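/- Let $k$ be an algebraically closed field of arbitrary characteristic and let $X$ be a scheme of finite type over $k$. For $m\in\mathbf{N}$ let $J_m(X)$ be the $m$-th jet scheme of $X$, i.e. the $k$-scheme representing $A\mapsto \mathrm{Hom}_k(\mathrm{Spec}\,A[t]/(t^{m+1}),X)$ on $k$-algebras $A$. For $p\le m$ let $\pi_{m,p}\colon J_m(X)\to J_p(X)$ be the projection induced by the truncations $A[t]/(t^{m+1})\to A[t]/(t^{p+1})$. A point of a jet scheme means a $k$-valued point, and a point of $J_m(X)$ is identified with the corresponding morphism $\mathrm{Spec}\,k[t]/(t^{m+1})\to X$. For an ideal sheaf $\mathcal I$ on $X$ and $e\le m$, $\mathrm{Cont}^e(\mathcal I)_m$ is the set of $\gamma\in J_m(X)$ such that the inverse image of $\mathcal I$ under $\gamma$ is the ideal $(t^e)$ of $k[t]/(t^{m+1})$. If $X$ has pure dimension $n$ (every irreducible component has dimension $n$), then $\mathrm{Jac}_X=\mathrm{Fitt}^n(\Omega_X)$ is the $n$-th Fitting ideal of the sheaf of differentials of $X$ over $k$. $X$ is a locally complete intersection (lci) if every point has an affine open neighbourhood that is isomorphic to a closed subscheme of some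 $\mathbf{A}^N$ whose ideal is generated by as many elements as its codimension. Given a morphism $g\colon V'\to V$ of $k$-schemes, sets of $k$-points $W'\subseteq V'$ and $W\subseteq V$, and a reduced $k$-scheme $F$, we say that $g$ induces a piecewise trivial fibration $W'\to W$ with fiber $F$ if $g(W')\subseteq W$ and there is a decomposition $W=T_1\sqcup\dots\sqcup T_r$ with every $T_i$ locally closed in $V$, such that every $W'\cap g^{-1}(T_i)$ is locally closed in $V'$ and, with the reduced scheme structures, there is an isomorphism $W'\cap g^{-1}(T_i)\simeq T_i\times F$ under which the restriction of $g$ corresponds to the first projection. (In particular $W$ and $W'$ are then constructible.) Then: (1) Let $p\le m\le 2p+1$ and let $\gamma\in J_p(X)$ be such that $\pi_{m,p}^{-1}(\gamma)\neq\emptyset$. Then there is an isomorphism of $k$-schemes $$\pi_{m,p}^{-1}(\gamma)\simeq \mathrm{Hom}_{k[t]/(t^{p+1})}\bigl(\gamma^*\Omega_X,(t^{p+1})/(t^{m+1})\bigr),$$ where the left-hand side is the scheme-theoretic fiber, and the right-hand side is the affine space attached to a finite-dimensional $k$-vector space (here $(t^{p+1})/(t^{m+1})$ is a $k[t]/(t^{p+1})$-module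 because $m\le 2p+1$). (2) Suppose that $X$ has pure dimension $n$ and is either reduced or lci, and let $m,p,e\in\mathbf{N}$ with $2p\ge m\ge p+e$. Then: (a) for every $\gamma\in\mathrm{Cont}^e(\mathrm{Jac}_X)_p$ with $\pi_{m,p}^{-1}(\gamma)\neq\emptyset$, the scheme-theoretic fiber satisfies $\pi_{m,p}^{-1}(\gamma)\simeq\mathbf{A}^{(m-p)n+e}$; (b) $\pi_{m,p}$ induces a piecewise trivial fibration $$\mathrm{Cont}^e(\mathrm{Jac}_X)_m\to\mathrm{Cont}^e(\mathrm{Jac}_X)_p\cap\mathrm{Im}(\pi_{m,p})$$ with fiber $\mathbf{A}^{(m-p)n+e}$. -/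

import Mathlib

open CategoryTheory Limits AlgebraicGeometry Opposite MonoidalCategory CartesianMonoidalCategory
open scoped TensorProduct Polynomial
universe v u

attribute [local instance] Over.cartesianMonoidalCategory

noncomputable section
namespace Jets

abbrev TruncPoly (A : Type u) [CommRing A] (m : ℕ) : Type u :=
  A[X] ⧸ Ideal.span {(Polynomial.X ^ (m + 1) : A[X])}

namespace TruncPoly
variable {A B R : Type u} [CommRing A] [CommRing B] [CommRing R] {m : ℕ}

def t (A : Type u) [CommRing A] (m : ℕ) : TruncPoly A m :=
  Ideal.Quotient.mk _ Polynomial.X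

lemma t_pow : t A m ^ (m + 1) = 0 := by
  rw [t, ← map_pow, Ideal.Quotient.eq_zero_iff_mem]
  exact Ideal.mem_span_singleton_self _

/-- The ring map `A[t]/(t^{m+1}) → B` with prescribed restriction to `A` and value at `t`. -/
def lift (f : A →+* B) (b : B) (hb : b ^ (m + 1) = 0) : TruncPoly A m →+* B :=
  Ideal.Quotient.lift _ (Polynomial.eval₂RingHom f b) fun a ha => by
    obtain ⟨c, rfl⟩ := Ideal.mem_span_singleton.1 ha
    simp [hb]

@[simp] lemma lift_algebraMap (f : A →+* B) (b : B) (hb : b ^ (m + 1) = 0) (a : A) :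
    lift f b hb (algebraMap A (TruncPoly A m) a) = f a := by
  change Ideal.Quotient.lift _ _ _ (Ideal.Quotient.mk _ (Polynomial.C a)) = _
  simp

@[simp] lemma lift_t (f : A →+* B) (b : B) (hb : b ^ (m + 1) = 0) : lift f b hb (t A m) = b := by
  simp [lift, t]

lemma hom_ext {f g : TruncPoly A m →+* B}
    (h : f.comp (algebraMap A _) = g.comp (algebraMap A _)) (ht : f (t A m) = g (t A m)) :
    f = g := by
  apply Ideal.Quotient.ringHom_ext
  apply Polynomial.ringHom_ext
  · intro a; exact congr($h a)
  · exact ht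

/-- Functoriality of `A ↦ A[t]/(t^{m+1})`. -/
def map (m : ℕ) (f : A →+* B) : TruncPoly A m →+* TruncPoly B m :=
  lift ((algebraMap B _).comp f) (t B m) t_pow

@[simp] lemma map_algebraMap (f : A →+* B) (a : A) :
    map m f (algebraMap A _ a) = algebraMap B _ (f a) := by simp [map]

@[simp] lemma map_t (f : A →+* B) : map m f (t A m) = t B m := by simp [map]

lemma isPushout (f : R →+* A) (m : ℕ) :
    IsPushout (CommRingCat.ofHom f) (CommRingCat.ofHom (algebraMap R (TruncPoly R m)))
      (CommRingCat.ofHom (algebraMap A (TruncPoly A m))) (CommRingCat.ofHom (map m f)) := by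
  refine ⟨⟨?_⟩, ⟨PushoutCocone.IsColimit.mk _ (fun s => CommRingCat.ofHom
    (lift s.inl.hom (s.inr.hom (t R m)) ?_)) ?_ ?_ ?_⟩⟩
  · ext a; simp
  · rw [← map_pow, t_pow, map_zero]
  · intro s; ext a; simp
  · intro s
    ext : 1
    apply hom_ext
    · ext a
      have := congr($(s.condition).hom a)
      simpa using this
    · simp
  · intro s q h1 h2
    ext : 1
    apply hom_ext
    · ext a; simpa using congr($(h1).hom a)
    · simpa using congr($(h2).hom (t R m))

end TruncPoly


namespace TruncPoly
section
variable {A B R : Type u} [CommRing A] [CommRing B] [CommRing R] {m : ℕ}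

/-- The coefficient of `t^i`. -/
def coeff (i : Fin (m + 1)) : TruncPoly A m →ₗ[A] A :=
  Submodule.liftQ ((Ideal.span {(Polynomial.X ^ (m + 1) : A[X])}).restrictScalars A)
    (Polynomial.lcoeff A i) (by
      intro x hx
      obtain ⟨q, rfl⟩ := Ideal.mem_span_singleton.1 hx
      simp [Polynomial.coeff_X_pow_mul', show ¬ (m + 1 ≤ (i : ℕ)) by omega])

lemma coeff_mk (i : Fin (m + 1)) (p : A[X]) :
    coeff i (Ideal.Quotient.mk _ p : TruncPoly A m) = p.coeff i := rfl

lemma ext_coeff {x y : TruncPoly A m} (h : ∀ i, coeff i x = coeff i y) : x = y := by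
  obtain ⟨p, rfl⟩ := Ideal.Quotient.mk_surjective x
  obtain ⟨q, rfl⟩ := Ideal.Quotient.mk_surjective y
  rw [Ideal.Quotient.eq, Ideal.mem_span_singleton, Polynomial.X_pow_dvd_iff]
  intro d hd
  have := h ⟨d, hd⟩
  simp only [coeff_mk] at this
  simp [this]

lemma coeff_map (f : A →+* B) (i : Fin (m + 1)) (x : TruncPoly A m) :
    coeff i (map m f x) = f (coeff i x) := by
  obtain ⟨p, rfl⟩ := Ideal.Quotient.mk_surjective x
  have : map m f (Ideal.Quotient.mk _ p) = Ideal.Quotient.mk _ (p.map f) := by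
    have := Polynomial.ringHom_ext (f := (map m f).comp (Ideal.Quotient.mk _))
      (g := (Ideal.Quotient.mk (Ideal.span {(Polynomial.X ^ (m + 1) : B[X])})).comp
        (Polynomial.mapRingHom f)) (fun a => by
          simp only [RingHom.comp_apply, Polynomial.coe_mapRingHom, Polynomial.map_C]
          exact map_algebraMap f a) (by
          simp only [RingHom.comp_apply, Polynomial.coe_mapRingHom, Polynomial.map_X]
          exact map_t f)
    exact congr($this p)
  rw [this, coeff_mk, coeff_mk, Polynomial.coeff_map]

/-- The element with given coefficients. -/
def ofCoeff (a : Fin (m + 1) → A) : TruncPoly A m :=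
  Ideal.Quotient.mk _ (∑ i : Fin (m + 1), Polynomial.monomial i (a i))

@[simp] lemma coeff_ofCoeff (a : Fin (m + 1) → A) (i) : coeff i (ofCoeff a) = a i := by
  rw [ofCoeff, coeff_mk, Polynomial.finsetSum_coeff]
  simp [Polynomial.coeff_monomial, Fin.val_inj]

lemma map_comp {C : Type u} [CommRing C] (g : B →+* C) (f : A →+* B) (x : TruncPoly A m) :
    map m (g.comp f) x = map m g (map m f x) :=
  ext_coeff fun i => by simp [coeff_map]

end

/-- The functor `A ↦ Hom(R, A[t]/(t^{m+1}))` on rings is representable. -/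
lemma exists_universal (R : Type u) [CommRing R] (m : ℕ) :
    ∃ (H : Type u) (_ : CommRing H) (φ : R →+* TruncPoly H m),
      ∀ (A : Type u) [CommRing A] (ψ : R →+* TruncPoly A m),
        ∃! f : H →+* A, (map m f).comp φ = ψ := by
  let P := MvPolynomial (R × Fin (m + 1)) ℤ
  let Φ : R → TruncPoly P m := fun r => ofCoeff fun i => MvPolynomial.X (r, i)
  let S : Set (TruncPoly P m) := {x | (∃ r s, x = Φ (r + s) - (Φ r + Φ s)) ∨
    (∃ r s, x = Φ (r * s) - Φ r * Φ s) ∨ x = Φ 1 - 1}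
  let J : Ideal P := Ideal.span {c | ∃ x ∈ S, ∃ i, c = coeff i x}
  have hJ : ∀ x ∈ S, map m (Ideal.Quotient.mk J) x = 0 := fun x hx => ext_coeff fun i => by
    rw [coeff_map, map_zero, Ideal.Quotient.eq_zero_iff_mem]
    exact Ideal.subset_span ⟨x, hx, i, rfl⟩
  let φ : R →+* TruncPoly (P ⧸ J) m := RingHom.mk'
    { toFun := fun r => map m (Ideal.Quotient.mk J) (Φ r)
      map_one' := by
        have := hJ (Φ 1 - 1) (Or.inr (Or.inr rfl))
        rwa [map_sub, map_one, sub_eq_zero] at this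
      map_mul' := fun r s => by
        have := hJ _ (Or.inr (Or.inl ⟨r, s, rfl⟩))
        rwa [map_sub, map_mul, sub_eq_zero] at this }
    (fun r s => by
        have := hJ _ (Or.inl ⟨r, s, rfl⟩)
        rwa [map_sub, map_add, sub_eq_zero] at this)
  have hφ : ∀ r, φ r = map m (Ideal.Quotient.mk J) (Φ r) := fun _ => rfl
  refine ⟨P ⧸ J, inferInstance, φ, fun A _ ψ => ?_⟩
  obtain ⟨e, heX⟩ : ∃ e : P →+* A, ∀ r i, e (MvPolynomial.X (r, i)) = coeff i (ψ r) :=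
    ⟨MvPolynomial.eval₂Hom (Int.castRingHom A) fun x => coeff x.2 (ψ x.1),
      fun r i => MvPolynomial.eval₂Hom_X' _ _ _⟩
  have he : ∀ r, map m e (Φ r) = ψ r := fun r => ext_coeff fun i => by
    rw [coeff_map, coeff_ofCoeff]
    exact heX r i
  have heS : ∀ x ∈ S, map m e x = 0 := by
    rintro x (⟨r, s, rfl⟩ | ⟨r, s, rfl⟩ | rfl) <;> simp [he]
  have heJ : ∀ a ∈ J, e a = 0 := by
    intro a ha
    have : J ≤ RingHom.ker e := by
      rw [Ideal.span_le]
      rintro c ⟨x, hx, i, rfl⟩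
      change e _ = 0
      rw [← coeff_map, heS x hx, map_zero]
    exact this ha
  refine ⟨Ideal.Quotient.lift J e heJ, ?_, ?_⟩
  · ext r : 1
    rw [RingHom.comp_apply, hφ, ← map_comp, ← he r]
    congr 1
  · intro g hg
    apply Ideal.Quotient.ringHom_ext
    apply MvPolynomial.ringHom_ext
    · intro n; simp
    · rintro ⟨r, i⟩
      have : coeff i (map m g (φ r)) = coeff i (ψ r) := by rw [← hg]; rfl
      rw [coeff_map, hφ, coeff_map] at this
      rw [coeff_ofCoeff] at this
      refine this.trans ?_
      rw [RingHom.comp_apply, Ideal.Quotient.lift_mk]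
      exact (heX r i).symm

end TruncPoly
/-! The thickening `S × Spec ℤ[t]/(t^{m+1})` of a scheme `S`, and the existence of jet schemes. -/
def base : Scheme.{u} := Spec (CommRingCat.of (ULift.{u} ℤ))
def baseTerminal : IsTerminal base.{u} := specULiftZIsTerminal
def disc (m : ℕ) : Scheme.{u} := Spec (CommRingCat.of (TruncPoly (ULift.{u} ℤ) m))
def toBase (S : Scheme.{u}) : S ⟶ base := baseTerminal.from S
lemma toBase_ext {S : Scheme.{u}} (f g : S ⟶ base) : f = g := baseTerminal.hom_ext _ _
def discHom (m : ℕ) : disc.{u} m ⟶ base := Spec.map (CommRingCat.ofHom (algebraMap _ _))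

def th (m : ℕ) (S : Scheme.{u}) : Scheme.{u} := pullback (toBase S) (discHom m)
def thFst (m : ℕ) (S : Scheme.{u}) : th m S ⟶ S := pullback.fst _ _
def thSnd (m : ℕ) (S : Scheme.{u}) : th m S ⟶ disc m := pullback.snd _ _

lemma isPullback_th (m : ℕ) (S : Scheme.{u}) :
    IsPullback (thFst m S) (thSnd m S) (toBase S) (discHom m) := IsPullback.of_hasPullback _ _

lemma th_hom_ext {m : ℕ} {S T : Scheme.{u}} {f g : T ⟶ th m S}
    (h1 : f ≫ thFst m S = g ≫ thFst m S) (h2 : f ≫ thSnd m S = g ≫ thSnd m S) : f = g :=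
  (isPullback_th m S).hom_ext h1 h2

def thLift {m : ℕ} {S T : Scheme.{u}} (f : T ⟶ S) (g : T ⟶ disc m) : T ⟶ th m S :=
  (isPullback_th m S).lift f g (toBase_ext _ _)

@[simp] lemma thLift_fst {m : ℕ} {S T : Scheme.{u}} (f : T ⟶ S) (g : T ⟶ disc m) :
    thLift f g ≫ thFst m S = f := (isPullback_th m S).lift_fst _ _ _

@[simp] lemma thLift_fst_assoc {m : ℕ} {S T Z : Scheme.{u}} (f : T ⟶ S) (g : T ⟶ disc m) (h : S ⟶ Z) :
    thLift f g ≫ thFst m S ≫ h = f ≫ h := by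
  simpa only [Category.assoc, Category.id_comp] using congrArg (· ≫ h) (thLift_fst f g)

@[simp] lemma thLift_snd {m : ℕ} {S T : Scheme.{u}} (f : T ⟶ S) (g : T ⟶ disc m) :
    thLift f g ≫ thSnd m S = g := (isPullback_th m S).lift_snd _ _ _

@[simp] lemma thLift_snd_assoc {m : ℕ} {S T Z : Scheme.{u}} (f : T ⟶ S) (g : T ⟶ disc m) (h : disc m ⟶ Z) :
    thLift f g ≫ thSnd m S ≫ h = g ≫ h := by
  simpa only [Category.assoc, Category.id_comp] using congrArg (· ≫ h) (thLift_snd f g)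

def thMap (m : ℕ) {S T : Scheme.{u}} (f : S ⟶ T) : th m S ⟶ th m T :=
  thLift (thFst m S ≫ f) (thSnd m S)

@[simp] lemma thMap_fst (m : ℕ) {S T : Scheme.{u}} (f : S ⟶ T) :
    thMap m f ≫ thFst m T = thFst m S ≫ f := by simp [thMap]

@[simp] lemma thMap_fst_assoc (m : ℕ) {S T Z : Scheme.{u}} (f : S ⟶ T) (h : T ⟶ Z) :
    thMap m f ≫ thFst m T ≫ h = thFst m S ≫ f ≫ h := by
  simpa only [Category.assoc, Category.id_comp] using congrArg (· ≫ h) (thMap_fst m f)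

@[simp] lemma thMap_snd (m : ℕ) {S T : Scheme.{u}} (f : S ⟶ T) :
    thMap m f ≫ thSnd m T = thSnd m S := by simp [thMap]

@[simp] lemma thMap_snd_assoc (m : ℕ) {S T Z : Scheme.{u}} (f : S ⟶ T) (h : disc m ⟶ Z) :
    thMap m f ≫ thSnd m T ≫ h = thSnd m S ≫ h := by
  simpa only [Category.assoc, Category.id_comp] using congrArg (· ≫ h) (thMap_snd m f)

lemma isPullback_thMap (m : ℕ) {S T : Scheme.{u}} (f : S ⟶ T) :
    IsPullback (thMap m f) (thFst m S) (thFst m T) f := by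
  refine IsPullback.of_right (h₁₂ := thSnd m T) (v₁₃ := discHom m) (h₂₂ := toBase T) ?_ ?_
    (isPullback_th m T).flip
  · have := (isPullback_th m S).flip
    convert this using 1
    · simp
    · exact toBase_ext _ _
  · simp

@[simp] lemma thMap_id (m : ℕ) (S : Scheme.{u}) : thMap m (𝟙 S) = 𝟙 _ := by
  apply th_hom_ext <;> simp

lemma thMap_comp (m : ℕ) {S T U : Scheme.{u}} (f : S ⟶ T) (g : T ⟶ U) :
    thMap m (f ≫ g) = thMap m f ≫ thMap m g := by
  apply th_hom_ext <;> simp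

lemma thMap_comp_assoc (m : ℕ) {S T U Z : Scheme.{u}} (f : S ⟶ T) (g : T ⟶ U) (h : th m U ⟶ Z) :
    thMap m (f ≫ g) ≫ h = thMap m f ≫ thMap m g ≫ h := by
  simpa only [Category.assoc, Category.id_comp] using congrArg (· ≫ h) (thMap_comp m f g)

instance thMap_open (m : ℕ) {S T : Scheme.{u}} (f : S ⟶ T) [IsOpenImmersion f] :
    IsOpenImmersion (thMap m f) :=
  MorphismProperty.of_isPullback (isPullback_thMap m f).flip inferInstance

def zeroSecBase (m : ℕ) : base.{u} ⟶ disc m := Spec.map (CommRingCat.ofHom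
    (TruncPoly.lift (m := m) (RingHom.id _) 0 (by simp)))

/-- zero section -/
def zeroSec (m : ℕ) (S : Scheme.{u}) : S ⟶ th m S := thLift (𝟙 S) (toBase S ≫ zeroSecBase m)

@[simp] lemma zeroSec_fst (m : ℕ) (S : Scheme.{u}) :
    zeroSec m S ≫ thFst m S = 𝟙 S := by
  simp [zeroSec]

@[simp] lemma zeroSec_fst_assoc (m : ℕ) (S : Scheme.{u}) {Z : Scheme.{u}} (h : S ⟶ Z) :
    zeroSec m S ≫ thFst m S ≫ h = h := by
  simpa only [Category.assoc, Category.id_comp] using congrArg (· ≫ h) (zeroSec_fst m S)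

@[simp] lemma zeroSec_snd (m : ℕ) (S : Scheme.{u}) :
    zeroSec m S ≫ thSnd m S = toBase S ≫ zeroSecBase m := by
  simp [zeroSec]

@[simp] lemma zeroSec_snd_assoc (m : ℕ) (S : Scheme.{u}) {Z : Scheme.{u}} (h : disc m ⟶ Z) :
    zeroSec m S ≫ thSnd m S ≫ h = toBase S ≫ zeroSecBase m ≫ h := by
  simpa only [Category.assoc, Category.id_comp] using congrArg (· ≫ h) (zeroSec_snd m S)

lemma zeroSec_nat (m : ℕ) {S T : Scheme.{u}} (f : S ⟶ T) :
    f ≫ zeroSec m T = zeroSec m S ≫ thMap m f := by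
  apply th_hom_ext
  · simp
  · simp only [Category.assoc, zeroSec_snd, thMap_snd]
    rw [← Category.assoc]; congr 1; exact toBase_ext _ _

lemma zeroSec_nat_assoc (m : ℕ) {S T Z : Scheme.{u}} (f : S ⟶ T) (h : th m T ⟶ Z) :
    f ≫ zeroSec m T ≫ h = zeroSec m S ≫ thMap m f ≫ h := by
  simpa only [Category.assoc, Category.id_comp] using congrArg (· ≫ h) (zeroSec_nat m f)

instance (m : ℕ) : Surjective (zeroSecBase.{u} m) := by
  constructor
  set φ := TruncPoly.lift (m := m) (RingHom.id (ULift.{u} ℤ)) 0 (by simp) with hφ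
  have hs : Function.Surjective φ := fun a => ⟨algebraMap _ _ a, by simp [hφ]⟩
  intro x
  have hx : (x : PrimeSpectrum (TruncPoly (ULift.{u} ℤ) m)) ∈ Set.range (PrimeSpectrum.comap φ) := by
    rw [range_comap_of_surjective _ _ hs]
    intro a ha
    obtain ⟨p, rfl⟩ := Ideal.Quotient.mk_surjective a
    have hp : p.eval 0 = 0 := by
      have : Polynomial.eval₂ (RingHom.id (ULift.{u} ℤ)) 0 p = 0 := ha
      rwa [Polynomial.eval₂_id] at this
    obtain ⟨q, rfl⟩ : Polynomial.X ∣ p := by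
      rwa [Polynomial.X_dvd_iff, Polynomial.coeff_zero_eq_eval_zero]
    refine Ideal.IsPrime.mem_of_pow_mem x.isPrime (m + 1) ?_
    have : (Ideal.Quotient.mk (Ideal.span {(Polynomial.X ^ (m + 1) : (ULift.{u} ℤ)[X])})
        (Polynomial.X * q)) ^ (m + 1) = 0 := by
      rw [← map_pow, mul_pow, Ideal.Quotient.eq_zero_iff_mem]
      exact Ideal.mul_mem_right _ _ (Ideal.mem_span_singleton_self _)
    rw [this]
    exact zero_mem _
  exact hx

instance (m : ℕ) (S : Scheme.{u}) : Surjective (zeroSec m S) := by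
  have : IsPullback (toBase S) (zeroSec m S) (zeroSecBase m) (thSnd m S) := by
    refine IsPullback.of_bot (h₃₁ := toBase S) (v₂₁ := thFst m S) (v₂₂ := discHom m) ?_ (by simp)
      (isPullback_th m S).flip
    have h : IsIso (zeroSec m S ≫ thFst m S) := by rw [zeroSec_fst]; infer_instance
    have h' : IsIso (zeroSecBase.{u} m ≫ discHom m) := by
      rw [toBase_ext (zeroSecBase.{u} m ≫ discHom m) (𝟙 _)]; infer_instance
    exact IsPullback.of_vert_isIso ⟨toBase_ext _ _⟩
  exact MorphismProperty.of_isPullback this inferInstance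

/-- The thickening of an open cover. -/
def thCover (m : ℕ) {S : Scheme.{u}} (𝒰 : Scheme.OpenCover.{v} S) : Scheme.OpenCover.{v} (th m S) :=
  .mkOfCovers 𝒰.I₀ (fun i => th m (𝒰.X i)) (fun i => thMap m (𝒰.f i)) (fun x => by
    obtain ⟨i, y, hy⟩ := 𝒰.exists_eq (thFst m S x)
    obtain ⟨z, hz, -⟩ := Scheme.exists_preimage_of_isPullback (isPullback_thMap m (𝒰.f i)) x y hy.symm
    exact ⟨i, z, hz⟩) (fun i => inferInstanceAs (IsOpenImmersion _))

/-- Morphisms out of the thickening are determined on the thickening of an open cover. -/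
lemma th_hom_ext_cover {m : ℕ} {S X : Scheme.{u}} (𝒰 : Scheme.OpenCover.{v} S) {f g : th m S ⟶ X}
    (h : ∀ i, thMap m (𝒰.f i) ≫ f = thMap m (𝒰.f i) ≫ g) : f = g :=
  Scheme.Cover.hom_ext (thCover m 𝒰) _ _ h

lemma th_isPullback (m : ℕ) {P A B C : Scheme.{u}} {f : P ⟶ A} {g : P ⟶ B} {h : A ⟶ C} {i : B ⟶ C}
    (sq : IsPullback f g h i) : IsPullback (thMap m f) (thMap m g) (thMap m h) (thMap m i) := by
  refine IsPullback.of_right (h₁₂ := thFst m A) (v₁₃ := h) (h₂₂ := thFst m C) ?_ ?_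
    (isPullback_thMap m h).flip
  · rw [thMap_fst, thMap_fst]
    exact (isPullback_thMap m g).flip.paste_horiz sq
  · rw [← thMap_comp, ← thMap_comp, sq.w]

/-- Gluing of morphisms out of the thickening. -/
lemma th_glue {m : ℕ} {S X : Scheme.{u}} (𝒰 : Scheme.OpenCover.{v} S) (f : ∀ i, th m (𝒰.X i) ⟶ X)
    (h : ∀ i j, thMap m (pullback.fst (𝒰.f i) (𝒰.f j)) ≫ f i =
      thMap m (pullback.snd (𝒰.f i) (𝒰.f j)) ≫ f j) :
    ∃ g : th m S ⟶ X, ∀ i, thMap m (𝒰.f i) ≫ g = f i := by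
  refine ⟨(thCover m 𝒰).glueMorphisms f fun i j => ?_, fun i =>
    (thCover m 𝒰).ι_glueMorphisms f _ i⟩
  have sq := th_isPullback m (IsPullback.of_hasPullback (𝒰.f i) (𝒰.f j))
  refine (cancel_epi sq.isoPullback.hom).1 ?_
  have h1 : sq.isoPullback.hom ≫ pullback.fst ((thCover m 𝒰).f i) ((thCover m 𝒰).f j) = _ :=
    sq.isoPullback_hom_fst
  have h2 : sq.isoPullback.hom ≫ pullback.snd ((thCover m 𝒰).f i) ((thCover m 𝒰).f j) = _ :=
    sq.isoPullback_hom_snd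
  exact ((Category.assoc _ _ _).symm.trans (congrArg (· ≫ f i) h1)).trans ((h i j).trans
    ((Category.assoc _ _ _).symm.trans (congrArg (· ≫ f j) h2)).symm)

/-- The presheaf `S ↦ Hom(S × Spec ℤ[t]/(t^{m+1}), X)`. -/
def thPresheaf (m : ℕ) (X : Scheme.{u}) : Scheme.{u}ᵒᵖ ⥤ Type u where
  obj S := th m S.unop ⟶ X
  map f := ↾ (fun g => thMap m f.unop ≫ g)
  map_id S := by ext; simp
  map_comp f g := by ext; simp [thMap_comp]

lemma thPresheaf_isSheaf (m : ℕ) (X : Scheme.{u}) :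
    Presheaf.IsSheaf Scheme.zariskiTopology (thPresheaf m X) := by
  rw [isSheaf_iff_isSheaf_of_type, Precoverage.isSheaf_toGrothendieck_iff_of_isStableUnderBaseChange]
  rintro Y S hS x hx
  obtain ⟨(𝓤 : Scheme.OpenCover Y), rfl⟩ := Scheme.exists_cover_of_mem_pretopology hS
  obtain ⟨g, hg⟩ := th_glue (X := X) 𝓤 (fun i => x (𝓤.f i) (.mk _)) (fun i j =>
    hx (pullback.fst (𝓤.f i) (𝓤.f j)) (pullback.snd (𝓤.f i) (𝓤.f j)) _ _ pullback.condition)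
  refine ⟨g, ?_, ?_⟩
  · rintro Z e ⟨j⟩
    exact hg j
  · intro e' h
    exact th_hom_ext_cover 𝓤 fun j => (h (𝓤.f j) (.mk j)).trans (hg j).symm


/-- The unique ring map `ℤ → A`. -/
def intHom (A : Type u) [CommRing A] : ULift.{u} ℤ →+* A :=
  (Int.castRingHom A).comp ULift.ringEquiv.toRingHom

lemma intHom_comp {A B : Type u} [CommRing A] [CommRing B] (f : A →+* B) :
    f.comp (intHom A) = intHom B := by
  ext ⟨n⟩; simp [intHom]

lemma isPullback_spec (m : ℕ) (A : Type u) [CommRing A] :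
    IsPullback (Spec.map (CommRingCat.ofHom (algebraMap A (TruncPoly A m))))
      (Spec.map (CommRingCat.ofHom (TruncPoly.map m (intHom A))))
      (toBase (Spec (CommRingCat.of A))) (discHom m) := by
  have := (isPullback_SpecMap_of_isPushout _ _ _ _ (TruncPoly.isPushout (intHom A) m).flip).flip
  rwa [show Spec.map (CommRingCat.ofHom (intHom A)) = toBase _ from
    toBase_ext _ _] at this

/-- `Spec A[t]/(t^{m+1})` is the thickening of `Spec A`. -/
def specIso (m : ℕ) (A : Type u) [CommRing A] :
    Spec (CommRingCat.of (TruncPoly A m)) ≅ th m (Spec (CommRingCat.of A)) :=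
  (isPullback_spec m A).isoIsPullback _ _ (isPullback_th m _)

@[simp] lemma specIso_hom_fst (m : ℕ) (A : Type u) [CommRing A] :
    (specIso m A).hom ≫ thFst m _ = Spec.map (CommRingCat.ofHom (algebraMap A (TruncPoly A m))) :=
  IsPullback.isoIsPullback_hom_fst ..

@[simp] lemma specIso_hom_fst_assoc (m : ℕ) (A : Type u) [CommRing A] {Z : Scheme.{u}} (h : Spec (CommRingCat.of A) ⟶ Z) :
    (specIso m A).hom ≫ thFst m _ ≫ h =
      Spec.map (CommRingCat.ofHom (algebraMap A (TruncPoly A m))) ≫ h := by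
  simpa only [Category.assoc, Category.id_comp] using congrArg (· ≫ h) (specIso_hom_fst m A)

@[simp] lemma specIso_hom_snd (m : ℕ) (A : Type u) [CommRing A] :
    (specIso m A).hom ≫ thSnd m _ =
      Spec.map (CommRingCat.ofHom (TruncPoly.map m (intHom A))) :=
  IsPullback.isoIsPullback_hom_snd ..

@[simp] lemma specIso_hom_snd_assoc (m : ℕ) (A : Type u) [CommRing A] {Z : Scheme.{u}} (h : disc m ⟶ Z) :
    (specIso m A).hom ≫ thSnd m _ ≫ h =
      Spec.map (CommRingCat.ofHom (TruncPoly.map m (intHom A))) ≫ h := by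
  exact (Category.assoc _ _ _).symm.trans (congrArg (· ≫ h) (specIso_hom_snd m A))

lemma specIso_nat (m : ℕ) {A B : Type u} [CommRing A] [CommRing B] (f : A →+* B) :
    (specIso m B).hom ≫ thMap m (Spec.map (CommRingCat.ofHom f)) =
      Spec.map (CommRingCat.ofHom (TruncPoly.map m f)) ≫ (specIso m A).hom := by
  apply th_hom_ext
  · simp only [Category.assoc, thMap_fst, specIso_hom_fst, specIso_hom_fst_assoc, ← Spec.map_comp,
      ← CommRingCat.ofHom_comp]
    congr 2
    ext a; simp
  · rw [Category.assoc, Category.assoc, thMap_snd, specIso_hom_snd, specIso_hom_snd,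
      ← intHom_comp f]
    refine Eq.trans ?_ (Spec.map_comp _ _)
    rw [← CommRingCat.ofHom_comp]
    congr 2
    exact RingHom.ext fun x => TruncPoly.map_comp _ _ _

lemma specIso_nat_assoc (m : ℕ) {A B : Type u} [CommRing A] [CommRing B] (f : A →+* B) {Z : Scheme.{u}}
    (h : th m (Spec (CommRingCat.of A)) ⟶ Z) :
    (specIso m B).hom ≫ thMap m (Spec.map (CommRingCat.ofHom f)) ≫ h =
      Spec.map (CommRingCat.ofHom (TruncPoly.map m f)) ≫ (specIso m A).hom ≫ h := by
  simpa only [Category.assoc, Category.id_comp] using congrArg (· ≫ h) (specIso_nat m f)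

/-- A representability statement which holds on affine schemes holds on all schemes. -/
lemma exists_affine_aux {m : ℕ} {H X : Scheme.{u}} (u : th m H ⟶ X)
    (aff : ∀ (T : Scheme.{u}) [IsAffine T] (g : th m T ⟶ X), ∃! f : T ⟶ H, thMap m f ≫ u = g)
    (S : Scheme.{u}) (g : th m S ⟶ X) : ∃! f : S ⟶ H, thMap m f ≫ u = g := by
  have inj : ∀ (T : Scheme.{u}) (a b : T ⟶ H),
      thMap m a ≫ u = thMap m b ≫ u → a = b := by
    intro T a b hab
    refine Scheme.Cover.hom_ext T.affineCover _ _ fun i => ?_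
    refine (aff _ (thMap m (T.affineCover.f i) ≫ thMap m a ≫ u)).unique ?_ ?_
    · rw [thMap_comp_assoc]
    · rw [thMap_comp_assoc, hab]
  have hex : ∀ i, ∃ f : S.affineCover.X i ⟶ H,
      thMap m f ≫ u = thMap m (S.affineCover.f i) ≫ g := fun i => (aff _ _).exists
  choose f hf using hex
  have hglue : ∀ i j, pullback.fst (S.affineCover.f i) (S.affineCover.f j) ≫ f i =
      pullback.snd (S.affineCover.f i) (S.affineCover.f j) ≫ f j := by
    intro i j
    apply inj
    rw [thMap_comp_assoc, thMap_comp_assoc, hf, hf, ← thMap_comp_assoc, ← thMap_comp_assoc,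
      pullback.condition]
  have hgl : thMap m (S.affineCover.glueMorphisms f hglue) ≫ u = g := by
    refine th_hom_ext_cover S.affineCover fun i => ?_
    rw [← thMap_comp_assoc, S.affineCover.ι_glueMorphisms]
    exact hf i
  exact ⟨_, hgl, fun f' hf' => inj _ _ _ (hf'.trans hgl.symm)⟩

/-- `Hom(S × Spec ℤ[t]/(t^{m+1}), Spec R)` is represented by an affine scheme. -/
lemma exists_affine (m : ℕ) (R : CommRingCat.{u}) :
    ∃ (H : Scheme.{u}) (u : th m H ⟶ Spec R), ∀ (S : Scheme.{u}) (g : th m S ⟶ Spec R),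
      ∃! f : S ⟶ H, thMap m f ≫ u = g := by
  obtain ⟨H, _, φ, hφ⟩ := TruncPoly.exists_universal R m
  let u : th m (Spec (CommRingCat.of H)) ⟶ Spec R :=
    (specIso m H).inv ≫ Spec.map (CommRingCat.ofHom φ)
  have key : ∀ (A : Type u) [CommRing A] (f : H →+* A),
      (specIso m A).hom ≫ thMap m (Spec.map (CommRingCat.ofHom f)) ≫ u =
        Spec.map (CommRingCat.ofHom ((TruncPoly.map m f).comp φ)) := by
    intro A _ f
    rw [specIso_nat_assoc, Iso.hom_inv_id_assoc, ← Spec.map_comp]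
    rfl
  have aff : ∀ (A : CommRingCat.{u}) (g : th m (Spec A) ⟶ Spec R),
      ∃! f : Spec A ⟶ Spec (CommRingCat.of H), thMap m f ≫ u = g := by
    intro A g
    obtain ⟨ψ, hψ⟩ := Spec.map_surjective ((specIso m A).hom ≫ g)
    obtain ⟨f, hf, huniq⟩ := hφ A ψ.hom
    refine ⟨Spec.map (CommRingCat.ofHom f), ?_, ?_⟩
    · refine (cancel_epi (specIso m A).hom).1 ?_
      rw [key, hf, ← hψ]; rfl
    · intro f' hf'
      obtain ⟨f', rfl⟩ := Spec.map_surjective f'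
      have := key A f'.hom
      have h2 : CommRingCat.ofHom f'.hom = f' := rfl
      rw [h2, hf', ← hψ] at this
      have h3 := Spec.map_injective this
      have h4 := huniq f'.hom (by simpa using congr($(h3).hom).symm)
      rw [← h4]; rfl
  refine ⟨Spec (CommRingCat.of H), u, exists_affine_aux u fun T _ g => ?_⟩
  obtain ⟨f, hf, hu⟩ := aff _ (thMap m T.isoSpec.inv ≫ g)
  refine ⟨T.isoSpec.hom ≫ f, ?_, fun f' hf' => ?_⟩
  · simp only [thMap_comp_assoc]
    rw [hf, ← thMap_comp_assoc]; simp
  · rw [← hu (T.isoSpec.inv ≫ f') (by simp only [thMap_comp_assoc]; rw [hf'])]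
    simp

lemma range_thMap_comp (m : ℕ) {S X : Scheme.{u}} (g : th m S ⟶ X) {T : Scheme.{u}} (q : T ⟶ S) :
    Set.range (thMap m q ≫ g) = Set.range (q ≫ zeroSec m S ≫ g) := by
  rw [zeroSec_nat_assoc]
  ext x
  simp only [Set.mem_range, Scheme.Hom.comp_apply]
  constructor
  · rintro ⟨y, rfl⟩
    obtain ⟨z, rfl⟩ := (zeroSec m T).surjective y
    exact ⟨z, rfl⟩
  · rintro ⟨y, rfl⟩
    exact ⟨_, rfl⟩

/-- The morphism of presheaves given by a morphism from a thickening. -/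
def thHom {m : ℕ} {H X : Scheme.{u}} (u : th m H ⟶ X) : yoneda.obj H ⟶ thPresheaf m X :=
  yonedaEquiv.symm u

lemma thHom_app {m : ℕ} {H X : Scheme.{u}} (u : th m H ⟶ X) (T : Scheme.{u}) (f : T ⟶ H) :
    (thHom u).app (op T) f = thMap m f ≫ u := rfl

lemma thHom_presheaf {m : ℕ} {H Y X : Scheme.{u}} (u : th m H ⟶ Y) (j : Y ⟶ X) [IsOpenImmersion j]
    (hu : ∀ (S : Scheme.{u}) (g : th m S ⟶ Y), ∃! f : S ⟶ H, thMap m f ≫ u = g) :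
    IsOpenImmersion.presheaf (thHom (u ≫ j)) := by
  apply MorphismProperty.relative.of_exists
  intro S g
  obtain ⟨g, rfl⟩ := yonedaEquiv.symm.surjective g
  change th m S ⟶ X at g
  let V : S.Opens := (zeroSec m S ≫ g) ⁻¹ᵁ j.opensRange
  have hV : Set.range (thMap m V.ι ≫ g) ⊆ Set.range j := by
    rw [range_thMap_comp]
    rintro _ ⟨x, rfl⟩
    exact x.2
  obtain ⟨f, hf, -⟩ := hu _ (IsOpenImmersion.lift j (thMap m V.ι ≫ g) hV)
  have hf' : thMap m f ≫ u ≫ j = thMap m V.ι ≫ g := by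
    rw [← Category.assoc, hf, IsOpenImmersion.lift_fac]
  refine ⟨V, yoneda.map f, V.ι, ⟨⟨?_⟩, ⟨?_⟩⟩, inferInstance⟩
  · ext T x
    change thMap m (x ≫ f) ≫ u ≫ j = thMap m (x ≫ V.ι) ≫ g
    rw [thMap_comp_assoc, thMap_comp_assoc, hf']
  · have hfac : ∀ (s : PullbackCone (thHom (u ≫ j)) (yonedaEquiv.symm g)) (T : Scheme.{u}ᵒᵖ)
        (x : s.pt.obj T), thMap m (s.fst.app T x) ≫ u ≫ j = thMap m (s.snd.app T x) ≫ g :=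
      fun s T x => congr($(NatTrans.congr_app s.condition T) x)
    have hr : ∀ (s : PullbackCone (thHom (u ≫ j)) (yonedaEquiv.symm g)) (T : Scheme.{u}ᵒᵖ)
        (x : s.pt.obj T), Set.range (show T.unop ⟶ S from s.snd.app T x) ⊆ Set.range V.ι := by
      intro s T x
      have h1 := range_thMap_comp m g (show T.unop ⟶ S from s.snd.app T x)
      have h2 : Set.range (thMap m (show T.unop ⟶ S from s.snd.app T x) ≫ g) ⊆ Set.range j := by
        rw [← hfac]
        rintro _ ⟨y, rfl⟩
        exact ⟨(thMap m (show T.unop ⟶ H from s.fst.app T x) ≫ u) y, by simp⟩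
      rw [h1] at h2
      rintro _ ⟨y, rfl⟩
      have := h2 ⟨y, rfl⟩
      rw [Scheme.Opens.range_ι]
      rw [Scheme.Hom.comp_apply] at this
      exact this
    let L : ∀ (s : PullbackCone (thHom (u ≫ j)) (yonedaEquiv.symm g)), s.pt ⟶ yoneda.obj V.toScheme :=
      fun s => NatTrans.mk (fun T => ↾ (fun x =>
        IsOpenImmersion.lift V.ι (show T.unop ⟶ S from s.snd.app T x) (hr s T x)))
        (by
          intro T T' q
          ext x
          refine (cancel_mono V.ι).1 ?_
          refine (IsOpenImmersion.lift_fac _ _ _).trans ?_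
          refine Eq.trans ?_ (Category.assoc _ _ _).symm
          refine Eq.trans ?_ (congrArg (q.unop ≫ ·) (IsOpenImmersion.lift_fac _ _ _).symm)
          exact congr($(s.snd.naturality q) x))
    have hL : ∀ s (T : Scheme.{u}ᵒᵖ) (x : s.pt.obj T),
        (show T.unop ⟶ V.toScheme from (L s).app T x) ≫ V.ι = s.snd.app T x :=
      fun s T x => IsOpenImmersion.lift_fac _ _ _
    refine PullbackCone.IsLimit.mk _ L ?_ ?_ ?_
    · intro s
      ext T x
      change (show T.unop ⟶ V.toScheme from (L s).app T x) ≫ f = s.fst.app T x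
      refine (hu _ (thMap m (show T.unop ⟶ H from s.fst.app T x) ≫ u)).unique ?_ rfl
      refine (cancel_mono j).1 ?_
      rw [Category.assoc, Category.assoc, hfac s T x, thMap_comp_assoc, hf', ← hL s T x,
        thMap_comp_assoc]
    · intro s
      ext T x
      exact hL s T x
    · intro s q h1 h2
      ext T x
      refine (cancel_mono V.ι).1 ?_
      refine Eq.trans ?_ (hL s T x).symm
      exact congr($(NatTrans.congr_app h2 T) x)

/-- Gluing: the presheaf is representable. -/
lemma exists_abs (m : ℕ) (X : Scheme.{u}) :
    ∃ (J : Scheme.{u}) (u : th m J ⟶ X), ∀ (S : Scheme.{u}) (g : th m S ⟶ X),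
      ∃! f : S ⟶ J, thMap m f ≫ u = g := by
  choose H u hu using fun U : X.affineOpens => exists_affine m Γ(X, U)
  let F : Sheaf Scheme.zariskiTopology (Type u) := ⟨thPresheaf m X, thPresheaf_isSheaf m X⟩
  let f : ∀ U : X.affineOpens, yoneda.obj (H U) ⟶ F.1 := fun U => thHom (u U ≫ IsAffineOpen.fromSpec U.2)
  have hf : ∀ U, IsOpenImmersion.presheaf (f U) := fun (U : X.affineOpens) =>
    have : IsOpenImmersion (IsAffineOpen.fromSpec U.2) := IsAffineOpen.isOpenImmersion_fromSpec U.2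
    thHom_presheaf (u U) (IsAffineOpen.fromSpec U.2) (hu U)
  have : Presheaf.IsLocallySurjective Scheme.zariskiTopology (Sigma.desc f) := by
    constructor
    intro S g
    change th m S ⟶ X at g
    let V : X.affineOpens → S.Opens := fun U => (zeroSec m S ≫ g) ⁻¹ᵁ U
    have hloc : ∀ U : X.affineOpens, ∃ a : (V U).toScheme ⟶ H U,
        thMap m a ≫ u U ≫ IsAffineOpen.fromSpec U.2 = thMap m (V U).ι ≫ g := by
      intro U
      have hV : Set.range (thMap m (V U).ι ≫ g) ⊆ Set.range (IsAffineOpen.fromSpec U.2) := by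
        rw [range_thMap_comp]
        refine Set.Subset.trans ?_ (IsAffineOpen.range_fromSpec U.2).ge
        rintro _ ⟨x, rfl⟩
        exact x.2
      have : IsOpenImmersion (IsAffineOpen.fromSpec U.2) :=
        IsAffineOpen.isOpenImmersion_fromSpec U.2
      obtain ⟨a, ha, -⟩ := hu U _ (IsOpenImmersion.lift (IsAffineOpen.fromSpec U.2) _ hV)
      exact ⟨a, by rw [← Category.assoc, ha, IsOpenImmersion.lift_fac]⟩
    let 𝒰 : S.OpenCover := S.openCoverOfIsOpenCover V (by
      rw [TopologicalSpace.IsOpenCover, eq_top_iff]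
      intro x _
      obtain ⟨_, ⟨U, hU, rfl⟩, hxU, -⟩ := X.isBasis_affineOpens.exists_subset_of_mem_open (Set.mem_univ ((zeroSec m S ≫ g) x)) isOpen_univ
      exact TopologicalSpace.Opens.mem_iSup.2 ⟨⟨U, hU⟩, hxU⟩)
    refine GrothendieckTopology.superset_covering _ ?_ 𝒰.mem_grothendieckTopology
    rw [Sieve.ofArrows, Sieve.generate_le_iff]
    rintro _ _ ⟨U⟩
    obtain ⟨a, ha⟩ := hloc U
    refine ⟨(Sigma.ι (fun U => yoneda.obj (H U)) U).app (op (V U).toScheme) a, ?_⟩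
    have h1 := congr($(NatTrans.congr_app (Sigma.ι_desc f U) (op (V U).toScheme)) a)
    refine Eq.trans h1 ?_
    change thMap m a ≫ u U ≫ IsAffineOpen.fromSpec U.2 = thMap m (V U).ι ≫ g
    exact ha
  obtain ⟨J, ⟨r⟩⟩ := Scheme.LocalRepresentability.isRepresentable (F := F) (f := f) hf
  refine ⟨J, r.homEquiv (𝟙 J), fun S g => ?_⟩
  have hr : ∀ q : S ⟶ J, thMap m q ≫ (r.homEquiv (𝟙 J) : th m J ⟶ X) = r.homEquiv q := fun q => by
    have := r.homEquiv_comp q (𝟙 J)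
    rw [Category.comp_id] at this
    exact this.symm
  refine ⟨r.homEquiv.symm g, ?_, fun q hq => ?_⟩
  · exact (hr _).trans (r.homEquiv.apply_symm_apply g)
  · exact (r.homEquiv.symm_apply_eq.2 ((hr q).symm.trans hq).symm).symm


/-- The category of schemes over `k`. -/
abbrev SchOver (k : Type u) [Field k] := Over (Spec (CommRingCat.of k))

section
variable {k : Type u} [Field k]

/-- `Spec A` as a scheme over `k`. -/
abbrev specOver (k : Type u) [Field k] (A : Type u) [CommRing A] [Algebra k A] : SchOver k :=
  Over.mk (Spec.map (CommRingCat.ofHom (algebraMap k A)))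

/-- The functor `T ↦ Hom_k(T × Spec k[t]/(t^{m+1}), X)` on schemes over `k`. -/
def jetFunctor (X : SchOver k) (m : ℕ) : (SchOver k)ᵒᵖ ⥤ Type u :=
  (tensorRight (specOver k (TruncPoly k m))).op ⋙ yoneda.obj X

lemma isPullback_tensor (T : SchOver k) (m : ℕ) :
    IsPullback (pullback.fst T.hom (specOver k (TruncPoly k m)).hom)
      (pullback.snd T.hom (specOver k (TruncPoly k m)).hom ≫
        Spec.map (CommRingCat.ofHom (TruncPoly.map m (intHom k))))
      (toBase T.left) (discHom m) := by
  have := (IsPullback.of_hasPullback T.hom (specOver k (TruncPoly k m)).hom).paste_vert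
    (isPullback_spec m k)
  rwa [show T.hom ≫ toBase _ = toBase _ from toBase_ext _ _] at this

def tensorIso (T : SchOver k) (m : ℕ) :
    (T ⊗ specOver k (TruncPoly k m)).left ≅ th m T.left :=
  (isPullback_tensor T m).isoIsPullback _ _ (isPullback_th m T.left)

lemma tensorIso_hom_fst (T : SchOver k) (m : ℕ) :
    (tensorIso T m).hom ≫ thFst m T.left = pullback.fst _ _ :=
  IsPullback.isoIsPullback_hom_fst ..

lemma tensorIso_hom_fst_assoc (T : SchOver k) (m : ℕ) {Z : Scheme.{u}} (h : T.left ⟶ Z) :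
    (tensorIso T m).hom ≫ thFst m T.left ≫ h = pullback.fst _ _ ≫ h :=
  (Category.assoc _ _ _).symm.trans (congrArg (· ≫ h) (tensorIso_hom_fst T m))

lemma tensorIso_hom_snd (T : SchOver k) (m : ℕ) :
    (tensorIso T m).hom ≫ thSnd m T.left = pullback.snd _ _ ≫
        Spec.map (CommRingCat.ofHom (TruncPoly.map m (intHom k))) :=
  IsPullback.isoIsPullback_hom_snd ..

lemma tensorIso_nat {T T' : SchOver k} (m : ℕ) (f : T ⟶ T') :
    (f ▷ specOver k (TruncPoly k m)).left ≫ (tensorIso T' m).hom =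
      (tensorIso T m).hom ≫ thMap m f.left := by
  apply th_hom_ext
  · rw [Category.assoc, Category.assoc, tensorIso_hom_fst, thMap_fst, ← Category.assoc,
      tensorIso_hom_fst]
    exact Over.whiskerRight_left_fst f
  · rw [Category.assoc, Category.assoc, tensorIso_hom_snd, thMap_snd, tensorIso_hom_snd]
    exact Over.whiskerRight_left_snd_assoc f _

theorem jetFunctor_isRepresentable (X : SchOver k) (m : ℕ) : (jetFunctor X m).IsRepresentable := by
  obtain ⟨JX, uX, hX⟩ := exists_abs m X.left
  obtain ⟨JB, uB, hB⟩ := exists_abs m (Spec (CommRingCat.of k))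
  obtain ⟨a, ha, -⟩ := hB _ (uX ≫ X.hom)
  obtain ⟨c, hc, -⟩ := hB _ (thFst m (Spec (CommRingCat.of k)))
  let J : SchOver k := Over.mk (pullback.snd a c)
  have hJ : thMap m (pullback.fst a c) ≫ uX ≫ X.hom = thFst m _ ≫ pullback.snd a c := by
    rw [← ha, ← thMap_comp_assoc, pullback.condition, thMap_comp_assoc, hc, thMap_fst]
  let ξ : J ⊗ specOver k (TruncPoly k m) ⟶ X :=
    Over.homMk ((tensorIso J m).hom ≫ thMap m (pullback.fst a c) ≫ uX) (by
      rw [Category.assoc, Category.assoc, hJ]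
      exact (Category.assoc _ _ _).symm.trans (congrArg (· ≫ pullback.snd a c) (tensorIso_hom_fst J m)))
  have hξ : ∀ (T : SchOver k) (f : T ⟶ J), (f ▷ specOver k (TruncPoly k m) ≫ ξ).left =
      (tensorIso T m).hom ≫ thMap m (f.left ≫ pullback.fst a c) ≫ uX := by
    intro T f
    rw [Over.comp_left, thMap_comp_assoc]
    change _ ≫ (tensorIso J m).hom ≫ _ ≫ _ = _
    rw [← Category.assoc, tensorIso_nat, Category.assoc]
  have hbij : ∀ T : SchOver k, Function.Bijective
      (fun f : T ⟶ J => (f ▷ specOver k (TruncPoly k m) ≫ ξ : T ⊗ specOver k (TruncPoly k m) ⟶ X)) := by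
    intro T
    constructor
    · intro f g hfg
      have h1 := congr(($hfg).left)
      rw [hξ, hξ, cancel_epi] at h1
      have h2 := (hX _ _).unique h1 rfl
      ext : 1
      apply pullback.hom_ext h2
      exact (Over.w f).trans (Over.w g).symm
    · intro g
      obtain ⟨q, hq, -⟩ := hX _ ((tensorIso T m).inv ≫ g.left)
      have hqa : q ≫ a = T.hom ≫ c := by
        refine (hB _ (thFst m _ ≫ T.hom)).unique ?_ ?_
        · rw [thMap_comp_assoc, ha, ← Category.assoc, hq, Category.assoc, Over.w g, Iso.inv_comp_eq]
          exact (tensorIso_hom_fst_assoc T m _).symm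
        · rw [thMap_comp_assoc, hc, thMap_fst]
      refine ⟨Over.homMk (pullback.lift q T.hom hqa) (pullback.lift_snd _ _ _), ?_⟩
      ext : 1
      simp only
      rw [hξ]
      change (tensorIso T m).hom ≫ thMap m (pullback.lift q T.hom hqa ≫ pullback.fst a c) ≫ uX = _
      rw [pullback.lift_fst, hq, Iso.hom_inv_id_assoc]
  refine ⟨J, ⟨⟨fun {T} => Equiv.ofBijective _ (hbij T), ?_⟩⟩⟩
  intro T T' f g
  change (f ≫ g) ▷ _ ≫ ξ = f ▷ _ ≫ g ▷ _ ≫ ξ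
  rw [comp_whiskerRight_assoc]

/-- The `m`-th jet scheme: it represents `T ↦ Hom_k(T × Spec k[t]/(t^{m+1}), X)`; for
`T = Spec A` the product is `Spec A[t]/(t^{m+1})`. -/
def jetScheme (X : SchOver k) (m : ℕ) : SchOver k :=
  haveI := jetFunctor_isRepresentable X m
  (jetFunctor X m).reprX

/-- The functorial bijection `Hom_k(T, J_m(X)) ≃ Hom_k(T × Spec k[t]/(t^{m+1}), X)`. -/
def jetEquiv (X : SchOver k) (m : ℕ) (T : SchOver k) :
    (T ⟶ jetScheme X m) ≃ (T ⊗ specOver k (TruncPoly k m) ⟶ X) :=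
  haveI := jetFunctor_isRepresentable X m
  (jetFunctor X m).representableBy.homEquiv

lemma jetEquiv_comp (X : SchOver k) (m : ℕ) {S T : SchOver k} (f : S ⟶ T)
    (g : T ⟶ jetScheme X m) :
    jetEquiv X m S (f ≫ g) = f ▷ specOver k (TruncPoly k m) ≫ jetEquiv X m T g :=
  haveI := jetFunctor_isRepresentable X m
  (jetFunctor X m).representableBy.homEquiv_comp f g

/-- The truncation `A[t]/(t^{m+1}) → A[t]/(t^{p+1})`. -/
def TruncPoly.trunc (A : Type u) [CommRing A] {m p : ℕ} (h : p ≤ m) :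
    TruncPoly A m →ₐ[A] TruncPoly A p :=
  Ideal.Quotient.factorₐ A (by
    rw [Ideal.span_singleton_le_span_singleton]
    exact pow_dvd_pow _ (by omega))

/-- The morphism of `k`-schemes defined by a homomorphism of `k`-algebras. -/
abbrev specOverMap {A B : Type u} [CommRing A] [Algebra k A] [CommRing B] [Algebra k B]
    (f : A →ₐ[k] B) : specOver k B ⟶ specOver k A :=
  Over.homMk (Spec.map (CommRingCat.ofHom f.toRingHom))
    (by simp [← Spec.map_comp, ← CommRingCat.ofHom_comp])

/-- The projection `π_{m,p} : J_m(X) → J_p(X)`, defined on functors of points by composition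
with the truncation. -/
def jetProj (X : SchOver k) {m p : ℕ} (h : p ≤ m) : jetScheme X m ⟶ jetScheme X p :=
  (jetEquiv X p (jetScheme X m)).symm
    (jetScheme X m ◁ specOverMap (TruncPoly.trunc k h) ≫
      jetEquiv X m (jetScheme X m) (𝟙 (jetScheme X m)))

/-- The `k`-valued points of a scheme over `k`. -/
abbrev KPoint (Y : SchOver k) := 𝟙_ (SchOver k) ⟶ Y

/-- The morphism `Spec k[t]/(t^{m+1}) → X` which corresponds to a `k`-point of `J_m(X)`. -/
def jetMap {X : SchOver k} {m : ℕ} (γ : KPoint (jetScheme X m)) :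
    specOver k (TruncPoly k m) ⟶ X :=
  (λ_ (specOver k (TruncPoly k m))).inv ≫ jetEquiv X m (𝟙_ (SchOver k)) γ

/-- The ring homomorphism `Γ(X, U) → k[t]/(t^{m+1})` of a jet which lies in the open set `U`. -/
def jetRingHom {X : SchOver k} {m : ℕ} (γ : KPoint (jetScheme X m)) (U : X.left.Opens)
    (hU : ⊤ ≤ (jetMap γ).left ⁻¹ᵁ U) : Γ(X.left, U) →+* TruncPoly k m :=
  (Scheme.ΓSpecIso (CommRingCat.of (TruncPoly k m))).hom.hom.comp
    ((jetMap γ).left.appLE U ⊤ hU).hom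

/-- The `k`-algebra structure on the ring of sections. -/
instance sectionsAlgebra (X : SchOver k) (U : X.left.Opens) : Algebra k Γ(X.left, U) :=
  ((X.hom.appLE ⊤ U le_top).hom.comp
    (Scheme.ΓSpecIso (CommRingCat.of k)).inv.hom).toAlgebra

/-- The Fitting ideal `Fitt^i(M)` of a finitely generated module: the ideal generated by the minors
of size `q - i` of relation matrices of systems of `q` generators (all systems of generators
give the same ideal). -/
def fittingIdeal (R : Type u) [CommRing R] (M : Type v) [AddCommGroup M] [Module R M] (i : ℕ) :
    Ideal R :=
  Ideal.span {d | ∃ (q : ℕ) (g : Fin q → M) (ρ : Fin (q - i) → Fin q → R)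
    (c : Fin (q - i) → Fin q), Submodule.span R (Set.range g) = ⊤ ∧
      (∀ a, ∑ j, ρ a j • g j = 0) ∧ d = (Matrix.of fun a b => ρ a (c b)).det}

/-- The ideal sheaf `Jac_X = Fitt^n(Ω_X)`. On an affine open `U` it is given by
`Fitt^n(Ω_{Γ(X, U)/k})` (these ideals are compatible with localization when `X` is locally of
finite type). -/
def jacobianIdeal (X : SchOver k) (n : ℕ) : X.left.IdealSheafData :=
  .ofIdeals fun U => fittingIdeal Γ(X.left, U) Ω[Γ(X.left, U)⁄k] n

/-- The inverse image in `k[t]/(t^{m+1})` of an ideal sheaf under a jet. -/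
def jetInverseImage {X : SchOver k} (I : X.left.IdealSheafData) {m : ℕ}
    (γ : KPoint (jetScheme X m)) : Ideal (TruncPoly k m) :=
  ((I.comap (jetMap γ).left).ideal
      ⟨⊤, isAffineOpen_top (Spec (CommRingCat.of (TruncPoly k m)))⟩).map
    (Scheme.ΓSpecIso (CommRingCat.of (TruncPoly k m))).hom.hom

/-- The contact locus `Cont^e(I)_m`: the jets of order `m` along which `I` has order `e ≤ m`. -/
def contactLocus {X : SchOver k} (I : X.left.IdealSheafData) (e m : ℕ) :
    Set (KPoint (jetScheme X m)) :=
  {γ | e ≤ m ∧ jetInverseImage I γ = Ideal.span {TruncPoly.t k m ^ e}}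

/-- All irreducible components have dimension `n`. -/
def IsPureDimensional (X : Scheme.{u}) (n : ℕ) : Prop :=
  ∀ Z ∈ irreducibleComponents X, topologicalKrullDim Z = n

/-- Locally complete intersection over `k`: locally, `X` is a closed subscheme of an affine
space which is cut out by as many equations as its codimension. -/
def IsLCI (X : SchOver k) : Prop :=
  ∀ x : X.left, ∃ U : X.left.Opens, IsAffineOpen U ∧ x ∈ U ∧
    ∃ (N r : ℕ) (φ : MvPolynomial (Fin N) k →ₐ[k] Γ(X.left, U))
      (f : Fin r → MvPolynomial (Fin N) k), Function.Surjective φ ∧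
      RingHom.ker φ = Ideal.span (Set.range f) ∧ ringKrullDim Γ(X.left, U) + r = N

/-- The affine space of dimension `d` over `k`. -/
abbrev affineSpace (k : Type u) [Field k] (d : ℕ) : SchOver k :=
  specOver k (MvPolynomial (Fin d) k)

/-- The affine space `Spec Sym(V^*)` of a finite dimensional vector space `V`. -/
abbrev vectorSpaceScheme (k : Type u) [Field k] (V : Type u) [AddCommGroup V] [Module k V] :
    SchOver k :=
  specOver k (SymmetricAlgebra k (Module.Dual k V))

/-- The ideal `(t^{p+1})/(t^{m+1})` of `k[t]/(t^{m+1})`. -/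
abbrev truncIdeal (k : Type u) [Field k] (m p : ℕ) : Ideal (TruncPoly k m) :=
  Ideal.span {TruncPoly.t k m ^ (p + 1)}

/-- The vector space `Hom_{k[t]/(t^{p+1})}(M, (t^{p+1})/(t^{m+1}))`, for a module `M` over
`k[t]/(t^{p+1})`. When `m ≤ 2p+1` the ideal `(t^{p+1})/(t^{m+1})` is annihilated by `t^{p+1}`, and
an element of `k[t]/(t^{p+1})` acts on it through any lift to `k[t]/(t^{m+1})`. -/
def truncHom (k : Type u) [Field k] {m p : ℕ} (h : p ≤ m) (M : Type u) [AddCommGroup M]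
    [Module (TruncPoly k p) M] : Submodule k (M →+ truncIdeal k m p) where
  carrier := {f | ∀ (a : TruncPoly k m) (x : M), f (TruncPoly.trunc k h a • x) = a • f x}
  add_mem' hf hg a x := by simp [hf a x, hg a x]
  zero_mem' a x := by simp
  smul_mem' c f hf a x := by
    simp only [AddMonoidHom.smul_apply]
    rw [hf a x, smul_comm]

/-- `γ^*Ω_X`, for a jet `γ` of order `p` which lies in an affine open set `U`: the module
`k[t]/(t^{p+1}) ⊗ Ω_{Γ(X, U)/k}` over `k[t]/(t^{p+1})`. -/
abbrev JetOmega {X : SchOver k} {p : ℕ} (γ : KPoint (jetScheme X p)) (U : X.left.Opens)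
    (hU : ⊤ ≤ (jetMap γ).left ⁻¹ᵁ U) : Type u :=
  letI := (jetRingHom γ U hU).toAlgebra
  TruncPoly k p ⊗[Γ(X.left, U)] Ω[Γ(X.left, U)⁄k]

/-- A locally closed subset of a scheme over `k`, with its reduced scheme structure. -/
structure ReducedLocallyClosed (V : SchOver k) where
  obj : SchOver k
  ι : obj ⟶ V
  reduced : IsReduced obj.left
  immersion : IsImmersion ι.left

/-- The set of `k`-points of a locally closed subset. -/
def ReducedLocallyClosed.points {V : SchOver k} (T : ReducedLocallyClosed V) : Set (KPoint V) :=
  Set.range fun x : KPoint T.obj => x ≫ T.ι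

/-- The morphism `g : V' → V` gives a piecewise trivial fibration `W' → W` with fiber `F`:
`g(W') ⊆ W`, and `W` is a finite disjoint union of locally closed subsets `T i` such that
`W' ∩ g⁻¹(T i)` is locally closed and, with the reduced scheme structure, is isomorphic to
`T i × F` over `T i`. (In particular `W` and `W'` are constructible.) -/
def IsPiecewiseTrivial {V' V : SchOver k} (g : V' ⟶ V) (W' : Set (KPoint V')) (W : Set (KPoint V))
    (F : SchOver k) : Prop :=
  (∀ x ∈ W', x ≫ g ∈ W) ∧
  ∃ (r : ℕ) (T : Fin r → ReducedLocallyClosed V),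
    (∀ i j, i ≠ j → Disjoint (T i).points (T j).points) ∧ (⋃ i, (T i).points) = W ∧
    ∀ i, ∃ Q : ReducedLocallyClosed V', Q.points = {x | x ∈ W' ∧ x ≫ g ∈ (T i).points} ∧
      ∃ φ : Q.obj ≅ (T i).obj ⊗ F, φ.hom ≫ fst (T i).obj F ≫ (T i).ι = Q.ι ≫ g

end
end Jets
end

/-! Let `ψ : R → k[t]/(t^{m+1})` be a jet in an affine chart `Spec R`. Another jet with the same
truncation to order `p` differs from `ψ` by a map into `(t^{p+1})/(t^{m+1})`. For `m ≤ 2p+1` this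
ideal has square zero, so the difference is a derivation along `ψ`, and conversely adding such a
derivation gives a lift (`exists_relDer_of_lift`, `exists_lift_of_relDer`). A nonempty fiber of
`π_{m,p}` is therefore a torsor under derivations. The argument runs over every `k`-algebra `C`, so
it determines the fiber as a scheme and not only its points.

The ideal `(t^{p+1})` is the annihilator of `t^{m-p}`. Put `M = ψ^*Ω` and `q = m - p`. Taking the
top coefficient identifies the linear maps `M → C[t]/(t^{m+1})` killed by `t^q` with the `C`-valued
functionals on `M/t^q M` (`JetDiffQuot.relDerEquiv`). Over any base on which `M/t^q M` has
coordinates, the lifts thus form a trivial bundle of affine spaces (`exists_isPullback_affineProj`).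
Over the point `Spec k` this gives (1), and it reduces (2a) to computing `dim M/t^q M`.

That dimension is read off from Fitting ideals, which commute with base change. The contact
condition says `Fitt^n(M) = (t^e)`, and `Fitt^{n-1}(M) = 0` because `Fitt^{n-1}(Ω_X) = 0`. Writing
`M` as a sum of modules `k[t]/(t^{a_i})`, these two facts force all but `n` of the exponents to add
up to `e` and the other `n` to be at least `m + 1 - e ≥ q`. Hence `dim M/t^q M = qn + e`
(`finrank_quotient_t_pow`).

The vanishing of `Fitt^{n-1}(Ω_X)` (`fittingSpan_eq_bot`) is the only place where `X` must be
reduced or lci. If `X` is reduced, it suffices to look at the generic points of the components,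
where the differentials have rank at least `n` because `k` is perfect. If `X` is cut out of `A^N` by
`r ≤ N - n` equations, all relations among the `dx_i` come from `r` rows of a Jacobian matrix, so a
determinant with more than `r` relation rows vanishes. Fitting indices are integers here, so that
`Fitt^{n-1}` is meaningful, and zero, also for `n = 0`.

For (2b), Noetherian induction on `J_p(X)` (`isPiecewiseTrivial_of_forall_isClosed`) reduces to
families of jets over a domain `B` of finite type, which may be shrunk to dense open subsets
(`exists_dense_trivial`). After shrinking, the order of contact is `e` everywhere or nowhere; either
no jet of the family lifts or the whole family does; and the reduction of the pulled back
differentials becomes free. The lifting alternative uses that a lift over an extension of `Frac B`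
yields one over `Frac B` itself (`exists_lift_of_retraction`: a torsor under a vector space is
trivial), and that such a lift spreads out to an open subset. -/

noncomputable section
namespace Jets

/-! ### Algebra homomorphisms of truncated polynomial rings. -/

namespace TruncPoly
variable {k A B C : Type u} [CommRing k] [CommRing A] [CommRing B] [CommRing C] [Algebra k A]
  [Algebra k B] [Algebra k C]

lemma algebraMap_eq_comp (m : ℕ) (a : k) :
    algebraMap k (TruncPoly A m) a = algebraMap A _ (algebraMap k A a) := rfl

/-- Functoriality of `A ↦ A[t]/(t^{m+1})` for homomorphisms of algebras. -/
def mapₐ (m : ℕ) (f : A →ₐ[k] B) : TruncPoly A m →ₐ[k] TruncPoly B m :=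
  { map m f.toRingHom with
    commutes' := fun a => by
      change map m f.toRingHom (algebraMap k _ a) = _
      rw [algebraMap_eq_comp, map_algebraMap, algebraMap_eq_comp]
      exact congrArg _ (f.commutes a) }

lemma coeff_mapₐ {m : ℕ} (f : A →ₐ[k] B) (i : Fin (m + 1)) (x : TruncPoly A m) :
    coeff i (mapₐ m f x) = f (coeff i x) := coeff_map _ _ _

@[simp] lemma mapₐ_t (m : ℕ) (f : A →ₐ[k] B) : mapₐ m f (t A m) = t B m := map_t _

lemma mapₐ_algebraMap (m : ℕ) (f : A →ₐ[k] B) (a : A) :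
    mapₐ m f (algebraMap A _ a) = algebraMap B _ (f a) := map_algebraMap _ _

lemma mapₐ_id (m : ℕ) : mapₐ m (AlgHom.id k A) = AlgHom.id k _ :=
  AlgHom.ext fun x => ext_coeff fun i => by rw [coeff_mapₐ]; rfl

lemma mapₐ_comp (m : ℕ) (f : A →ₐ[k] B) (g : B →ₐ[k] C) :
    mapₐ m (g.comp f) = (mapₐ m g).comp (mapₐ m f) :=
  AlgHom.ext fun x => ext_coeff fun i => by
    rw [AlgHom.comp_apply, coeff_mapₐ, coeff_mapₐ, coeff_mapₐ]; rfl

lemma trunc_mk (A : Type u) [CommRing A] {m p : ℕ} (h : p ≤ m) (x : A[X]) :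
    trunc A h (Ideal.Quotient.mk _ x) = Ideal.Quotient.mk _ x := rfl

lemma coeff_trunc {m p : ℕ} (h : p ≤ m) (i : Fin (p + 1)) (x : TruncPoly A m) :
    coeff i (trunc A h x) = coeff (Fin.castLE (by omega) i) x := by
  obtain ⟨x, rfl⟩ := Ideal.Quotient.mk_surjective x
  rw [trunc_mk, coeff_mk, coeff_mk]
  rfl

lemma trunc_surjective (A : Type u) [CommRing A] {m p : ℕ} (h : p ≤ m) :
    Function.Surjective (trunc A h) := fun x => by
  obtain ⟨x, rfl⟩ := Ideal.Quotient.mk_surjective x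
  exact ⟨Ideal.Quotient.mk _ x, rfl⟩

@[simp] lemma trunc_t (A : Type u) [CommRing A] {m p : ℕ} (h : p ≤ m) :
    trunc A h (t A m) = t A p := rfl

/-- Truncation is a homomorphism over any base. -/
def truncₐ (k A : Type u) [CommRing k] [CommRing A] [Algebra k A] {m p : ℕ} (h : p ≤ m) :
    TruncPoly A m →ₐ[k] TruncPoly A p :=
  (trunc A h).restrictScalars k

lemma truncₐ_apply {m p : ℕ} (h : p ≤ m) (x : TruncPoly A m) :
    truncₐ k A h x = trunc A h x := rfl

lemma mapₐ_truncₐ {m p : ℕ} (h : p ≤ m) (f : A →ₐ[k] B) :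
    (mapₐ p f).comp (truncₐ k A h) = (truncₐ k B h).comp (mapₐ m f) :=
  AlgHom.ext fun x => ext_coeff fun i => by
    simp only [AlgHom.comp_apply, truncₐ_apply, coeff_mapₐ, coeff_trunc]

/-- The constant coefficient. -/
def aug (k A : Type u) [CommRing k] [CommRing A] [Algebra k A] (m : ℕ) :
    TruncPoly A m →ₐ[k] A :=
  { lift (m := m) (RingHom.id A) 0 (by simp) with
    commutes' := fun a => by
      change lift _ _ _ (algebraMap k _ a) = _
      rw [algebraMap_eq_comp, lift_algebraMap]; rfl }

lemma aug_algebraMap (m : ℕ) (a : A) : aug k A m (algebraMap A _ a) = a := lift_algebraMap _ _ (by simp) _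

lemma aug_surjective (m : ℕ) : Function.Surjective (aug k A m) :=
  fun a => ⟨algebraMap A _ a, aug_algebraMap m a⟩

lemma aug_eq_coeff (m : ℕ) (x : TruncPoly A m) : aug k A m x = coeff 0 x := by
  obtain ⟨x, rfl⟩ := Ideal.Quotient.mk_surjective x
  rw [coeff_mk]
  change Polynomial.eval₂ (RingHom.id A) 0 x = _
  rw [Polynomial.eval₂_id, ← Polynomial.coeff_zero_eq_eval_zero]; rfl

/-- Such an `x` is a multiple of `t`. Hence a thickening has the same underlying space as its base.
-/
lemma isNilpotent_of_aug_eq_zero (m : ℕ) (x : TruncPoly A m) (hx : aug k A m x = 0) :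
    x ^ (m + 1) = 0 := by
  obtain ⟨x, rfl⟩ := Ideal.Quotient.mk_surjective x
  have h : x.eval 0 = 0 := by
    have : Polynomial.eval₂ (RingHom.id A) 0 x = 0 := hx
    rwa [Polynomial.eval₂_id] at this
  obtain ⟨y, rfl⟩ : Polynomial.X ∣ x := by
    rwa [Polynomial.X_dvd_iff, Polynomial.coeff_zero_eq_eval_zero]
  rw [← _root_.map_pow, mul_pow, Ideal.Quotient.eq_zero_iff_mem]
  exact Ideal.mul_mem_right _ _ (Ideal.mem_span_singleton_self _)

lemma aug_truncₐ {m p : ℕ} (h : p ≤ m) : (aug k A p).comp (truncₐ k A h) = aug k A m :=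
  AlgHom.ext fun x => by
    simp only [AlgHom.comp_apply, truncₐ_apply, aug_eq_coeff, coeff_trunc]; rfl

end TruncPoly

end Jets
end

/-! ### Affine `k`-schemes and isomorphisms tested on affine points. -/

noncomputable section
namespace Jets

section
variable {k : Type u} [Field k]

lemma specOverMap_comp {A B C : Type u} [CommRing A] [Algebra k A] [CommRing B] [Algebra k B]
    [CommRing C] [Algebra k C] (f : A →ₐ[k] B) (g : B →ₐ[k] C) :
    specOverMap (g.comp f) = specOverMap g ≫ specOverMap f := by
  ext : 1
  exact Spec.map_comp (CommRingCat.ofHom f.toRingHom) (CommRingCat.ofHom g.toRingHom)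

lemma specOverMap_id {A : Type u} [CommRing A] [Algebra k A] :
    specOverMap (AlgHom.id k A) = 𝟙 (specOver k A) := by
  ext : 1
  exact Spec.map_id _

lemma specOverMap_injective {A B : Type u} [CommRing A] [Algebra k A] [CommRing B] [Algebra k B]
    {f g : A →ₐ[k] B} (h : specOverMap f = specOverMap g) : f = g := by
  have h1 := Spec.map_injective congr(($h).left)
  exact AlgHom.ext fun x => congr($(h1).hom x)

lemma specOverMap_surjective {A B : Type u} [CommRing A] [Algebra k A] [CommRing B] [Algebra k B]
    (y : specOver k B ⟶ specOver k A) : ∃ f : A →ₐ[k] B, y = specOverMap f := by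
  obtain ⟨f, hf⟩ := Spec.map_surjective y.left
  have hw := Over.w y
  rw [← hf] at hw
  have h2 := Spec.map_injective ((Spec.map_comp _ _).trans hw)
  refine ⟨{ f.hom with commutes' := fun a => congr($(h2).hom a) }, ?_⟩
  ext : 1
  exact hf.symm

/-- A `k`-scheme whose underlying scheme is affine is the spectrum of a `k`-algebra. -/
lemma exists_algebra_of_hom {Z : SchOver k} {C : CommRingCat.{u}} (z : Spec C ⟶ Z.left) :
    ∃ (_ : Algebra k C) (z' : specOver k C ⟶ Z), z'.left = z := by
  obtain ⟨f, hf⟩ := Spec.map_surjective (z ≫ Z.hom)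
  refine ⟨f.hom.toAlgebra, Over.homMk z ?_, rfl⟩
  exact hf.symm

/-- Since `w` is a monomorphism, local sections agree on overlaps and glue; a monomorphism with a
section is an isomorphism. -/
lemma isIso_of_local_sections {Y Z : Scheme.{u}} (𝒰 : Z.OpenCover) (w : Y ⟶ Z)
    (inj : ∀ {T : Scheme.{u}} (a b : T ⟶ Y), a ≫ w = b ≫ w → a = b)
    (hex : ∀ i, ∃ f : 𝒰.X i ⟶ Y, f ≫ w = 𝒰.f i) : IsIso w := by
  choose f hf using hex
  let g := 𝒰.glueMorphisms f (fun i j => inj _ _ (by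
    rw [Category.assoc, Category.assoc, hf, hf, pullback.condition]))
  have hg : g ≫ w = 𝟙 _ := Scheme.Cover.hom_ext 𝒰 _ _ fun i => by
    rw [← Category.assoc, 𝒰.ι_glueMorphisms, hf, Category.comp_id]
  exact ⟨g, inj _ _ (by rw [Category.assoc, hg, Category.comp_id, Category.id_comp]), hg⟩

/-- A morphism of `k`-schemes which induces bijections on points with values in `k`-algebras is an
isomorphism. -/
lemma isIso_of_affine {Y Z : SchOver k} (w : Y ⟶ Z)
    (h : ∀ (C : Type u) [CommRing C] [Algebra k C] (z : specOver k C ⟶ Z),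
      ∃! y : specOver k C ⟶ Y, y ≫ w = z) : IsIso w := by
  have inj : ∀ {T : Scheme.{u}} (a b : T ⟶ Y.left), a ≫ w.left = b ≫ w.left → a = b := by
    intro T a b hab
    refine Scheme.Cover.hom_ext T.affineOpenCover.openCover _ _ fun i => ?_
    change T.affineOpenCover.f i ≫ a = T.affineOpenCover.f i ≫ b
    -- The morphisms `a` and `b` are not assumed to be over `k`. The affine piece receives its
    -- `k`-structure from `a`, and `b` respects it because both have the same composite with `w`.
    obtain ⟨_, y, hy⟩ := exists_algebra_of_hom (T.affineOpenCover.f i ≫ a)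
    have e1 : (T.affineOpenCover.f i ≫ b) ≫ Y.hom =
        (specOver k (T.affineOpenCover.X i)).hom := by
      rw [← Over.w y, hy, ← Over.w w, Category.assoc, Category.assoc]
      exact congrArg (T.affineOpenCover.f i ≫ ·) (((Category.assoc _ _ _).symm.trans
        (congrArg (· ≫ Z.hom) hab.symm)).trans (Category.assoc _ _ _))
    have := (h _ (y ≫ w)).unique (y₁ := y) (y₂ := Over.homMk (T.affineOpenCover.f i ≫ b) e1) rfl
      (by
        ext : 1
        rw [Over.comp_left, Over.comp_left, hy, Category.assoc, hab]
        exact Category.assoc _ _ _)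
    rw [← hy]
    exact congr(($this).left)
  have : IsIso w.left := isIso_of_local_sections Z.left.affineOpenCover.openCover w.left inj
    fun i => by
      obtain ⟨_, z, hz⟩ := exists_algebra_of_hom (Z.left.affineOpenCover.f i)
      obtain ⟨y, hy, -⟩ := h _ z
      exact ⟨y.left, (congr(($hy).left)).trans hz⟩
  have : IsIso ((Over.forget _).map w) := this
  exact isIso_of_reflects_iso w (Over.forget _)

end
end Jets
end

/-! ### Jets parametrized by the spectrum of an algebra. -/

noncomputable section
namespace Jets

section
variable {k : Type u} [Field k]

/-- The homomorphism of `k`-algebras `A[t]/(t^{m+1}) → B` with prescribed restriction to `A` and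
value at `t`. -/
def TruncPoly.liftₐ {A B : Type u} [CommRing A] [Algebra k A] [CommRing B] [Algebra k B] {m : ℕ}
    (f : A →ₐ[k] B) (b : B) (hb : b ^ (m + 1) = 0) : TruncPoly A m →ₐ[k] B :=
  { TruncPoly.lift f.toRingHom b hb with
    commutes' := fun a => by
      change TruncPoly.lift f.toRingHom b hb (algebraMap k _ a) = _
      rw [TruncPoly.algebraMap_eq_comp, TruncPoly.lift_algebraMap]
      exact f.commutes a }

/-- The morphism from `Spec C[t]/(t^{m+1})` to the product of `Spec C` and `Spec k[t]/(t^{m+1})`. -/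
def specTensor (k C : Type u) [Field k] [CommRing C] [Algebra k C] (m : ℕ) :
    specOver k (TruncPoly C m) ⟶ specOver k C ⊗ specOver k (TruncPoly k m) :=
  lift (specOverMap (IsScalarTower.toAlgHom k C (TruncPoly C m)))
    (specOverMap (TruncPoly.mapₐ m (Algebra.ofId k C)))

@[simp] lemma specTensor_fst (C : Type u) [CommRing C] [Algebra k C] (m : ℕ) :
    specTensor k C m ≫ fst _ _ = specOverMap (IsScalarTower.toAlgHom k C (TruncPoly C m)) :=
  lift_fst _ _

@[simp] lemma specTensor_snd (C : Type u) [CommRing C] [Algebra k C] (m : ℕ) :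
    specTensor k C m ≫ snd _ _ = specOverMap (TruncPoly.mapₐ m (Algebra.ofId k C)) :=
  lift_snd _ _

/-- Both sides have the same `D`-points: a homomorphism `C → D` together with an element of `D`
whose `(m+1)`-st power vanishes, the image of `t`. -/
instance specTensor_isIso (C : Type u) [CommRing C] [Algebra k C] (m : ℕ) :
    IsIso (specTensor k C m) := by
  refine isIso_of_affine _ fun D _ _ z => ?_
  obtain ⟨f, hf⟩ := specOverMap_surjective (z ≫ fst _ _)
  obtain ⟨g, hg⟩ := specOverMap_surjective (z ≫ snd _ _)
  have hb : g (TruncPoly.t k m) ^ (m + 1) = 0 := by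
    rw [← map_pow, TruncPoly.t_pow, map_zero]
  refine ⟨specOverMap (TruncPoly.liftₐ f (g (TruncPoly.t k m)) hb), ?_, ?_⟩
  · apply CartesianMonoidalCategory.hom_ext
    · rw [Category.assoc, specTensor_fst, hf, ← specOverMap_comp]
      congr 1
      exact AlgHom.ext fun c => TruncPoly.lift_algebraMap _ _ hb _
    · rw [Category.assoc, specTensor_snd, hg, ← specOverMap_comp]
      congr 1
      apply AlgHom.coe_ringHom_injective
      apply TruncPoly.hom_ext
      · ext a
        change TruncPoly.lift f.toRingHom _ hb (TruncPoly.mapₐ m (Algebra.ofId k C)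
          (algebraMap _ _ a)) = g (algebraMap k _ a)
        rw [TruncPoly.mapₐ_algebraMap, TruncPoly.lift_algebraMap, g.commutes]
        exact f.commutes a
      · change TruncPoly.lift f.toRingHom _ hb (TruncPoly.mapₐ m (Algebra.ofId k C) _) = g _
        rw [TruncPoly.mapₐ_t, TruncPoly.lift_t]
  · intro y hy
    obtain ⟨y, rfl⟩ := specOverMap_surjective y
    have h1 := congr($hy ≫ fst _ _)
    have h2 := congr($hy ≫ snd _ _)
    rw [Category.assoc, specTensor_fst, hf, ← specOverMap_comp] at h1
    rw [Category.assoc, specTensor_snd, hg, ← specOverMap_comp] at h2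
    have h1 := specOverMap_injective h1
    have h2 := specOverMap_injective h2
    congr 1
    apply AlgHom.coe_ringHom_injective
    apply TruncPoly.hom_ext
    · ext c
      refine (congr($h1 c)).trans (TruncPoly.lift_algebraMap _ _ hb _).symm
    · refine Eq.trans ?_ (TruncPoly.lift_t _ _ hb).symm
      have := congr($h2 (TruncPoly.t k m))
      rwa [AlgHom.comp_apply, TruncPoly.mapₐ_t] at this

lemma specTensor_nat {C C' : Type u} [CommRing C] [Algebra k C] [CommRing C'] [Algebra k C']
    (m : ℕ) (f : C →ₐ[k] C') :
    specTensor k C' m ≫ specOverMap f ▷ specOver k (TruncPoly k m) =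
      specOverMap (TruncPoly.mapₐ m f) ≫ specTensor k C m := by
  apply CartesianMonoidalCategory.hom_ext
  · rw [Category.assoc, Category.assoc, whiskerRight_fst, specTensor_fst, ← Category.assoc,
      specTensor_fst, ← specOverMap_comp, ← specOverMap_comp]
    congr 1
    exact AlgHom.ext fun c => (TruncPoly.mapₐ_algebraMap m f c).symm
  · rw [Category.assoc, Category.assoc, whiskerRight_snd, specTensor_snd, specTensor_snd,
      ← specOverMap_comp, ← TruncPoly.mapₐ_comp]
    congr 2
    exact Subsingleton.elim _ _

lemma specTensor_trunc (C : Type u) [CommRing C] [Algebra k C] {m p : ℕ} (h : p ≤ m) :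
    specTensor k C p ≫ specOver k C ◁ specOverMap (TruncPoly.trunc k h) =
      specOverMap (TruncPoly.truncₐ k C h) ≫ specTensor k C m := by
  apply CartesianMonoidalCategory.hom_ext
  · rw [Category.assoc, Category.assoc, whiskerLeft_fst, specTensor_fst,
      specTensor_fst, ← specOverMap_comp]
    rfl
  · rw [Category.assoc, Category.assoc, whiskerLeft_snd, specTensor_snd, ← Category.assoc,
      specTensor_snd, ← specOverMap_comp, ← specOverMap_comp]
    congr 1
    exact TruncPoly.mapₐ_truncₐ h (Algebra.ofId k C)

/-- The spectrum of `k` is the unit of the category of `k`-schemes. -/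
def unitSpec (k : Type u) [Field k] : 𝟙_ (SchOver k) ≅ specOver k k :=
  Over.isoMk (Iso.refl _) (by
    have : CommRingCat.ofHom (algebraMap k k) = 𝟙 (CommRingCat.of k) := rfl
    change 𝟙 _ ≫ Spec.map (CommRingCat.ofHom (algebraMap k k)) = 𝟙 _
    rw [this, Spec.map_id, Category.id_comp])

lemma specTensor_aug (C : Type u) [CommRing C] [Algebra k C] (m : ℕ) :
    (ρ_ (specOver k C)).inv ≫
      specOver k C ◁ ((unitSpec k).hom ≫ specOverMap (TruncPoly.aug k k m)) =
      specOverMap (TruncPoly.aug k C m) ≫ specTensor k C m := by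
  apply CartesianMonoidalCategory.hom_ext
  · rw [Category.assoc, Category.assoc, whiskerLeft_fst, specTensor_fst, rightUnitor_inv_fst,
      ← specOverMap_comp, ← specOverMap_id]
    congr 1
    exact AlgHom.ext fun c => (TruncPoly.aug_algebraMap (k := k) m c).symm
  · rw [Category.assoc, Category.assoc, whiskerLeft_snd, specTensor_snd,
      ← specOverMap_comp, rightUnitor_inv_snd_assoc]
    have h1 : toUnit (specOver k C) ≫ (unitSpec k).hom = specOverMap (Algebra.ofId k C) := by
      rw [← Iso.eq_comp_inv]
      exact toUnit_unique _ _
    rw [← Category.assoc, h1, ← specOverMap_comp]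
    congr 1
    exact AlgHom.ext fun x => by
      simp only [AlgHom.comp_apply, TruncPoly.aug_eq_coeff, TruncPoly.coeff_mapₐ]

variable (X : SchOver k) (m : ℕ)

/-- The jets parametrized by the spectrum of a `k`-algebra `C` are the morphisms from
`Spec C[t]/(t^{m+1})`. -/
def jetAff (C : Type u) [CommRing C] [Algebra k C] :
    (specOver k C ⟶ jetScheme X m) ≃ (specOver k (TruncPoly C m) ⟶ X) :=
  (jetEquiv X m (specOver k C)).trans
    ⟨fun g => specTensor k C m ≫ g, fun g => inv (specTensor k C m) ≫ g,
      fun g => by simp, fun g => by simp⟩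

lemma jetAff_apply (C : Type u) [CommRing C] [Algebra k C] (x : specOver k C ⟶ jetScheme X m) :
    jetAff X m C x = specTensor k C m ≫ jetEquiv X m (specOver k C) x := rfl

variable {X m}

lemma jetAff_comp {C C' : Type u} [CommRing C] [Algebra k C] [CommRing C'] [Algebra k C']
    (f : C →ₐ[k] C') (x : specOver k C ⟶ jetScheme X m) :
    jetAff X m C' (specOverMap f ≫ x) = specOverMap (TruncPoly.mapₐ m f) ≫ jetAff X m C x := by
  rw [jetAff_apply, jetAff_apply, jetEquiv_comp, ← Category.assoc, specTensor_nat, Category.assoc]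

lemma jetEquiv_proj {p : ℕ} (h : p ≤ m) {T : SchOver k} (x : T ⟶ jetScheme X m) :
    jetEquiv X p T (x ≫ jetProj X h) =
      T ◁ specOverMap (TruncPoly.trunc k h) ≫ jetEquiv X m T x := by
  rw [jetEquiv_comp, jetProj, Equiv.apply_symm_apply, ← Category.assoc, ← whisker_exchange,
    Category.assoc, ← jetEquiv_comp, Category.comp_id]

lemma jetAff_proj {p : ℕ} (h : p ≤ m) {C : Type u} [CommRing C] [Algebra k C]
    (x : specOver k C ⟶ jetScheme X m) :
    jetAff X p C (x ≫ jetProj X h) =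
      specOverMap (TruncPoly.truncₐ k C h) ≫ jetAff X m C x := by
  rw [jetAff_apply, jetAff_apply, jetEquiv_proj, ← Category.assoc, specTensor_trunc,
    Category.assoc]

variable (X m) in
/-- The morphism which maps a jet to its center. -/
def jetCenter : jetScheme X m ⟶ X :=
  (ρ_ _).inv ≫ jetScheme X m ◁ ((unitSpec k).hom ≫ specOverMap (TruncPoly.aug k k m)) ≫
    jetEquiv X m (jetScheme X m) (𝟙 _)

lemma comp_jetCenter {C : Type u} [CommRing C] [Algebra k C] (x : specOver k C ⟶ jetScheme X m) :
    x ≫ jetCenter X m = specOverMap (TruncPoly.aug k C m) ≫ jetAff X m C x := by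
  rw [jetCenter, ← Category.assoc, rightUnitor_inv_naturality, Category.assoc,
    ← whisker_exchange_assoc, ← jetEquiv_comp, Category.comp_id, ← Category.assoc, specTensor_aug,
    Category.assoc, jetAff_apply]

lemma jetMap_eq (γ : KPoint (jetScheme X m)) :
    jetMap γ = jetAff X m k ((unitSpec k).inv ≫ γ) := by
  rw [jetMap, jetAff_apply, jetEquiv_comp, ← Category.assoc]
  congr 1
  apply CartesianMonoidalCategory.hom_ext
  · exact toUnit_unique _ _
  · rw [leftUnitor_inv_snd, Category.assoc, whiskerRight_snd, specTensor_snd, ← specOverMap_id]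
    congr 1
    exact (TruncPoly.mapₐ_id m).symm

end
end Jets
end

/-! ### Universal jets and jets inside an affine open set. -/

noncomputable section
namespace Jets

/-- The representing algebra has to be of finite type, so variables are introduced only for the
coefficients of the images of finitely many generators of `R`. The ideal `J` consists of the
equations saying that every relation of `R` maps to zero. -/
lemma TruncPoly.exists_universal_algHom (k : Type u) [Field k] (R : Type u) [CommRing R]
    [Algebra k R] [Algebra.FiniteType k R] (m : ℕ) :
    ∃ (H : Type u) (_ : CommRing H) (_ : Algebra k H) (_ : Algebra.FiniteType k H)
      (Φ : R →ₐ[k] TruncPoly H m), ∀ (C : Type u) [CommRing C] [Algebra k C]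
        (ψ : R →ₐ[k] TruncPoly C m), ∃! f : H →ₐ[k] C, (mapₐ m f).comp Φ = ψ := by
  obtain ⟨N, π, hπ⟩ := Algebra.FiniteType.iff_quotient_mvPolynomial''.1 ‹Algebra.FiniteType k R›
  let P := MvPolynomial (Fin N × Fin (m + 1)) k
  let Ψ : MvPolynomial (Fin N) k →ₐ[k] TruncPoly P m :=
    MvPolynomial.aeval fun i => ofCoeff fun j => MvPolynomial.X (i, j)
  let J : Ideal P := Ideal.span {c | ∃ f, π f = 0 ∧ ∃ j, c = coeff j (Ψ f)}
  let Q : P →ₐ[k] P ⧸ J := Ideal.Quotient.mkₐ k J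
  have hJ : ∀ f, π f = 0 → mapₐ m Q (Ψ f) = 0 := fun f hf => ext_coeff fun j => by
    rw [coeff_mapₐ, map_zero]
    exact Ideal.Quotient.eq_zero_iff_mem.2 (Ideal.subset_span ⟨f, hf, j, rfl⟩)
  let Φ : R →ₐ[k] TruncPoly (P ⧸ J) m :=
    AlgHom.liftOfSurjective π hπ ((mapₐ m Q).comp Ψ) (fun f hf => hJ f hf)
  have hΦ : ∀ f, Φ (π f) = mapₐ m Q (Ψ f) := fun f =>
    AlgHom.liftOfSurjective_apply π hπ ((mapₐ m Q).comp Ψ) (fun f hf => hJ f hf) f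
  refine ⟨P ⧸ J, inferInstance, inferInstance, inferInstance, Φ, fun C _ _ ψ => ?_⟩
  let e : P →ₐ[k] C := MvPolynomial.aeval fun x => coeff x.2 (ψ (π (MvPolynomial.X x.1)))
  have he : (mapₐ m e).comp Ψ = ψ.comp π := by
    ext i : 1
    refine ext_coeff fun j => ?_
    rw [AlgHom.comp_apply, coeff_mapₐ, MvPolynomial.aeval_X, coeff_ofCoeff, MvPolynomial.aeval_X]
    rfl
  have heJ : ∀ a ∈ J, e a = 0 := by
    intro a ha
    have : J ≤ RingHom.ker e := by
      rw [Ideal.span_le]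
      rintro c ⟨f, hf, i, rfl⟩
      change e _ = 0
      have := congr($he f)
      rw [AlgHom.comp_apply, AlgHom.comp_apply, hf, map_zero] at this
      rw [← coeff_mapₐ, this, map_zero]
    exact this ha
  have h1 : (Ideal.Quotient.liftₐ J e heJ).comp Q = e :=
    AlgHom.ext fun x => Ideal.Quotient.lift_mk J e.toRingHom heJ
  refine ⟨Ideal.Quotient.liftₐ J e heJ, ?_, ?_⟩
  · ext r : 1
    obtain ⟨f, rfl⟩ := hπ r
    rw [AlgHom.comp_apply, hΦ, ← AlgHom.comp_apply, ← mapₐ_comp]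
    rw [h1]
    exact congr($he f)
  · intro g hg
    have h2 : g.comp Q = e := by
      apply MvPolynomial.algHom_ext
      rintro ⟨i, j⟩
      have h3 := congr(coeff j ($hg (π (MvPolynomial.X i))))
      rw [AlgHom.comp_apply, hΦ, coeff_mapₐ, coeff_mapₐ, MvPolynomial.aeval_X,
        coeff_ofCoeff] at h3
      rw [MvPolynomial.aeval_X]
      exact h3
    ext y : 1
    obtain ⟨x, rfl⟩ := Ideal.Quotient.mk_surjective y
    exact (congr($h2 x)).trans congr($h1 x).symm

section
variable {k : Type u} [Field k] {X : SchOver k} {U : X.left.Opens}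

lemma fromSpec_hom (hU : IsAffineOpen U) :
    hU.fromSpec ≫ X.hom = Spec.map (CommRingCat.ofHom (algebraMap k Γ(X.left, U))) := by
  rw [← IsAffineOpen.SpecMap_appLE_fromSpec X.hom (isAffineOpen_top _) hU le_top,
    IsAffineOpen.fromSpec_top, Scheme.isoSpec_Spec_inv, ← Spec.map_comp]
  rfl

/-- The inclusion of an affine open set, as a morphism of `k`-schemes. -/
def fromSpecOver (hU : IsAffineOpen U) : specOver k Γ(X.left, U) ⟶ X :=
  Over.homMk hU.fromSpec (fromSpec_hom hU)

instance (hU : IsAffineOpen U) : Mono (fromSpecOver hU) := by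
  have : Mono ((Over.forget _).map (fromSpecOver hU)) := inferInstanceAs (Mono hU.fromSpec)
  exact (Over.forget _).mono_of_mono_map this

lemma exists_eq_comp_fromSpecOver (hU : IsAffineOpen U) {C : Type u} [CommRing C] [Algebra k C]
    (y : specOver k C ⟶ X) (hy : ⊤ ≤ y.left ⁻¹ᵁ U) :
    ∃ ψ : Γ(X.left, U) →ₐ[k] C, y = specOverMap ψ ≫ fromSpecOver hU := by
  have h1 : Set.range y.left ⊆ Set.range hU.fromSpec := by
    rw [hU.range_fromSpec]
    rintro _ ⟨x, rfl⟩
    exact hy (show x ∈ ⊤ from trivial)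
  have h2 := IsOpenImmersion.lift_fac hU.fromSpec y.left h1
  let y' : specOver k C ⟶ specOver k Γ(X.left, U) :=
    Over.homMk (IsOpenImmersion.lift hU.fromSpec y.left h1) (by
      rw [← Over.w y, ← Over.w (fromSpecOver hU)]
      exact (Category.assoc _ _ _).symm.trans (congrArg (· ≫ X.hom) h2))
  obtain ⟨ψ, hψ⟩ := specOverMap_surjective y'
  refine ⟨ψ, ?_⟩
  rw [← hψ]
  ext : 1
  exact h2.symm

/-- The family of jets in an affine open set which is defined by a homomorphism of algebras. -/
def affJet (hU : IsAffineOpen U) {m : ℕ} {C : Type u} [CommRing C] [Algebra k C]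
    (ψ : Γ(X.left, U) →ₐ[k] TruncPoly C m) : specOver k C ⟶ jetScheme X m :=
  (jetAff X m C).symm (specOverMap ψ ≫ fromSpecOver hU)

variable {m : ℕ} {C C' : Type u} [CommRing C] [Algebra k C] [CommRing C'] [Algebra k C']

lemma jetAff_affJet (hU : IsAffineOpen U) (ψ : Γ(X.left, U) →ₐ[k] TruncPoly C m) :
    jetAff X m C (affJet hU ψ) = specOverMap ψ ≫ fromSpecOver hU := Equiv.apply_symm_apply _ _

lemma affJet_injective (hU : IsAffineOpen U) :
    Function.Injective (affJet (m := m) (C := C) hU) := by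
  intro ψ ψ' h
  have := congrArg (jetAff X m C) h
  rw [jetAff_affJet, jetAff_affJet, cancel_mono] at this
  exact specOverMap_injective this

lemma specOverMap_comp_affJet (hU : IsAffineOpen U) (f : C →ₐ[k] C')
    (ψ : Γ(X.left, U) →ₐ[k] TruncPoly C m) :
    specOverMap f ≫ affJet hU ψ = affJet hU ((TruncPoly.mapₐ m f).comp ψ) := by
  apply (jetAff X m C').injective
  rw [jetAff_comp, jetAff_affJet, jetAff_affJet, specOverMap_comp, Category.assoc]

lemma affJet_proj (hU : IsAffineOpen U) {p : ℕ} (h : p ≤ m)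
    (ψ : Γ(X.left, U) →ₐ[k] TruncPoly C m) :
    affJet hU ψ ≫ jetProj X h = affJet hU ((TruncPoly.truncₐ k C h).comp ψ) := by
  apply (jetAff X p C).injective
  rw [jetAff_proj, jetAff_affJet, jetAff_affJet, specOverMap_comp, Category.assoc]

lemma specOverMap_aug_surjective (x : (specOver k (TruncPoly C m)).left) :
    ∃ y, (specOverMap (TruncPoly.aug k C m)).left y = x := by
  have hx : (x : PrimeSpectrum (TruncPoly C m)) ∈
      Set.range (PrimeSpectrum.comap (TruncPoly.aug k C m).toRingHom) := by
    rw [range_comap_of_surjective _ _ (TruncPoly.aug_surjective m)]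
    intro a ha
    refine Ideal.IsPrime.mem_of_pow_mem x.isPrime (m + 1) ?_
    rw [TruncPoly.isNilpotent_of_aug_eq_zero (k := k) m a ha]
    exact zero_mem _
  exact hx

/-- Factoring through an open set is a topological condition, and `Spec C → Spec C[t]/(t^{m+1})` is
surjective, so only the center of the jet matters. -/
lemma exists_affJet_iff (hU : IsAffineOpen U) (x : specOver k C ⟶ jetScheme X m) :
    (∃ ψ, x = affJet hU ψ) ↔ ⊤ ≤ (x ≫ jetCenter X m).left ⁻¹ᵁ U := by
  constructor
  · rintro ⟨ψ, rfl⟩ y -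
    rw [comp_jetCenter, jetAff_affJet, ← Category.assoc, ← specOverMap_comp]
    change hU.fromSpec ((specOverMap ((TruncPoly.aug k C m).comp ψ)).left y) ∈ (U : Set X.left)
    rw [← hU.range_fromSpec]
    exact ⟨_, rfl⟩
  · intro h
    obtain ⟨ψ, hψ⟩ := exists_eq_comp_fromSpecOver hU (jetAff X m C x) (by
      rintro z -
      obtain ⟨y, rfl⟩ := specOverMap_aug_surjective z
      rw [comp_jetCenter] at h
      exact h (show y ∈ ⊤ from trivial))
    exact ⟨ψ, (jetAff X m C).injective (by rw [hψ, jetAff_affJet])⟩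

lemma jetProj_center {p : ℕ} (h : p ≤ m) (x : specOver k C ⟶ jetScheme X m) :
    (x ≫ jetProj X h) ≫ jetCenter X p = x ≫ jetCenter X m := by
  rw [comp_jetCenter, comp_jetCenter, jetAff_proj, ← Category.assoc, ← specOverMap_comp,
    TruncPoly.aug_truncₐ]

/-- Truncation does not move the center, so a lift of a jet stays in the same affine chart. This
turns lifting of jets into lifting of algebra homomorphisms. -/
lemma exists_affJet_of_proj (hU : IsAffineOpen U) {p : ℕ} (h : p ≤ m)
    (x : specOver k C ⟶ jetScheme X m) (φ : Γ(X.left, U) →ₐ[k] TruncPoly C p)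
    (hx : x ≫ jetProj X h = affJet hU φ) :
    ∃ ψ, x = affJet hU ψ ∧ (TruncPoly.truncₐ k C h).comp ψ = φ := by
  obtain ⟨ψ, rfl⟩ := (exists_affJet_iff hU x).2 (by
    rw [← jetProj_center h]
    exact (exists_affJet_iff hU _).1 ⟨φ, hx⟩)
  exact ⟨ψ, rfl, affJet_injective hU (by rw [← affJet_proj, hx])⟩

end
end Jets
end

/-! ### Affine charts and Noetherianity of jet schemes. -/

noncomputable section
namespace Jets

section
variable {k : Type u} [Field k] {X : SchOver k} {U : X.left.Opens}

lemma finiteType_sections [LocallyOfFiniteType X.hom] (hU : IsAffineOpen U) :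
    Algebra.FiniteType k Γ(X.left, U) := by
  have h1 := LocallyOfFiniteType.finiteType_appLE X.hom (isAffineOpen_top (Spec (CommRingCat.of k)))
    hU le_top
  have h2 : RingHom.FiniteType (algebraMap k Γ(X.left, U)) :=
    h1.comp (RingHom.FiniteType.of_surjective _
      (ConcreteCategory.bijective_of_isIso (Scheme.ΓSpecIso (CommRingCat.of k)).inv).2)
  exact h2

/-- The jets with center in an affine open set form an affine scheme of finite type. -/
lemma exists_chart [LocallyOfFiniteType X.hom] (hU : IsAffineOpen U) (m : ℕ) :
    ∃ (H : Type u) (_ : CommRing H) (_ : Algebra k H) (_ : Algebra.FiniteType k H)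
      (Φ : Γ(X.left, U) →ₐ[k] TruncPoly H m), IsOpenImmersion (affJet hU Φ).left ∧
        Set.range (affJet hU Φ).left = (jetCenter X m).left ⁻¹' U := by
  have := finiteType_sections hU
  obtain ⟨H, _, _, _, Φ, hΦ⟩ := TruncPoly.exists_universal_algHom k Γ(X.left, U) m
  refine ⟨H, inferInstance, inferInstance, inferInstance, Φ, ?_⟩
  let V : (jetScheme X m).left.Opens := (jetCenter X m).left ⁻¹ᵁ U
  let VO : SchOver k := Over.mk (V.ι ≫ (jetScheme X m).hom)
  let i : VO ⟶ jetScheme X m := Over.homMk V.ι rfl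
  have hi : ∀ {T : SchOver k} (a b : T ⟶ VO), a ≫ i = b ≫ i → a = b := by
    intro T a b hab
    ext : 1
    exact (cancel_mono V.ι).1 congr(($hab).left)
  have hr : Set.range (affJet hU Φ).left ⊆ Set.range V.ι := by
    rw [Scheme.Opens.range_ι]
    rintro _ ⟨y, rfl⟩
    exact (exists_affJet_iff hU (affJet hU Φ)).1 ⟨Φ, rfl⟩ (show y ∈ ⊤ from trivial)
  have hl := IsOpenImmersion.lift_fac V.ι (affJet hU Φ).left hr
  let w : specOver k H ⟶ VO := Over.homMk (IsOpenImmersion.lift V.ι (affJet hU Φ).left hr) (by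
    rw [← Over.w (affJet hU Φ)]
    exact (Category.assoc _ _ _).symm.trans (congrArg (· ≫ (jetScheme X m).hom) hl))
  have hw : w ≫ i = affJet hU Φ := by
    ext : 1
    exact hl
  -- On `C`-points, the open subscheme `VO` parametrizes jets with center in `U`, that is,
  -- homomorphisms `Γ(X, U) → C[t]/(t^{m+1})`; these are what `H` represents.
  have : IsIso w := by
    refine isIso_of_affine w fun C _ _ z => ?_
    obtain ⟨ψ, hψ⟩ := (exists_affJet_iff hU (z ≫ i)).2 (by
      rintro y -
      change (jetCenter X m).left (V.ι (z.left y)) ∈ U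
      exact (z.left y).2)
    obtain ⟨f, hf, hfu⟩ := hΦ C ψ
    refine ⟨specOverMap f, ?_, fun y hy => ?_⟩
    · apply hi
      rw [Category.assoc, hw, hψ, specOverMap_comp_affJet, hf]
    · obtain ⟨g, rfl⟩ := specOverMap_surjective y
      congr 1
      apply hfu
      apply affJet_injective hU
      rw [← specOverMap_comp_affJet, ← hψ, ← hy, Category.assoc, hw]
  have hiso : IsIso w.left := inferInstanceAs (IsIso ((Over.forget _).map w))
  have hl' : (affJet hU Φ).left = w.left ≫ V.ι := hl.symm
  rw [hl']
  refine ⟨inferInstance, ?_⟩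
  rw [Scheme.Hom.comp_base, TopCat.coe_comp, Set.range_comp, Set.range_eq_univ.2 w.left.surjective,
    Set.image_univ, Scheme.Opens.range_ι]
  rfl

/-- Finitely many charts, each the spectrum of a Noetherian ring, cover the jet scheme. This is what
permits Noetherian induction on its closed subsets. -/
lemma noetherianSpace_jetScheme (X : SchOver k) [LocallyOfFiniteType X.hom] [QuasiCompact X.hom]
    (m : ℕ) : TopologicalSpace.NoetherianSpace (jetScheme X m).left := by
  have : CompactSpace X.left := (quasiCompact_iff_compactSpace X.hom).1 inferInstance
  have h1 := isCompact_univ.elim_finite_subcover (X := X.left)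
    (fun U : X.left.affineOpens => (U.1 : Set X.left)) (fun U => U.1.2)
    (fun x _ => by
      obtain ⟨_, ⟨U, hU, rfl⟩, hxU, -⟩ :=
        X.left.isBasis_affineOpens.exists_subset_of_mem_open (Set.mem_univ x) isOpen_univ
      exact Set.mem_iUnion.2 ⟨⟨U, hU⟩, hxU⟩)
  obtain ⟨s, hs⟩ := h1
  rw [← TopologicalSpace.noetherian_univ_iff]
  have h2 : (Set.univ : Set (jetScheme X m).left) =
      ⋃ U : s, (jetCenter X m).left ⁻¹' (U.1.1 : Set X.left) := by
    refine (Set.eq_univ_of_forall fun x => ?_).symm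
    obtain ⟨U, hU⟩ := Set.mem_iUnion.1 (hs (Set.mem_univ ((jetCenter X m).left x)))
    obtain ⟨hUs, hx⟩ := Set.mem_iUnion.1 hU
    exact Set.mem_iUnion.2 ⟨⟨U, hUs⟩, hx⟩
  rw [h2]
  have : ∀ U : s, TopologicalSpace.NoetherianSpace
      ((jetCenter X m).left ⁻¹' (U.1.1 : Set X.left) : Set (jetScheme X m).left) := by
    intro U
    obtain ⟨H, _, _, _, Φ, h3, h4⟩ := exists_chart U.1.2 m
    have : IsNoetherianRing H := Algebra.FiniteType.isNoetherianRing k H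
    rw [← h4]
    have : TopologicalSpace.NoetherianSpace (specOver k H).left :=
      inferInstanceAs (TopologicalSpace.NoetherianSpace (PrimeSpectrum H))
    exact TopologicalSpace.NoetherianSpace.range _ (affJet U.1.2 Φ).left.continuous
  exact TopologicalSpace.NoetherianSpace.iUnion _

end
end Jets
end

/-! ### Lifts of jets, derivations, and pulled back differentials. -/

noncomputable section
namespace Jets

namespace TruncPoly
variable {A B : Type u} [CommRing A] [CommRing B] {m p : ℕ}

lemma coeff_t_pow_mul (q : ℕ) (i : Fin (m + 1)) (x : TruncPoly A m) :
    coeff i (t A m ^ q * x) =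
      if q ≤ (i : ℕ) then coeff ⟨i - q, by omega⟩ x else 0 := by
  obtain ⟨x, rfl⟩ := Ideal.Quotient.mk_surjective x
  rw [t, ← _root_.map_pow, ← _root_.map_mul, coeff_mk, coeff_mk, Polynomial.coeff_X_pow_mul']

lemma coeff_congr {i j : Fin (m + 1)} (h : (i : ℕ) = j) (x : TruncPoly A m) :
    coeff i x = coeff j x := by
  rw [Fin.ext h]

lemma coeff_algebraMap_mul (a : A) (i : Fin (m + 1)) (x : TruncPoly A m) :
    coeff i (algebraMap A _ a * x) = a * coeff i x := by
  rw [← Algebra.smul_def, _root_.map_smul, smul_eq_mul]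

lemma t_pow_eq_zero {q : ℕ} (h : m < q) : t A m ^ q = 0 := by
  obtain ⟨c, rfl⟩ := Nat.exists_eq_add_of_le (Nat.succ_le_of_lt h)
  rw [pow_add, show t A m ^ m.succ = 0 from t_pow, zero_mul]

/-- Multiplication by `t^{m-p}` shifts coefficients and loses exactly those of degree above `p`. The
kernel of truncation thereby becomes an annihilator, which is the form used in `relDer` with `q = m
- p`. -/
lemma t_pow_mul_eq_zero_iff (h : p ≤ m) (x : TruncPoly A m) :
    t A m ^ (m - p) * x = 0 ↔ trunc A h x = 0 := by
  constructor
  · intro hx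
    refine ext_coeff fun i => ?_
    have := congrArg (coeff (⟨i + (m - p), by omega⟩ : Fin (m + 1))) hx
    rw [coeff_t_pow_mul, if_pos (by simp), map_zero] at this
    rw [coeff_trunc, map_zero, ← this]
    exact coeff_congr (by simp) x
  · intro hx
    refine ext_coeff fun i => ?_
    rw [coeff_t_pow_mul, map_zero]
    split_ifs with hi
    · have := congrArg (coeff (⟨i - (m - p), by omega⟩ : Fin (p + 1))) hx
      rw [coeff_trunc, map_zero] at this
      exact (coeff_congr rfl x).trans this
    · rfl

lemma exists_eq_t_pow_mul_of_trunc_eq_zero (h : p ≤ m) (x : TruncPoly A m)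
    (hx : trunc A h x = 0) : ∃ y, x = t A m ^ (p + 1) * y := by
  refine ⟨ofCoeff fun i => if hi : i + (p + 1) < m + 1 then coeff ⟨i + (p + 1), hi⟩ x else 0, ?_⟩
  refine ext_coeff fun i => ?_
  rw [coeff_t_pow_mul]
  split_ifs with hi
  · rw [coeff_ofCoeff, dif_pos (by simp only []; omega)]
    exact coeff_congr (by simp only []; omega) x
  · have := congrArg (coeff (⟨i, by omega⟩ : Fin (p + 1))) hx
    rw [coeff_trunc, map_zero] at this
    exact (coeff_congr rfl x).trans this

lemma trunc_t_pow_mul (h : p ≤ m) (x : TruncPoly A m) : trunc A h (t A m ^ (p + 1) * x) = 0 := by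
  rw [_root_.map_mul, _root_.map_pow, trunc_t, t_pow, zero_mul]

/-- The bound on `m` is used here: a product of two multiples of `t^{p+1}` is a multiple of
`t^{2p+2}`, and `2p + 2 > m`. -/
lemma mul_eq_zero_of_trunc_eq_zero (h : p ≤ m) (hm : m ≤ 2 * p + 1) {x y : TruncPoly A m}
    (hx : trunc A h x = 0) (hy : trunc A h y = 0) : x * y = 0 := by
  obtain ⟨x, rfl⟩ := exists_eq_t_pow_mul_of_trunc_eq_zero h x hx
  obtain ⟨y, rfl⟩ := exists_eq_t_pow_mul_of_trunc_eq_zero h y hy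
  rw [mul_mul_mul_comm, ← pow_add, t_pow_eq_zero (by omega), zero_mul]

/-- Induction on elements: constants, sums, and multiplication by `t`. -/
lemma induction {P : TruncPoly A m → Prop} (const : ∀ a, P (algebraMap A _ a))
    (add : ∀ x y, P x → P y → P (x + y)) (mul_t : ∀ x, P x → P (x * t A m)) (x) : P x := by
  obtain ⟨x, rfl⟩ := Ideal.Quotient.mk_surjective x
  induction x using Polynomial.induction_on with
  | C a => exact const a
  | add x y hx hy => rw [_root_.map_add]; exact add _ _ hx hy
  | monomial n a ih =>
    have h : (Ideal.Quotient.mk (Ideal.span {(Polynomial.X ^ (m + 1) : A[X])})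
        (Polynomial.C a * Polynomial.X ^ (n + 1))) = Ideal.Quotient.mk _
        (Polynomial.C a * Polynomial.X ^ n) * Ideal.Quotient.mk _ Polynomial.X := by
      rw [← _root_.map_mul, mul_assoc, ← pow_succ]
    exact h ▸ mul_t _ ih

instance [Module.Finite A A] : Module.Finite A (TruncPoly A m) := by
  have : Function.Surjective (LinearMap.toSpanSingleton A A (1 : A)) := fun a => ⟨a, by simp⟩
  let L : (Fin (m + 1) → A) →ₗ[A] TruncPoly A m :=
    { toFun := ofCoeff
      map_add' := fun a b => ext_coeff fun i => by simp
      map_smul' := fun a b => ext_coeff fun i => by simp }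
  exact Module.Finite.of_surjective L fun x => ⟨fun i => coeff i x, ext_coeff fun i => by simp [L]⟩

end TruncPoly

section
variable {k : Type u} [Field k] {R B C : Type u} [CommRing R] [Algebra k R] [CommRing B]
  [Algebra k B] [CommRing C] [Algebra k C] {m : ℕ}

/-- The derivations along a jet which are killed by `t^q`. -/
def relDer (ψ : R →ₐ[k] TruncPoly C m) (q : ℕ) : Submodule C (R →ₗ[k] TruncPoly C m) where
  carrier := {D | (∀ r s, D (r * s) = ψ r * D s + ψ s * D r) ∧
    ∀ r, TruncPoly.t C m ^ q * D r = 0}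
  add_mem' := fun ⟨h1, h2⟩ ⟨h3, h4⟩ => ⟨fun r s => by
    simp only [LinearMap.add_apply, h1, h3]; ring, fun r => by
    rw [LinearMap.add_apply, mul_add, h2, h4, add_zero]⟩
  zero_mem' := ⟨fun r s => by simp, fun r => by simp⟩
  smul_mem' := fun c D ⟨h1, h2⟩ => ⟨fun r s => by
    simp only [LinearMap.smul_apply, h1, smul_add, mul_smul_comm], fun r => by
    rw [LinearMap.smul_apply, mul_smul_comm, h2, smul_zero]⟩

/-- A lift of a jet plus a derivation is another lift. -/
lemma exists_lift_of_relDer {p : ℕ} (h : p ≤ m) (hm : m ≤ 2 * p + 1)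
    (ψ : R →ₐ[k] TruncPoly C m) (D : R →ₗ[k] TruncPoly C m) (hD : D ∈ relDer ψ (m - p)) :
    ∃ χ : R →ₐ[k] TruncPoly C m, (∀ r, χ r = ψ r + D r) ∧
      (TruncPoly.truncₐ k C h).comp χ = (TruncPoly.truncₐ k C h).comp ψ := by
  -- Since `D` takes values in the square-zero ideal `(t^{p+1})`, the quadratic error term `D r * D
  -- s` in the multiplicativity of `ψ + D` disappears.
  have h0 : ∀ r, TruncPoly.trunc C h (D r) = 0 := fun r =>
    (TruncPoly.t_pow_mul_eq_zero_iff h _).1 (hD.2 r)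
  have h1 : D 1 = 0 := by
    have := hD.1 1 1
    rw [mul_one, map_one ψ, one_mul] at this
    simpa using this
  refine ⟨AlgHom.ofLinearMap (ψ.toLinearMap + D) ?_ ?_, fun r => rfl, ?_⟩
  · simp [h1]
  · intro r s
    have := TruncPoly.mul_eq_zero_of_trunc_eq_zero h hm (h0 r) (h0 s)
    simp only [LinearMap.add_apply, AlgHom.toLinearMap_apply, map_mul, hD.1 r s]
    linear_combination -this
  · ext r
    simp [TruncPoly.truncₐ_apply, h0]

/-- The difference of two lifts of a jet is a derivation. -/
lemma exists_relDer_of_lift {p : ℕ} (h : p ≤ m) (hm : m ≤ 2 * p + 1)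
    (ψ χ : R →ₐ[k] TruncPoly C m)
    (hχ : (TruncPoly.truncₐ k C h).comp χ = (TruncPoly.truncₐ k C h).comp ψ) :
    ∃ D ∈ relDer ψ (m - p), ∀ r, χ r = ψ r + D r := by
  have h0 : ∀ r, TruncPoly.trunc C h (χ r - ψ r) = 0 := fun r => by
    rw [map_sub, sub_eq_zero]
    exact congr($hχ r)
  refine ⟨χ.toLinearMap - ψ.toLinearMap, ⟨fun r s => ?_, fun r => ?_⟩, fun r => by simp⟩
  · have := TruncPoly.mul_eq_zero_of_trunc_eq_zero h hm (h0 r) (h0 s)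
    simp only [LinearMap.sub_apply, AlgHom.toLinearMap_apply, map_mul]
    linear_combination this
  · exact (TruncPoly.t_pow_mul_eq_zero_iff h _).2 (h0 r)

/-- The pullback of the module of differentials along a jet. -/
def JetDiff (ψ : R →ₐ[k] TruncPoly B m) : Type u :=
  letI := ψ.toRingHom.toAlgebra
  TruncPoly B m ⊗[R] Ω[R⁄k]

namespace JetDiff
variable (ψ : R →ₐ[k] TruncPoly B m)

instance : AddCommGroup (JetDiff ψ) :=
  letI := ψ.toRingHom.toAlgebra
  show AddCommGroup (TruncPoly B m ⊗[R] Ω[R⁄k]) from inferInstance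

instance : Module (TruncPoly B m) (JetDiff ψ) :=
  letI := ψ.toRingHom.toAlgebra
  show Module (TruncPoly B m) (TruncPoly B m ⊗[R] Ω[R⁄k]) from inferInstance

instance : Module B (JetDiff ψ) := Module.compHom _ (algebraMap B (TruncPoly B m))

lemma smul_def (b : B) (x : JetDiff ψ) : b • x = algebraMap B (TruncPoly B m) b • x := rfl

instance : IsScalarTower B (TruncPoly B m) (JetDiff ψ) :=
  ⟨fun b a x => (congrArg (· • x) (Algebra.smul_def b a)).trans (mul_smul _ _ _)⟩

/-- The pullback of differentials. -/
def pull : Ω[R⁄k] →+ JetDiff ψ :=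
  letI := ψ.toRingHom.toAlgebra
  (TensorProduct.mk R (TruncPoly B m) Ω[R⁄k] 1).toAddMonoidHom

lemma pull_smul (r : R) (w : Ω[R⁄k]) : pull ψ (r • w) = ψ r • pull ψ w := by
  let := ψ.toRingHom.toAlgebra
  change (1 : TruncPoly B m) ⊗ₜ[R] (r • w) = ψ r • ((1 : TruncPoly B m) ⊗ₜ[R] w)
  rw [TensorProduct.tmul_smul, ← algebraMap_smul (TruncPoly B m) r]
  rfl

/-- The pullback of the differential of a function. -/
def d (r : R) : JetDiff ψ := pull ψ (KaehlerDifferential.D k R r)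

lemma d_mul (r s : R) : d ψ (r * s) = ψ r • d ψ s + ψ s • d ψ r := by
  rw [d, Derivation.leibniz, map_add, pull_smul, pull_smul]; rfl

lemma span_range_pull : Submodule.span (TruncPoly B m) (Set.range (pull ψ)) = ⊤ := by
  let := ψ.toRingHom.toAlgebra
  rw [eq_top_iff]
  rintro (x : TruncPoly B m ⊗[R] Ω[R⁄k]) -
  induction x with
  | zero => exact zero_mem _
  | add x y hx hy => exact add_mem hx hy
  | tmul a w =>
    have : a ⊗ₜ[R] w = a • ((1 : TruncPoly B m) ⊗ₜ[R] w) := by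
      rw [TensorProduct.smul_tmul', smul_eq_mul, mul_one]
    rw [this]
    exact Submodule.smul_mem _ _ (Submodule.subset_span ⟨w, rfl⟩)

lemma span_pull_of_span {s : Set Ω[R⁄k]} (hs : Submodule.span R s = ⊤) :
    Submodule.span (TruncPoly B m) (pull ψ '' s) = ⊤ := by
  rw [eq_top_iff, ← span_range_pull ψ, Submodule.span_le]
  rintro _ ⟨w, rfl⟩
  have hw : w ∈ Submodule.span R s := hs ▸ Submodule.mem_top
  induction hw using Submodule.span_induction with
  | mem x hx => exact Submodule.subset_span ⟨x, hx, rfl⟩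
  | zero => rw [map_zero]; exact zero_mem _
  | add x y _ _ hx hy => rw [map_add]; exact add_mem hx hy
  | smul a x _ hx => rw [pull_smul]; exact Submodule.smul_mem _ _ hx

lemma span_range_d : Submodule.span (TruncPoly B m) (Set.range (d ψ)) = ⊤ := by
  rw [← span_pull_of_span ψ (KaehlerDifferential.span_range_derivation k R), ← Set.range_comp]
  rfl

instance [Algebra.FiniteType k R] : Module.Finite (TruncPoly B m) (JetDiff ψ) := by
  obtain ⟨s, hs⟩ := (inferInstance : Module.Finite R Ω[R⁄k])
  refine ⟨⟨(s.finite_toSet.image (pull ψ)).toFinset, ?_⟩⟩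
  rw [Set.Finite.coe_toFinset]
  exact span_pull_of_span ψ hs

instance [Algebra.FiniteType k R] : Module.Finite B (JetDiff ψ) :=
  Module.Finite.trans (TruncPoly B m) _

/-- This is the universal property of the differentials followed by base change along `ψ`. The
actions of `R` and `k` on `E` are created inside the proof, so that `E` may be any module over the
truncated polynomial ring. -/
lemma exists_lift {E : Type u} [AddCommGroup E] [Module (TruncPoly B m) E] (D : R →+ E)
    (h1 : ∀ a : k, D (algebraMap k R a) = 0) (h2 : ∀ r s, D (r * s) = ψ r • D s + ψ s • D r) :
    ∃ L : JetDiff ψ →ₗ[TruncPoly B m] E, ∀ r, L (d ψ r) = D r := by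
  let := ψ.toRingHom.toAlgebra
  let : Module R E := Module.compHom E ψ.toRingHom
  let : Module k E := Module.compHom E (algebraMap k R)
  have t1 : IsScalarTower R (TruncPoly B m) E := ⟨fun r a x => by
    rw [Algebra.smul_def, mul_smul]; rfl⟩
  have t2 : IsScalarTower k R E := ⟨fun r a x => by
    rw [Algebra.smul_def, mul_smul]; rfl⟩
  let D' : Derivation k R E := Derivation.mk'
    { D with
      map_smul' := fun a r => by
        change D (a • r) = ψ (algebraMap k R a) • D r
        rw [Algebra.smul_def, h2, h1, smul_zero, add_zero] } (fun r s => h2 r s)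
  refine ⟨LinearMap.liftBaseChange (TruncPoly B m) D'.liftKaehlerDifferential, fun r => ?_⟩
  change LinearMap.liftBaseChange (TruncPoly B m) D'.liftKaehlerDifferential
    ((1 : TruncPoly B m) ⊗ₜ[R] (KaehlerDifferential.D k R r)) = _
  rw [LinearMap.liftBaseChange_tmul, one_smul, Derivation.liftKaehlerDifferential_comp_D]
  rfl

end JetDiff
end
end Jets
end

/-! ### Duality between derivations and functionals. -/

noncomputable section
namespace Jets

section
variable {k : Type u} [Field k] {R B C : Type u} [CommRing R] [Algebra k R] [CommRing B]
  [Algebra k B] [CommRing C] [Algebra k C] {m : ℕ}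

/-- The multiples of `t^q` in the pullback of the module of differentials. -/
def JetDiff.tPowRange (ψ : R →ₐ[k] TruncPoly B m) (q : ℕ) :
    Submodule (TruncPoly B m) (JetDiff ψ) :=
  LinearMap.range (LinearMap.lsmul (TruncPoly B m) (JetDiff ψ) (TruncPoly.t B m ^ q))

/-- The reduction modulo `t^q` of the pullback of the module of differentials along a jet. -/
abbrev JetDiffQuot (ψ : R →ₐ[k] TruncPoly B m) (q : ℕ) : Type u :=
  JetDiff ψ ⧸ JetDiff.tPowRange ψ q

namespace JetDiffQuot
variable (f : B →ₐ[k] C) (ψ : R →ₐ[k] TruncPoly B m) (q : ℕ)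

/-- The projection from the pullback of the module of differentials. -/
def proj : JetDiff ψ →ₗ[TruncPoly B m] JetDiffQuot ψ q := (JetDiff.tPowRange ψ q).mkQ

lemma proj_surjective : Function.Surjective (proj ψ q) := Submodule.mkQ_surjective _

lemma proj_smul (b : B) (x : JetDiff ψ) : proj ψ q (b • x) = b • proj ψ q x := rfl

lemma proj_t_pow_smul {i : ℕ} (hi : q ≤ i) (x : JetDiff ψ) :
    proj ψ q (TruncPoly.t B m ^ i • x) = 0 := by
  refine (Submodule.Quotient.mk_eq_zero _).2 ⟨TruncPoly.t B m ^ (i - q) • x, ?_⟩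
  rw [LinearMap.lsmul_apply, ← mul_smul, ← pow_add, Nat.add_sub_cancel' hi]

variable {f ψ q}

/-- The `C[t]/(t^{m+1})`-valued map defined by a `C`-valued functional, which is its top
coefficient. -/
def extend (l : JetDiffQuot ψ q →ₛₗ[f.toRingHom] C) : JetDiff ψ →+ TruncPoly C m where
  toFun x := TruncPoly.ofCoeff fun i => l (proj ψ q (TruncPoly.t B m ^ (m - (i : ℕ)) • x))
  map_zero' := TruncPoly.ext_coeff fun i => by
    rw [TruncPoly.coeff_ofCoeff, smul_zero, map_zero, map_zero, map_zero]
  map_add' x y := TruncPoly.ext_coeff fun i => by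
    rw [map_add, TruncPoly.coeff_ofCoeff, TruncPoly.coeff_ofCoeff, TruncPoly.coeff_ofCoeff,
      smul_add, map_add]
    exact LinearMap.map_add l _ _

lemma coeff_extend (l : JetDiffQuot ψ q →ₛₗ[f.toRingHom] C) (x : JetDiff ψ) (i : Fin (m + 1)) :
    TruncPoly.coeff i (extend l x) = l (proj ψ q (TruncPoly.t B m ^ (m - (i : ℕ)) • x)) :=
  TruncPoly.coeff_ofCoeff _ _

lemma coeff_last_extend (l : JetDiffQuot ψ q →ₛₗ[f.toRingHom] C) (x : JetDiff ψ) :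
    TruncPoly.coeff (Fin.last m) (extend l x) = l (proj ψ q x) := by
  rw [coeff_extend, Fin.val_last, Nat.sub_self, pow_zero, one_smul]

/-- It is enough to treat constants and `t`. The coefficient of `t^i` was defined through `t^{m-i} •
x`, so multiplying `x` by `t` shifts the coefficients by one, and the lowest one becomes `l` of
`t^{m+1} • x = 0`. -/
lemma extend_smul (l : JetDiffQuot ψ q →ₛₗ[f.toRingHom] C) (a : TruncPoly B m) (x : JetDiff ψ) :
    extend l (a • x) = TruncPoly.mapₐ m f a * extend l x := by
  induction a using TruncPoly.induction generalizing x with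
  | const b =>
    refine TruncPoly.ext_coeff fun i => ?_
    rw [TruncPoly.mapₐ_algebraMap, TruncPoly.coeff_algebraMap_mul, coeff_extend, coeff_extend,
      smul_comm, ← JetDiff.smul_def, proj_smul, LinearMap.map_smulₛₗ]
    rfl
  | add a b ha hb => rw [add_smul, map_add, map_add, ha, hb, add_mul]
  | mul_t a ha =>
    rw [mul_smul, ha, map_mul, mul_assoc, TruncPoly.mapₐ_t]
    congr 1
    refine TruncPoly.ext_coeff fun i => ?_
    rw [← pow_one (TruncPoly.t C m), TruncPoly.coeff_t_pow_mul, coeff_extend, ← mul_smul,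
      ← pow_succ]
    split_ifs with hi
    · rw [coeff_extend]
      congr 5
      simp only []
      omega
    · rw [TruncPoly.t_pow_eq_zero (by omega), show (0 : TruncPoly B m) • x = 0 from zero_smul (TruncPoly B m) x,
        map_zero]
      exact LinearMap.map_zero l

lemma t_pow_mul_extend (l : JetDiffQuot ψ q →ₛₗ[f.toRingHom] C) (x : JetDiff ψ) :
    TruncPoly.t C m ^ q * extend l x = 0 := by
  have := extend_smul l (TruncPoly.t B m ^ q) x
  rw [map_pow, TruncPoly.mapₐ_t] at this
  rw [← this]
  refine TruncPoly.ext_coeff fun i => ?_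
  rw [coeff_extend, smul_smul, ← pow_add, proj_t_pow_smul ψ q (by omega), map_zero, map_zero]

variable (f ψ q)

/-- The derivation along a jet which is defined by a functional. -/
def toRelDer : (JetDiffQuot ψ q →ₛₗ[f.toRingHom] C) →ₗ[C]
    relDer ((TruncPoly.mapₐ m f).comp ψ) q where
  toFun l := ⟨
    { toFun := fun r => extend l (JetDiff.d ψ r)
      map_add' := fun r s => by
        rw [JetDiff.d, map_add, map_add, map_add]; rfl
      map_smul' := fun a r => by
        have h : JetDiff.d ψ (a • r) = (algebraMap B (TruncPoly B m) (algebraMap k B a)) • JetDiff.d ψ r := by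
          rw [JetDiff.d, Derivation.map_smul, ← algebraMap_smul R a, JetDiff.pull_smul,
            AlgHom.commutes]
          rfl
        rw [h, extend_smul, TruncPoly.mapₐ_algebraMap, AlgHom.commutes]
        exact (Algebra.smul_def a (extend l (JetDiff.d ψ r))).symm }, fun r s => by
      change extend l _ = _ * extend l _ + _ * extend l _
      rw [JetDiff.d_mul, map_add, extend_smul, extend_smul]; rfl,
    fun r => t_pow_mul_extend l _⟩
  map_add' l l' := Subtype.ext (LinearMap.ext fun r => TruncPoly.ext_coeff fun i => by
    change TruncPoly.coeff i (extend (l + l') _) = TruncPoly.coeff i (extend l _ + extend l' _)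
    rw [map_add, coeff_extend, coeff_extend, coeff_extend]; rfl)
  map_smul' c l := Subtype.ext (LinearMap.ext fun r => TruncPoly.ext_coeff fun i => by
    change TruncPoly.coeff i (extend (c • l) _) = TruncPoly.coeff i (c • extend l _)
    rw [map_smul, coeff_extend, coeff_extend]; rfl)

variable {f ψ q}

lemma toRelDer_apply (l : JetDiffQuot ψ q →ₛₗ[f.toRingHom] C) (r : R) :
    (toRelDer f ψ q l).1 r = extend l (JetDiff.d ψ r) := rfl

/-- The values on differentials of functions determine `extend l` by linearity, and `l` is its top
coefficient. -/
lemma toRelDer_injective : Function.Injective (toRelDer f ψ q) := by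
  intro l l' hl
  have h : ∀ x : JetDiff ψ, extend l x = extend l' x := by
    intro x
    have hx : x ∈ Submodule.span (TruncPoly B m) (Set.range (JetDiff.d ψ)) := by
      rw [JetDiff.span_range_d]; trivial
    induction hx using Submodule.span_induction with
    | mem x hx =>
      obtain ⟨r, rfl⟩ := hx
      rw [← toRelDer_apply, ← toRelDer_apply, hl]
    | zero => rw [map_zero, map_zero]
    | add x y _ _ hx hy => rw [map_add, map_add, hx, hy]
    | smul a x _ hx => rw [extend_smul, extend_smul, hx]
  refine LinearMap.ext fun x => ?_
  obtain ⟨x, rfl⟩ := proj_surjective ψ q x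
  rw [← coeff_last_extend, h, coeff_last_extend]

lemma exists_extend {D : R →ₗ[k] TruncPoly C m} (hD : D ∈ relDer ((TruncPoly.mapₐ m f).comp ψ) q) :
    ∃ L : JetDiff ψ →+ TruncPoly C m,
      (∀ a x, L (a • x) = TruncPoly.mapₐ m f a * L x) ∧ ∀ r, L (JetDiff.d ψ r) = D r := by
  let : Module (TruncPoly B m) (TruncPoly C m) :=
    Module.compHom (TruncPoly C m) (TruncPoly.mapₐ m f).toRingHom
  obtain ⟨L, hL⟩ := JetDiff.exists_lift ψ (E := TruncPoly C m) D.toAddMonoidHom (fun a => by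
    have h1 : D 1 = 0 := by
      have := hD.1 1 1
      rw [mul_one, map_one ((TruncPoly.mapₐ m f).comp ψ), one_mul] at this
      simpa using this
    change D (algebraMap k R a) = 0
    rw [Algebra.algebraMap_eq_smul_one, map_smul, h1, smul_zero]) (fun r s => hD.1 r s)
  exact ⟨L.toAddMonoidHom, fun a x => L.map_smul a x, hL⟩

/-- The derivation extends to a linear map `L` on the pulled back differentials. As `t^q` kills `L`,
its top coefficient is a functional on the quotient by multiples of `t^q`. -/
lemma toRelDer_surjective : Function.Surjective (toRelDer f ψ q) := by
  rintro ⟨D, hD⟩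
  obtain ⟨L, hsm, hL⟩ := exists_extend hD
  have hL0 : ∀ x, TruncPoly.t C m ^ q * L x = 0 := by
    intro x
    have hx : x ∈ Submodule.span (TruncPoly B m) (Set.range (JetDiff.d ψ)) := by
      rw [JetDiff.span_range_d]; trivial
    induction hx using Submodule.span_induction with
    | mem x hx =>
      obtain ⟨r, rfl⟩ := hx
      rw [hL]
      exact hD.2 r
    | zero => rw [map_zero, mul_zero]
    | add x y _ _ hx hy => rw [map_add, mul_add, hx, hy, add_zero]
    | smul a x _ hx => rw [hsm, mul_left_comm, hx, mul_zero]
  let L' : JetDiffQuot ψ q →+ TruncPoly C m :=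
    QuotientAddGroup.lift (JetDiff.tPowRange ψ q).toAddSubgroup L (by
      rintro _ ⟨x, rfl⟩
      rw [LinearMap.lsmul_apply, AddMonoidHom.mem_ker, hsm, map_pow, TruncPoly.mapₐ_t, hL0])
  have hL' : ∀ x, L' (proj ψ q x) = L x := fun x => rfl
  refine ⟨{ toFun := fun x => TruncPoly.coeff (Fin.last m) (L' x)
            map_add' := fun x y => by rw [map_add, map_add]
            map_smul' := fun b x => ?_ }, ?_⟩
  · obtain ⟨x, rfl⟩ := proj_surjective ψ q x
    rw [← proj_smul, hL', hL', JetDiff.smul_def, hsm, TruncPoly.mapₐ_algebraMap,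
      TruncPoly.coeff_algebraMap_mul]
    rfl
  · refine Subtype.ext (LinearMap.ext fun r => TruncPoly.ext_coeff fun i => ?_)
    rw [toRelDer_apply, coeff_extend]
    change TruncPoly.coeff (Fin.last m) (L' _) = _
    -- The coefficient of degree `m` in `t^{m-i} * D r` is the coefficient of degree `i` in `D r`,
    -- so the top coefficient of `L` recovers all of `D`.
    rw [hL', hsm, hL, map_pow, TruncPoly.mapₐ_t, TruncPoly.coeff_t_pow_mul,
      if_pos (by rw [Fin.val_last]; omega)]
    exact TruncPoly.coeff_congr (by simp only [Fin.val_last]; omega) (D r)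

variable (f ψ q) in
/-- The functionals on the pulled back differentials correspond to the derivations. -/
def relDerEquiv : (JetDiffQuot ψ q →ₛₗ[f.toRingHom] C) ≃ₗ[C]
    relDer ((TruncPoly.mapₐ m f).comp ψ) q :=
  LinearEquiv.ofBijective (toRelDer f ψ q) ⟨toRelDer_injective, toRelDer_surjective⟩

end JetDiffQuot

/-- Semilinear functionals on a free module are determined by their values on a basis. -/
def semilinearEquiv {ι : Type} [Fintype ι] {B C : Type u} [CommRing B] [CommRing C] (σ : B →+* C)
    {N : Type u} [AddCommGroup N] [Module B N] (b : Module.Basis ι B N) :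
    (N →ₛₗ[σ] C) ≃ₗ[C] (ι → C) where
  toFun l i := l (b i)
  map_add' _ _ := rfl
  map_smul' _ _ := rfl
  invFun v :=
    { toFun := fun x => ∑ i, σ (b.repr x i) * v i
      map_add' := fun x y => by simp [add_mul, Finset.sum_add_distrib]
      map_smul' := fun a x => by simp [Finset.mul_sum, mul_assoc] }
  left_inv l := LinearMap.ext fun x => by
    conv_rhs => rw [← b.sum_repr x, map_sum]
    simp [LinearMap.map_smulₛₗ]
  right_inv v := by
    classical
    ext i
    simp [Finsupp.single_apply]

end
end Jets
end

/-! ### Universal lifts and trivial bundles of affine spaces. -/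

noncomputable section
namespace Jets

section
variable {k : Type u} [Field k] {R B B' : Type u} [CommRing R] [Algebra k R] [CommRing B]
  [Algebra k B] [CommRing B'] [Algebra k B'] {m p : ℕ}

/-- Functionals `lam j` with values in a `B`-algebra `B'` are coordinates if they form a basis of
the functionals with values in any `B'`-algebra. -/
def JetDiffQuot.IsCoordinates {ψ : R →ₐ[k] TruncPoly B m} {q d : ℕ} (i : B →ₐ[k] B')
    (lam : Fin d → JetDiffQuot ψ q →ₛₗ[i.toRingHom] B') : Prop :=
  ∀ (C : Type u) [CommRing C] [Algebra k C] (f : B' →ₐ[k] C)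
    (l : JetDiffQuot ψ q →ₛₗ[(f.comp i).toRingHom] C),
    ∃! v : Fin d → C, ∀ x, l x = ∑ j, f (lam j x) * v j

/-- The coordinate functions of a basis remain a basis of the functionals after every change of
ring. Working with functionals rather than with a basis of a base changed module keeps the same `ψ`
after a localization `B → B'`. -/
lemma JetDiffQuot.exists_isCoordinates_of_basis {ψ : R →ₐ[k] TruncPoly B m} {q d : ℕ}
    (b : Module.Basis (Fin d) B (JetDiffQuot ψ q)) :
    ∃ lam : Fin d → JetDiffQuot ψ q →ₛₗ[(AlgHom.id k B).toRingHom] B,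
      IsCoordinates (AlgHom.id k B) lam := by
  refine ⟨fun j => b.coord j, fun C _ _ f l => ?_⟩
  refine ⟨fun j => l (b j), fun x => ?_, fun v hv => funext fun j => ?_⟩
  · conv_lhs => rw [← b.sum_repr x, map_sum]
    refine Finset.sum_congr rfl fun j _ => ?_
    exact LinearMap.map_smulₛₗ l _ _
  · rw [show l (b j) = ∑ j', f (b.coord j' (b j)) * v j' from hv (b j), Finset.sum_eq_single j]
    · change v j = f (b.repr (b j) j) * v j
      rw [b.repr_self, Finsupp.single_eq_same, map_one, one_mul]
    · intro j' _ hj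
      change f (b.repr (b j) j') * v j' = 0
      rw [b.repr_self, Finsupp.single_eq_of_ne hj, map_zero, zero_mul]
    · intro h
      exact absurd (Finset.mem_univ j) h

/-- If the reduction of the pulled back differentials has coordinates, then the lifts of a jet are
parametrized by an affine space. -/
lemma exists_universal_lift (h : p ≤ m) (hm : m ≤ 2 * p + 1) (ψ : R →ₐ[k] TruncPoly B m) {d : ℕ}
    (i : B →ₐ[k] B') (lam : Fin d → JetDiffQuot ψ (m - p) →ₛₗ[i.toRingHom] B')
    (hlam : JetDiffQuot.IsCoordinates i lam) :
    ∃ Ψ : R →ₐ[k] TruncPoly (MvPolynomial (Fin d) B') m,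
      (TruncPoly.truncₐ k _ h).comp Ψ =
        (TruncPoly.mapₐ p ((IsScalarTower.toAlgHom k B' (MvPolynomial (Fin d) B')).comp i)).comp
          ((TruncPoly.truncₐ k B h).comp ψ) ∧
      ∀ (C : Type u) [CommRing C] [Algebra k C] (f : B' →ₐ[k] C) (χ : R →ₐ[k] TruncPoly C m),
        (TruncPoly.truncₐ k C h).comp χ =
          (TruncPoly.mapₐ p (f.comp i)).comp ((TruncPoly.truncₐ k B h).comp ψ) →
        ∃! g : MvPolynomial (Fin d) B' →ₐ[k] C,
          g.comp (IsScalarTower.toAlgHom k B' (MvPolynomial (Fin d) B')) = f ∧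
          (TruncPoly.mapₐ m g).comp Ψ = χ := by
  let i' : B' →ₐ[k] MvPolynomial (Fin d) B' := IsScalarTower.toAlgHom k B' _
  have htr : ∀ {C : Type u} [CommRing C] [Algebra k C] (f : B →ₐ[k] C),
      (TruncPoly.mapₐ p f).comp ((TruncPoly.truncₐ k B h).comp ψ) =
        (TruncPoly.truncₐ k C h).comp ((TruncPoly.mapₐ m f).comp ψ) := fun f => by
    rw [← AlgHom.comp_assoc, TruncPoly.mapₐ_truncₐ, AlgHom.comp_assoc]
  -- The generic functional `∑ X_j lam_j`. The universal lift is `ψ` plus its derivation, and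
  -- specializing the variables to `v` gives the lift attached to `∑ v_j lam_j`.
  let l₀ : JetDiffQuot ψ (m - p) →ₛₗ[(i'.comp i).toRingHom] MvPolynomial (Fin d) B' :=
    { toFun := fun x => ∑ j, i' (lam j x) * MvPolynomial.X j
      map_add' := fun x y => by simp only [map_add, add_mul, Finset.sum_add_distrib]
      map_smul' := fun a x => by
        rw [smul_eq_mul, Finset.mul_sum]
        refine Finset.sum_congr rfl fun j _ => ?_
        rw [LinearMap.map_smulₛₗ, smul_eq_mul, map_mul, mul_assoc]
        rfl }
  have hl₀ : ∀ x, l₀ x = ∑ j, i' (lam j x) * MvPolynomial.X j := fun x => rfl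
  obtain ⟨Ψ, hΨ, hΨt⟩ := exists_lift_of_relDer h hm ((TruncPoly.mapₐ m (i'.comp i)).comp ψ)
    (JetDiffQuot.toRelDer (i'.comp i) ψ (m - p) l₀).1
    (JetDiffQuot.toRelDer (i'.comp i) ψ (m - p) l₀).2
  refine ⟨Ψ, by rw [hΨt, htr], fun C _ _ f χ hχ => ?_⟩
  rw [htr] at hχ
  obtain ⟨D, hD, hχD⟩ := exists_relDer_of_lift h hm ((TruncPoly.mapₐ m (f.comp i)).comp ψ) χ hχ
  obtain ⟨l, hl⟩ := JetDiffQuot.toRelDer_surjective (f := f.comp i) ⟨D, hD⟩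
  have hl : ∀ r, JetDiffQuot.extend l (JetDiff.d ψ r) = D r := fun r => by
    rw [← JetDiffQuot.toRelDer_apply, hl]
  obtain ⟨v, hv, hvu⟩ := hlam C f l
  let g : MvPolynomial (Fin d) B' →ₐ[k] C :=
    { MvPolynomial.eval₂Hom f.toRingHom v with
      commutes' := fun a => by
        change MvPolynomial.eval₂Hom f.toRingHom _ (MvPolynomial.C (algebraMap k B' a)) = _
        rw [MvPolynomial.eval₂Hom_C]
        exact f.commutes a }
  have hgX : ∀ j, g (MvPolynomial.X j) = v j := fun j => MvPolynomial.eval₂Hom_X' _ _ _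
  have hgi : g.comp i' = f := AlgHom.ext fun a => MvPolynomial.eval₂Hom_C _ _ _
  have hgl : ∀ x, g (l₀ x) = l x := by
    intro x
    rw [hl₀, map_sum, hv]
    refine Finset.sum_congr rfl fun j _ => ?_
    rw [map_mul, hgX]
    congr 1
    exact congr($hgi _)
  refine ⟨g, ⟨hgi, ?_⟩, ?_⟩
  · refine AlgHom.ext fun r => ?_
    rw [AlgHom.comp_apply, hΨ, hχD, map_add, ← AlgHom.comp_apply, ← AlgHom.comp_assoc,
      ← TruncPoly.mapₐ_comp, ← AlgHom.comp_assoc, hgi]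
    congr 1
    refine TruncPoly.ext_coeff fun j => ?_
    rw [TruncPoly.coeff_mapₐ, JetDiffQuot.toRelDer_apply, JetDiffQuot.coeff_extend, hgl, ← hl,
      JetDiffQuot.coeff_extend]
  · rintro g' ⟨h1, h2⟩
    have hg' : ∀ x, g' (l₀ x) = ∑ j, f (lam j x) * g' (MvPolynomial.X j) := fun x => by
      rw [hl₀, map_sum]
      refine Finset.sum_congr rfl fun j _ => ?_
      rw [map_mul]
      congr 1
      exact congr($h1 _)
    let l' : JetDiffQuot ψ (m - p) →ₛₗ[(f.comp i).toRingHom] C :=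
      { toFun := fun x => g' (l₀ x)
        map_add' := fun x y => by rw [map_add, map_add]
        map_smul' := fun a x => by
          rw [LinearMap.map_smulₛₗ, smul_eq_mul, map_mul]
          exact congr($h1 (i a) * g' (l₀ x)) }
    -- For uniqueness, any `g'` inducing `χ` specializes the generic functional to one with the same
    -- derivation as `l`, hence to `l`; the values of `g'` on the variables are then the coordinates
    -- of `l`.
    have hl' : l' = l := by
      apply JetDiffQuot.toRelDer_injective
      refine Subtype.ext (LinearMap.ext fun r => TruncPoly.ext_coeff fun j => ?_)
      rw [JetDiffQuot.toRelDer_apply, JetDiffQuot.toRelDer_apply, hl]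
      have h3 := congr($h2 r)
      rw [AlgHom.comp_apply, hΨ, hχD, map_add, ← AlgHom.comp_apply, ← AlgHom.comp_assoc,
        ← TruncPoly.mapₐ_comp, ← AlgHom.comp_assoc, h1, add_right_inj,
        JetDiffQuot.toRelDer_apply] at h3
      rw [← h3, TruncPoly.coeff_mapₐ, JetDiffQuot.coeff_extend, JetDiffQuot.coeff_extend]
      rfl
    have hvg : (fun j => g' (MvPolynomial.X j)) = v := hvu _ fun x => by
      rw [← hg', ← hl']
      rfl
    apply AlgHom.coe_ringHom_injective
    apply MvPolynomial.ringHom_ext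
    · intro a
      exact congr($(h1.trans hgi.symm) a)
    · intro j
      exact (congrFun hvg j).trans (hgX j).symm

variable {X : SchOver k} {U : X.left.Opens}

/-- The morphism which forgets the coordinates. -/
abbrev affineProj (k B : Type u) [Field k] [CommRing B] [Algebra k B] (d : ℕ) :
    specOver k (MvPolynomial (Fin d) B) ⟶ specOver k B :=
  specOverMap (IsScalarTower.toAlgHom k B (MvPolynomial (Fin d) B))

/-- The jets of order `m` over a family of jets of order `p` which has a lift form a trivial
bundle of affine spaces when the pulled back differentials are free. -/
lemma exists_isPullback_affineProj (hU : IsAffineOpen U) (h : p ≤ m) (hm : m ≤ 2 * p + 1)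
    (ψ : Γ(X.left, U) →ₐ[k] TruncPoly B m) {d : ℕ}
    (i : B →ₐ[k] B') (lam : Fin d → JetDiffQuot ψ (m - p) →ₛₗ[i.toRingHom] B')
    (hlam : JetDiffQuot.IsCoordinates i lam) :
    ∃ q : specOver k (MvPolynomial (Fin d) B') ⟶ jetScheme X m,
      IsPullback q (affineProj k B' d) (jetProj X h)
        (affJet hU ((TruncPoly.mapₐ p i).comp ((TruncPoly.truncₐ k B h).comp ψ))) := by
  obtain ⟨Ψ, h1, h2⟩ := exists_universal_lift h hm ψ i lam hlam
  have sq : affJet hU Ψ ≫ jetProj X h = affineProj k B' d ≫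
      affJet hU ((TruncPoly.mapₐ p i).comp ((TruncPoly.truncₐ k B h).comp ψ)) := by
    rw [affJet_proj, h1, specOverMap_comp_affJet, TruncPoly.mapₐ_comp, AlgHom.comp_assoc]
  refine ⟨affJet hU Ψ, IsPullback.of_iso_pullback ⟨sq⟩ (@asIso _ _ _ _ (pullback.lift _ _ sq) ?_)
    (pullback.lift_fst _ _ _) (pullback.lift_snd _ _ _)⟩
  -- A `C`-point of the fiber product is a homomorphism `f : B' → C` with a lift of the jet
  -- specialized along `f`, which is the data parametrized by the universal lift.
  refine isIso_of_affine _ fun C _ _ z => ?_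
  obtain ⟨f, hf⟩ := specOverMap_surjective (z ≫ pullback.snd _ _)
  obtain ⟨χ, hχ, hχt⟩ := exists_affJet_of_proj hU h (z ≫ pullback.fst _ _)
    ((TruncPoly.mapₐ p (f.comp i)).comp ((TruncPoly.truncₐ k B h).comp ψ)) (by
      rw [Category.assoc, pullback.condition, ← Category.assoc, hf, specOverMap_comp_affJet,
        TruncPoly.mapₐ_comp, AlgHom.comp_assoc])
  obtain ⟨g, ⟨hg1, hg2⟩, hgu⟩ := h2 C f χ hχt
  refine ⟨specOverMap g, ?_, fun y hy => ?_⟩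
  · apply pullback.hom_ext
    · rw [Category.assoc, pullback.lift_fst, specOverMap_comp_affJet, hg2, hχ]
    · rw [Category.assoc, pullback.lift_snd, ← specOverMap_comp, hg1, hf]
  · obtain ⟨g', rfl⟩ := specOverMap_surjective y
    congr 1
    apply hgu
    constructor
    · apply specOverMap_injective
      rw [specOverMap_comp, ← hf, ← hy, Category.assoc, pullback.lift_snd]
    · apply affJet_injective hU
      rw [← specOverMap_comp_affJet, ← hχ, ← hy, Category.assoc, pullback.lift_fst]

end
end Jets
end

/-! ### Comparison with homomorphisms into `(t^{p+1})/(t^{m+1})`. -/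

noncomputable section
namespace Jets

section
variable {k : Type u} [Field k] {R : Type u} [CommRing R] [Algebra k R] {m p : ℕ}

lemma mem_truncIdeal (h : p ≤ m) (x : TruncPoly k m) :
    x ∈ truncIdeal k m p ↔ TruncPoly.trunc k h x = 0 := by
  rw [Ideal.mem_span_singleton]
  constructor
  · rintro ⟨y, rfl⟩
    exact TruncPoly.trunc_t_pow_mul h y
  · exact TruncPoly.exists_eq_t_pow_mul_of_trunc_eq_zero h x

/-- This makes the action of `k[t]/(t^{p+1})` on `(t^{p+1})/(t^{m+1})` independent of the chosen
lift of a scalar. -/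
lemma mul_eq_mul_of_trunc_eq (h : p ≤ m) (hm : m ≤ 2 * p + 1) {a b : TruncPoly k m}
    (hab : TruncPoly.trunc k h a = TruncPoly.trunc k h b) (x : truncIdeal k m p) :
    a * (x : TruncPoly k m) = b * x := by
  rw [← sub_eq_zero, ← sub_mul]
  exact TruncPoly.mul_eq_zero_of_trunc_eq_zero h hm (by rw [map_sub, hab, sub_self])
    ((mem_truncIdeal h _).1 x.2)

/-- The structure of a `k[t]/(t^{p+1})`-module on `(t^{p+1})/(t^{m+1})`. -/
abbrev truncIdealModule (k : Type u) [Field k] (h : p ≤ m) (hm : m ≤ 2 * p + 1) :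
    Module (TruncPoly k p) (truncIdeal k m p) :=
  let s := Function.surjInv (TruncPoly.trunc_surjective k h)
  have hs : ∀ a, TruncPoly.trunc k h (s a) = a :=
    Function.surjInv_eq (TruncPoly.trunc_surjective k h)
  { smul := fun a x => s a • x
    one_smul := fun x => Subtype.ext
      ((mul_eq_mul_of_trunc_eq h hm (by rw [hs, map_one]) x).trans (one_mul _))
    mul_smul := fun a b x => Subtype.ext
      ((mul_eq_mul_of_trunc_eq h hm (by rw [hs, map_mul, hs, hs]) x).trans (mul_assoc _ _ _))
    smul_zero := fun a => Subtype.ext (mul_zero (s a))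
    smul_add := fun a x y => Subtype.ext (mul_add (s a) _ _)
    add_smul := fun a b x => Subtype.ext
      ((mul_eq_mul_of_trunc_eq h hm (by rw [hs, map_add, hs, hs]) x).trans (add_mul _ _ _))
    zero_smul := fun x => Subtype.ext
      ((mul_eq_mul_of_trunc_eq h hm (by rw [hs, map_zero]) x).trans (zero_mul _)) }

/-- The homomorphisms into `(t^{p+1})/(t^{m+1})` define derivations. -/
def truncHomToRelDer (h : p ≤ m) (ψ : R →ₐ[k] TruncPoly k m) :
    truncHom k h (JetDiff ((TruncPoly.truncₐ k k h).comp ψ)) →ₗ[k] relDer ψ (m - p) where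
  toFun f := ⟨
    { toFun := fun r => (f.1 (JetDiff.d _ r) : TruncPoly k m)
      map_add' := fun r s => by
        rw [JetDiff.d, map_add, map_add, map_add]; rfl
      map_smul' := fun a r => by
        have h1 : JetDiff.d ((TruncPoly.truncₐ k k h).comp ψ) (a • r) =
            TruncPoly.trunc k h (algebraMap k _ a) • JetDiff.d _ r := by
          rw [JetDiff.d, Derivation.map_smul, ← algebraMap_smul R a, JetDiff.pull_smul,
            AlgHom.commutes]
          rfl
        rw [h1, f.2]
        exact (Algebra.smul_def a ((f.1 (JetDiff.d _ r) : TruncPoly k m))).symm },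
    fun r s => by
      change (f.1 _ : TruncPoly k m) = _ * (f.1 _ : TruncPoly k m) + _ * (f.1 _ : TruncPoly k m)
      have h1 : ∀ r x, f.1 ((TruncPoly.truncₐ k k h).comp ψ r • x) = ψ r • f.1 x :=
        fun r x => f.2 (ψ r) x
      rw [JetDiff.d_mul, map_add, h1, h1]
      rfl,
    fun r => (TruncPoly.t_pow_mul_eq_zero_iff h _).2 ((mem_truncIdeal h _).1 (f.1 _).2)⟩
  map_add' f g := rfl
  map_smul' c f := rfl

/-- A derivation killed by `t^{m-p}` has values in `(t^{p+1})`, where only the truncation of `ψ`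
acts. It therefore factors through the differentials pulled back along the truncated jet. -/
lemma truncHomToRelDer_bijective (h : p ≤ m) (hm : m ≤ 2 * p + 1) (ψ : R →ₐ[k] TruncPoly k m) :
    Function.Bijective (truncHomToRelDer h ψ) := by
  constructor
  · intro f g hfg
    refine Subtype.ext (AddMonoidHom.ext fun x => ?_)
    have hx : x ∈ Submodule.span (TruncPoly k p) (Set.range (JetDiff.d _)) := by
      rw [JetDiff.span_range_d]; trivial
    induction hx using Submodule.span_induction with
    | mem x hx =>
      obtain ⟨r, rfl⟩ := hx
      exact Subtype.ext congr(($hfg).1 r)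
    | zero => rw [map_zero, map_zero]
    | add x y _ _ hx hy => rw [map_add, map_add, hx, hy]
    | smul a x _ hx =>
      obtain ⟨a, rfl⟩ := TruncPoly.trunc_surjective k h a
      rw [f.2, g.2, hx]
  · rintro ⟨D, hD⟩
    let := truncIdealModule k h hm
    have hsm : ∀ (a : TruncPoly k m) (x : truncIdeal k m p),
        TruncPoly.trunc k h a • x = a • x := fun a x =>
      Subtype.ext (mul_eq_mul_of_trunc_eq h hm (b := a)
        (Function.surjInv_eq (TruncPoly.trunc_surjective k h) (TruncPoly.trunc k h a)) x)
    have hD0 : ∀ r, D r ∈ truncIdeal k m p := fun r =>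
      (mem_truncIdeal h _).2 ((TruncPoly.t_pow_mul_eq_zero_iff h _).1 (hD.2 r))
    let D' : R →+ truncIdeal k m p :=
      { toFun := fun r => ⟨D r, hD0 r⟩
        map_zero' := Subtype.ext (map_zero D)
        map_add' := fun r s => Subtype.ext (map_add D r s) }
    have h1 : D 1 = 0 := by
      have := hD.1 1 1
      rw [mul_one, map_one ψ, one_mul] at this
      simpa using this
    obtain ⟨L, hL⟩ := JetDiff.exists_lift ((TruncPoly.truncₐ k k h).comp ψ) D' (fun a =>
      Subtype.ext (by
        change D (algebraMap k R a) = 0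
        rw [Algebra.algebraMap_eq_smul_one, map_smul, h1, smul_zero])) (fun r s => by
      have h2 : ∀ r x, (TruncPoly.truncₐ k k h).comp ψ r • x = ψ r • x :=
        fun r (x : truncIdeal k m p) => hsm (ψ r) x
      rw [h2, h2]
      exact Subtype.ext (hD.1 r s))
    refine ⟨⟨L.toAddMonoidHom, fun a x => ?_⟩, Subtype.ext (LinearMap.ext fun r => ?_)⟩
    · rw [← hsm]
      exact L.map_smul _ _
    · exact congrArg Subtype.val (hL r)

/-- Both vector spaces are identified with the derivations along `ψ`: one directly, the other by the
top coefficient duality. -/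
lemma finrank_truncHom (h : p ≤ m) (hm : m ≤ 2 * p + 1) (ψ : R →ₐ[k] TruncPoly k m) {d : ℕ}
    (b : Module.Basis (Fin d) k (JetDiffQuot ψ (m - p))) :
    Nonempty (truncHom k h (JetDiff ((TruncPoly.truncₐ k k h).comp ψ)) ≃ₗ[k] (Fin d → k)) := by
  have e1 := LinearEquiv.ofBijective _ (truncHomToRelDer_bijective h hm ψ)
  have e2 := JetDiffQuot.relDerEquiv (AlgHom.id k k) ψ (m - p)
  rw [TruncPoly.mapₐ_id, AlgHom.id_comp] at e2
  exact ⟨e1.trans (e2.symm.trans (semilinearEquiv _ b))⟩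

variable {X : SchOver k} {U : X.left.Opens}

lemma jetMap_eq_of_affJet (hU : IsAffineOpen U) {γ : KPoint (jetScheme X m)}
    {φ : Γ(X.left, U) →ₐ[k] TruncPoly k m} (hγ : (unitSpec k).inv ≫ γ = affJet hU φ) :
    jetMap γ = specOverMap φ ≫ fromSpecOver hU := by
  rw [jetMap_eq, hγ, jetAff_affJet]

lemma exists_affJet_of_jetMap (hU : IsAffineOpen U) (γ : KPoint (jetScheme X m))
    (hγ : ⊤ ≤ (jetMap γ).left ⁻¹ᵁ U) :
    ∃ φ : Γ(X.left, U) →ₐ[k] TruncPoly k m, (unitSpec k).inv ≫ γ = affJet hU φ := by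
  obtain ⟨φ, hφ⟩ := exists_eq_comp_fromSpecOver hU _ hγ
  refine ⟨φ, (jetAff X m k).injective ?_⟩
  rw [← jetMap_eq, hφ, jetAff_affJet]

lemma appLE_eq_of_eq_fromSpec {Y : Scheme.{u}} {V : Y.Opens} (hV : IsAffineOpen V)
    {A : CommRingCat.{u}} (f : Spec A ⟶ Y) (hf : ⊤ ≤ f ⁻¹ᵁ V) (φ : Γ(Y, V) ⟶ A)
    (h : f = Spec.map φ ≫ hV.fromSpec) : f.appLE V ⊤ hf ≫ (Scheme.ΓSpecIso A).hom = φ := by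
  have h1 := IsAffineOpen.SpecMap_appLE_fromSpec f hV (isAffineOpen_top (Spec A)) hf
  rw [IsAffineOpen.fromSpec_top, Scheme.isoSpec_Spec_inv] at h1
  have h3 : Spec.map (f.appLE V ⊤ hf) = Spec.map (Scheme.ΓSpecIso A).inv ≫ Spec.map φ := by
    rw [← cancel_mono hV.fromSpec, h1, Category.assoc, ← h]
  rw [← Spec.map_comp] at h3
  rw [Spec.map_injective h3, Category.assoc, Iso.inv_hom_id, Category.comp_id]

/-- Links the geometric description of a jet in `U`, by pulling back sections, with the algebra
homomorphism used in the computations. -/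
lemma jetRingHom_eq (hU : IsAffineOpen U) {γ : KPoint (jetScheme X m)}
    (hγ : ⊤ ≤ (jetMap γ).left ⁻¹ᵁ U) {φ : Γ(X.left, U) →ₐ[k] TruncPoly k m}
    (hφ : (unitSpec k).inv ≫ γ = affJet hU φ) : jetRingHom γ U hγ = φ.toRingHom := by
  have h2 : (jetMap γ).left = Spec.map (CommRingCat.ofHom φ.toRingHom) ≫ hU.fromSpec := by
    rw [jetMap_eq_of_affJet hU hφ]; rfl
  exact congrArg CommRingCat.Hom.hom (appLE_eq_of_eq_fromSpec hU (jetMap γ).left hγ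
    (CommRingCat.ofHom φ.toRingHom) h2)

end
end Jets
end

/-! ### Fibers of the projections as vector spaces. -/

noncomputable section
namespace Jets

lemma nonempty_pullback_iso_of_isPullback {C : Type*} [Category C] {P Y Z S T : C} {q : P ⟶ Y}
    {a : P ⟶ S} {f : Y ⟶ Z} {g : S ⟶ Z} (hq : IsPullback q a f g) [HasPullbacks C] (e : T ≅ S)
    {γ : T ⟶ Z} (hγ : e.inv ≫ γ = g) : Nonempty (pullback f γ ≅ P) := by
  have h1 : IsPullback q (a ≫ e.inv) f γ := by
    refine IsPullback.of_iso hq (Iso.refl _) (Iso.refl _) e.symm (Iso.refl _) ?_ ?_ ?_ ?_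
    · simp
    · simp
    · simp
    · rw [← hγ]; simp
  exact ⟨(IsPullback.of_hasPullback _ _).isoIsPullback _ _ h1⟩

section
variable {k : Type u} [Field k]

lemma nonempty_vectorSpaceScheme_iso {V : Type u} [AddCommGroup V] [Module k V] {d : ℕ}
    (e : V ≃ₗ[k] (Fin d → k)) : Nonempty (affineSpace k d ≅ vectorSpaceScheme k V) := by
  let b : Module.Basis (Fin d) k V := Module.Basis.ofEquivFun e
  let f : SymmetricAlgebra k (Module.Dual k V) ≃ₐ[k] MvPolynomial (Fin d) k :=
    SymmetricAlgebra.equivMvPolynomial b.dualBasis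
  refine ⟨⟨specOverMap f.toAlgHom, specOverMap f.symm.toAlgHom, ?_, ?_⟩⟩
  · rw [← specOverMap_comp]
    convert specOverMap_id
    ext x
    exact congrArg _ (f.apply_symm_apply (MvPolynomial.X x))
  · rw [← specOverMap_comp]
    convert specOverMap_id
    exact AlgHom.ext fun x => f.symm_apply_apply x

variable {X : SchOver k} {U : X.left.Opens} {m p : ℕ}

lemma exists_lift_of_affJet (hU : IsAffineOpen U) (h : p ≤ m) {γ : KPoint (jetScheme X p)}
    {φ : Γ(X.left, U) →ₐ[k] TruncPoly k p} (hφ : (unitSpec k).inv ≫ γ = affJet hU φ)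
    {δ : KPoint (jetScheme X m)} (hδ : δ ≫ jetProj X h = γ) :
    ∃ ψ : Γ(X.left, U) →ₐ[k] TruncPoly k m, (unitSpec k).inv ≫ δ = affJet hU ψ ∧
      (TruncPoly.truncₐ k k h).comp ψ = φ :=
  exists_affJet_of_proj hU h ((unitSpec k).inv ≫ δ) φ (by rw [Category.assoc, hδ, hφ])

lemma nonempty_pullback_iso (hU : IsAffineOpen U) (h : p ≤ m) (hm : m ≤ 2 * p + 1)
    {γ : KPoint (jetScheme X p)} (ψ : Γ(X.left, U) →ₐ[k] TruncPoly k m)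
    (hγ : (unitSpec k).inv ≫ γ = affJet hU ((TruncPoly.truncₐ k k h).comp ψ)) {d : ℕ}
    (b : Module.Basis (Fin d) k (JetDiffQuot ψ (m - p))) :
    Nonempty (pullback (jetProj X h) γ ≅ affineSpace k d) := by
  obtain ⟨lam, hlam⟩ := JetDiffQuot.exists_isCoordinates_of_basis b
  obtain ⟨q, hq⟩ := exists_isPullback_affineProj hU h hm ψ _ lam hlam
  rw [TruncPoly.mapₐ_id, AlgHom.id_comp] at hq
  exact nonempty_pullback_iso_of_isPullback hq (unitSpec k) hγ

/-- The module structure in `JetOmega` depends on the ring homomorphism itself, so the equality `ρ =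
φ` is carried as a hypothesis and eliminated by substitution. -/
lemma nonempty_truncHom_equiv (h : p ≤ m) {R : Type u} [CommRing R] [Algebra k R]
    {ρ : R →+* TruncPoly k p} {φ : R →ₐ[k] TruncPoly k p} (hρ : ρ = φ.toRingHom) :
    letI := ρ.toAlgebra
    Nonempty (truncHom k h (TruncPoly k p ⊗[R] Ω[R⁄k]) ≃ₗ[k] truncHom k h (JetDiff φ)) := by
  subst hρ
  exact ⟨LinearEquiv.refl _ _⟩

/-- The fibers of the projections between jet schemes are affine spaces. -/
theorem nonempty_pullback_iso_vectorSpaceScheme (h : p ≤ m) (hm : m ≤ 2 * p + 1)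
    [LocallyOfFiniteType X.hom]
    (γ : KPoint (jetScheme X p)) (hγ : ∃ δ : KPoint (jetScheme X m), δ ≫ jetProj X h = γ)
    (U : X.left.Opens) (hγU : ⊤ ≤ (jetMap γ).left ⁻¹ᵁ U) (hU : IsAffineOpen U) :
    Nonempty (pullback (jetProj X h) γ ≅
      vectorSpaceScheme k (truncHom k h (JetOmega γ U hγU))) := by
  obtain ⟨δ, hδ⟩ := hγ
  obtain ⟨φ, hφ⟩ := exists_affJet_of_jetMap hU γ hγU
  obtain ⟨ψ, hψ, rfl⟩ := exists_lift_of_affJet hU h hφ hδ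
  have := finiteType_sections hU
  let b := Module.finBasis k (JetDiffQuot ψ (m - p))
  -- Both schemes are affine spaces of the same dimension, the number of elements of the basis `b`.
  obtain ⟨e1⟩ := nonempty_pullback_iso hU h hm ψ hφ b
  obtain ⟨e2⟩ := nonempty_truncHom_equiv h (jetRingHom_eq hU hγU hφ)
  obtain ⟨e3⟩ := finrank_truncHom h hm ψ b
  obtain ⟨e4⟩ := nonempty_vectorSpaceScheme_iso (e2.trans e3)
  exact ⟨e1.trans e4⟩

end

end Jets
end

/-! ### Fitting ideals: independence of the generators. -/

noncomputable section
namespace Jets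

section
variable {R : Type u} [CommRing R] {M : Type v} [AddCommGroup M] [Module R M]

/-- By multilinearity of the determinant, the rows may be replaced one at a time by elements of the
spanning sets. -/
lemma det_mem_of_mem_span {ι : Type*} [Fintype ι] [DecidableEq ι] {I : Ideal R}
    (V : ι → Set (ι → R)) (h : ∀ w : Matrix ι ι R, (∀ i, w i ∈ V i) → w.det ∈ I)
    (w : Matrix ι ι R) (hw : ∀ i, w i ∈ Submodule.span R (V i)) : w.det ∈ I := by
  suffices ∀ (t : Finset ι) (w : Matrix ι ι R), (∀ i ∈ t, w i ∈ Submodule.span R (V i)) →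
      (∀ i ∉ t, w i ∈ V i) → w.det ∈ I from
    this Finset.univ w (fun i _ => hw i) fun i hi => absurd (Finset.mem_univ i) hi
  intro t
  induction t using Finset.induction_on with
  | empty => exact fun w _ hw => h w fun i => hw i (Finset.notMem_empty i)
  | insert a t ha ih =>
    intro w h1 h2
    let L : (ι → R) →ₗ[R] R :=
      (Matrix.detRowAlternating (n := ι) (R := R)).toMultilinearMap.toLinearMap w a
    have hL : ∀ x, L x = (w.updateRow a x).det := fun x => rfl
    have h3 : V a ⊆ Submodule.comap L I := fun x hx => by
      change L x ∈ I
      rw [hL]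
      refine ih _ (fun i hi => ?_) fun i hi => ?_
      · rw [Matrix.updateRow_ne (fun h : i = a => ha (h ▸ hi))]
        exact h1 i (Finset.mem_insert_of_mem hi)
      · by_cases hia : i = a
        · subst hia
          rwa [Matrix.updateRow_self]
        · rw [Matrix.updateRow_ne hia]
          exact h2 i fun h => (Finset.mem_insert.1 h).elim hia hi
    have h4 := Submodule.span_le.2 h3 (h1 a (Finset.mem_insert_self _ _))
    rwa [Submodule.mem_comap, hL, Matrix.updateRow_eq_self] at h4

/-- The ideal generated by the determinants of matrices of which all but `i` rows are relations
between the given elements. For a system of generators it is the `i`-th Fitting ideal. -/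
def fittingSpan {ι : Type*} [Fintype ι] [DecidableEq ι] (i : ℤ) (g : ι → M) : Ideal R :=
  Ideal.span {d | ∃ (w : Matrix ι ι R) (s : Finset ι), (Fintype.card ι : ℤ) ≤ s.card + i ∧
    (∀ a ∈ s, ∑ j, w a j • g j = 0) ∧ d = w.det}

section
variable {ι : Type*} [Fintype ι] [DecidableEq ι] {i : ℤ} {g : ι → M}

lemma det_mem_fittingSpan {w : Matrix ι ι R} (s : Finset ι)
    (hs : (Fintype.card ι : ℤ) ≤ s.card + i) (hw : ∀ a ∈ s, ∑ j, w a j • g j = 0) :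
    w.det ∈ fittingSpan i g := Ideal.subset_span ⟨w, s, hs, hw, rfl⟩

lemma fittingSpan_le {I : Ideal R} : fittingSpan i g ≤ I ↔ ∀ (w : Matrix ι ι R) (s : Finset ι),
    (Fintype.card ι : ℤ) ≤ s.card + i → (∀ a ∈ s, ∑ j, w a j • g j = 0) → w.det ∈ I := by
  rw [fittingSpan, Ideal.span_le]
  constructor
  · intro h w s hs hw
    exact h ⟨w, s, hs, hw, rfl⟩
  · rintro h _ ⟨w, s, hs, hw, rfl⟩
    exact h w s hs hw

lemma fittingSpan_comp_equiv_le {κ : Type*} [Fintype κ] [DecidableEq κ] (e : κ ≃ ι) :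
    fittingSpan i (g ∘ e) ≤ fittingSpan (R := R) i g := by
  refine fittingSpan_le.2 fun w s hs hw => ?_
  rw [← Matrix.det_reindex_self e w]
  refine det_mem_fittingSpan (s.map e.toEmbedding) ?_ fun a ha => ?_
  · rwa [Finset.card_map, ← Fintype.card_congr e]
  · rw [Finset.mem_map_equiv] at ha
    rw [← hw _ ha, ← e.sum_comp]
    simp

lemma fittingSpan_comp_equiv {κ : Type*} [Fintype κ] [DecidableEq κ] (e : κ ≃ ι) :
    fittingSpan i (g ∘ e) = fittingSpan (R := R) i g := by
  refine le_antisymm (fittingSpan_comp_equiv_le e) ?_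
  refine le_of_eq_of_le ?_ (fittingSpan_comp_equiv_le e.symm)
  congr 1
  ext j
  simp

/-- If a row of `w` is a relation for `g`, the same row of `w * C` is a relation for `g'`, and the
determinant is unchanged. Square matrices with free rows, in place of minors, make this argument
immediate. -/
lemma fittingSpan_le_of_matrix {g' : ι → M} (C : Matrix ι ι R) (hC : C.det = 1)
    (h : ∀ j, g j = ∑ l, C j l • g' l) : fittingSpan (R := R) i g ≤ fittingSpan i g' := by
  refine fittingSpan_le.2 fun w s hs hw => ?_
  rw [← mul_one w.det, ← hC, ← Matrix.det_mul]
  refine det_mem_fittingSpan s hs fun a ha => ?_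
  rw [← hw a ha]
  simp_rw [Matrix.mul_apply, Finset.sum_smul, h, Finset.smul_sum, smul_smul]
  exact Finset.sum_comm

lemma fittingSpan_comp_injective {M' : Type*} [AddCommGroup M'] [Module R M'] {f : M →ₗ[R] M'}
    (hf : Function.Injective f) : fittingSpan (R := R) i (f ∘ g) = fittingSpan i g := by
  have h : ∀ w : ι → R, ∑ j, w j • (f ∘ g) j = 0 ↔ ∑ j, w j • g j = 0 := fun w => by
    rw [← map_eq_zero_iff f hf]
    simp
  refine le_antisymm (fittingSpan_le.2 fun w s hs hw => ?_) (fittingSpan_le.2 fun w s hs hw => ?_)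
  · exact det_mem_fittingSpan s hs fun a ha => (h _).1 (hw a ha)
  · exact det_mem_fittingSpan s hs fun a ha => (h _).2 (hw a ha)

end

section
variable {n : ℕ} {i : ℤ} {g : Fin n → M}

/-- For one inclusion, expand along the column of the zero generator: each minor loses at most one
relation row. For the other, border the matrix by a unit row, which is a relation because the new
generator is zero. -/
lemma fittingSpan_cons_zero :
    fittingSpan (R := R) i (Fin.cons 0 g : Fin (n + 1) → M) = fittingSpan i g := by
  apply le_antisymm
  · refine fittingSpan_le.2 fun w s hs hw => ?_
    rw [Matrix.det_succ_column_zero]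
    refine Ideal.sum_mem _ fun a _ => Ideal.mul_mem_left _ _ ?_
    let s' : Finset (Fin n) := Finset.univ.filter fun b => a.succAbove b ∈ s
    refine det_mem_fittingSpan s' ?_ fun b hb => ?_
    · have h1 : s ⊆ insert a (s'.map (Fin.succAboveEmb a)) := fun x hx => by
        rcases Fin.eq_self_or_eq_succAbove a x with rfl | ⟨b, rfl⟩
        · exact Finset.mem_insert_self _ _
        · refine Finset.mem_insert_of_mem (Finset.mem_map.2 ⟨b, ?_, rfl⟩)
          simpa [s'] using hx
      have h2 := (Finset.card_le_card h1).trans (Finset.card_insert_le _ _)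
      rw [Finset.card_map] at h2
      simp only [Fintype.card_fin] at hs ⊢
      omega
    · rw [← hw (a.succAbove b) (by simpa [s'] using hb), Fin.sum_univ_succ]
      simp
  · refine fittingSpan_le.2 fun w s hs hw => ?_
    let W : Matrix (Fin (n + 1)) (Fin (n + 1)) R :=
      Fin.cons (Fin.cons 1 0) fun a => Fin.cons 0 (w a)
    have hW : W.det = w.det := by
      rw [Matrix.det_succ_column_zero, Fin.sum_univ_succ]
      simp [W]
      rfl
    rw [← hW]
    refine det_mem_fittingSpan (insert 0 (s.map (Fin.succEmb n))) ?_ fun a ha => ?_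
    · rw [Finset.card_insert_of_notMem (by simp), Finset.card_map]
      simp only [Fintype.card_fin] at hs ⊢
      omega
    · rcases Finset.mem_insert.1 ha with rfl | ha
      · rw [Fin.sum_univ_succ]
        simp [W]
      · obtain ⟨b, hb, rfl⟩ := Finset.mem_map.1 ha
        rw [← hw b hb, Fin.sum_univ_succ]
        simp [W]

lemma fittingSpan_cons_le (c : Fin n → R) (x y : M) (hx : x = y + ∑ j, c j • g j) :
    fittingSpan (R := R) i (Fin.cons x g : Fin (n + 1) → M) ≤
      fittingSpan i (Fin.cons y g : Fin (n + 1) → M) := by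
  let C : Matrix (Fin (n + 1)) (Fin (n + 1)) R :=
    Fin.cons (Fin.cons 1 c) fun a => Fin.cons 0 (Pi.single a 1)
  refine fittingSpan_le_of_matrix C ?_ fun j => ?_
  · rw [Matrix.det_succ_column_zero, Fin.sum_univ_succ]
    have h1 : C.submatrix Fin.succ Fin.succ = (1 : Matrix (Fin n) (Fin n) R) := by
      ext a b
      change (Pi.single a 1 : Fin n → R) b = _
      simp [Matrix.one_apply, Pi.single_apply, eq_comm]
    have h2 : ∀ a : Fin n, C a.succ 0 = 0 := fun a => rfl
    have h3 : C 0 0 = 1 := rfl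
    simp [h1, h2, h3]
  · refine Fin.cases ?_ (fun a => ?_) j
    · rw [Fin.sum_univ_succ]
      simp [C, hx]
    · rw [Fin.sum_univ_succ]
      simp [C, Pi.single_apply]

/-- A unipotent change of generators replaces the redundant generator `x` by zero. -/
lemma fittingSpan_cons {x : M} (hx : x ∈ Submodule.span R (Set.range g)) :
    fittingSpan (R := R) i (Fin.cons x g : Fin (n + 1) → M) = fittingSpan i g := by
  obtain ⟨c, rfl⟩ := (Submodule.mem_span_range_iff_exists_fun R).1 hx
  rw [← fittingSpan_cons_zero (g := g)]
  refine le_antisymm (fittingSpan_cons_le c (∑ j, c j • g j) 0 (zero_add _).symm)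
    (fittingSpan_cons_le (-c) 0 (∑ j, c j • g j) ?_)
  simp only [Pi.neg_apply, neg_smul, Finset.sum_neg_distrib, add_neg_cancel]

end

section
variable {ι κ : Type*} [Fintype ι] [DecidableEq ι] [Fintype κ] [DecidableEq κ] {i : ℤ} {g : ι → M}

lemma fittingSpan_option {x : M} (hx : x ∈ Submodule.span R (Set.range g)) :
    fittingSpan (R := R) i (fun o : Option ι => o.elim x g) = fittingSpan i g := by
  let e := (Fintype.equivFin ι).symm
  rw [← fittingSpan_comp_equiv e (g := g), ← fittingSpan_cons (x := x),
    ← fittingSpan_comp_equiv ((finSuccEquiv _).trans e.optionCongr)]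
  · congr 1
    ext j
    refine Fin.cases ?_ (fun a => ?_) j <;> simp
  · rwa [e.surjective.range_comp]

/-- Redundant generators are added one at a time. Two systems of generators are then compared
through their union. -/
lemma fittingSpan_sum (h : κ → M) (hh : ∀ j, h j ∈ Submodule.span R (Set.range g)) :
    fittingSpan (R := R) i (Sum.elim g h) = fittingSpan i g := by
  let e := (Fintype.equivFin κ).symm
  rw [← fittingSpan_comp_equiv ((Equiv.refl ι).sumCongr e)]
  have he : Sum.elim g h ∘ ((Equiv.refl ι).sumCongr e) = Sum.elim g (h ∘ e) := by
    ext j; cases j <;> rfl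
  rw [he]
  replace hh : ∀ j, (h ∘ e) j ∈ Submodule.span R (Set.range g) := fun j => hh (e j)
  generalize h ∘ e = h' at hh
  generalize Fintype.card κ = n at h' hh
  induction n with
  | zero =>
    rw [← fittingSpan_comp_equiv (Equiv.sumEmpty ι (Fin 0)).symm]
    rfl
  | succ n ih =>
    rw [← ih (fun j : Fin n => h' j.succ) fun j => hh _,
      ← fittingSpan_option (g := Sum.elim g fun j : Fin n => h' j.succ) (x := h' 0)]
    · let E : Option (ι ⊕ Fin n) ≃ ι ⊕ Fin (n + 1) :=
        ((Equiv.optionEquivSumPUnit.{0} (ι ⊕ Fin n)).trans (Equiv.sumAssoc _ _ _)).trans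
          ((Equiv.refl ι).sumCongr ((Equiv.optionEquivSumPUnit.{0} (Fin n)).symm.trans
            (finSuccEquiv n).symm))
      rw [← fittingSpan_comp_equiv E]
      congr 1
      ext o
      rcases o with _ | (a | a) <;> simp [E]
    · exact Submodule.span_mono (by rintro _ ⟨j, rfl⟩; exact ⟨Sum.inl j, rfl⟩) (hh 0)

/-- The ideal does not depend on the system of generators. -/
lemma fittingSpan_eq {h : κ → M} (hg : Submodule.span R (Set.range g) = ⊤)
    (hh : Submodule.span R (Set.range h) = ⊤) :
    fittingSpan (R := R) i g = fittingSpan i h := by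
  rw [← fittingSpan_sum h fun j => hg ▸ Submodule.mem_top,
    ← fittingSpan_sum (g := h) g fun j => hh ▸ Submodule.mem_top,
    ← fittingSpan_comp_equiv (Equiv.sumComm ι κ)]
  congr 1
  ext j
  cases j <;> rfl

end
end

end Jets
end

/-! ### Fitting ideals: minors and base change. -/

noncomputable section
namespace Jets

section
variable {R : Type u} [CommRing R] {M : Type v} [AddCommGroup M] [Module R M]

lemma single_mem_span_range {ι : Type*} [Fintype ι] [DecidableEq ι] (x : ι → R) :
    x ∈ Submodule.span R (Set.range fun j => (Pi.single j 1 : ι → R)) := by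
  rw [← Finset.univ_sum_single x]
  refine Submodule.sum_mem _ fun j _ => ?_
  rw [show (Pi.single j (x j) : ι → R) = x j • Pi.single j 1 by
    rw [← Pi.single_smul, smul_eq_mul, mul_one]]
  exact Submodule.smul_mem _ _ (Submodule.subset_span ⟨j, rfl⟩)

lemma det_eq_det_submatrix {ι κ : Type*} [Fintype ι] [DecidableEq ι] [Fintype κ] [DecidableEq κ]
    (A : Matrix ι ι R) (p : ι → Prop) [DecidablePred p] (e : κ ≃ {i // p i})
    (h : ∀ i, ¬ p i → A i = Pi.single i 1) : A.det = (Matrix.of fun a b => A (e a) (e b)).det := by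
  have h1 := A.twoBlockTriangular_det p fun i hi j hj => by
    rw [h i hi]
    exact Pi.single_eq_of_ne (fun hji : j = i => hi (hji ▸ hj)) _
  have h2 : (A.toSquareBlockProp fun i => ¬ p i) = 1 := by
    ext ⟨i, hi⟩ ⟨j, hj⟩
    change A i j = _
    simp only [h i hi, Matrix.one_apply, Pi.single_apply, Subtype.mk.injEq, eq_comm]
  rw [h2, Matrix.det_one, mul_one] at h1
  exact h1.trans (Matrix.det_submatrix_equiv_self e (A.toSquareBlockProp p)).symm

/-- Fill up the relation rows with unit rows in the columns outside the minor. If a column of the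
minor is repeated, the minor is zero. -/
lemma minor_mem_fittingSpan {n q : ℕ} {g : Fin q → M} (ρ : Fin (q - n) → Fin q → R)
    (c : Fin (q - n) → Fin q) (hρ : ∀ a, ∑ j, ρ a j • g j = 0) :
    (Matrix.of fun a b => ρ a (c b)).det ∈ fittingSpan (n : ℤ) g := by
  classical
  by_cases hc : Function.Injective c
  · let e := Equiv.ofInjective c hc
    let w : Matrix (Fin q) (Fin q) R := fun j =>
      if h : j ∈ Set.range c then ρ (e.symm ⟨j, h⟩) else Pi.single j 1
    have h1 : w.det = (Matrix.of fun a b => ρ a (c b)).det := by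
      rw [det_eq_det_submatrix w (· ∈ Set.range c) e fun i hi => dif_neg hi]
      congr 1
      ext a b
      have h3 : (e a : Fin q) ∈ Set.range c := (e a).2
      simp only [Matrix.of_apply, w, dif_pos h3, Subtype.coe_eta, Equiv.symm_apply_apply]
      rfl
    rw [← h1]
    refine det_mem_fittingSpan (Finset.univ.map ⟨c, hc⟩) ?_ fun a ha => ?_
    · rw [Finset.card_map, Finset.card_univ, Fintype.card_fin, Fintype.card_fin]
      omega
    · obtain ⟨b, -, rfl⟩ := Finset.mem_map.1 ha
      have h3 : c b ∈ Set.range c := ⟨b, rfl⟩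
      simp only [w, Function.Embedding.coeFn_mk, dif_pos h3]
      exact hρ _
  · obtain ⟨a, b, hab, hne⟩ : ∃ a b, c a = c b ∧ a ≠ b := by
      simpa [Function.Injective] using hc
    rw [Matrix.det_zero_of_column_eq hne fun i => by simp [hab]]
    exact zero_mem _

/-- By multilinearity the free rows may be taken to be unit vectors. If two of them coincide the
determinant vanishes; otherwise a permutation of the columns makes them standard and leaves, up to
sign, a minor of the relation rows. -/
lemma fittingSpan_le_fittingIdeal {n q : ℕ} {g : Fin q → M}
    (hg : Submodule.span R (Set.range g) = ⊤) :
    fittingSpan (n : ℤ) g ≤ fittingIdeal R M n := by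
  classical
  refine fittingSpan_le.2 fun w s hs hw => ?_
  -- Surplus relation rows count as free rows. For `q < n` the truncated difference is `0`, and the
  -- empty minor is `1`.
  obtain ⟨s', hs', hcard⟩ : ∃ s' ⊆ s, s'.card = q - n :=
    Finset.exists_subset_card_eq (by rw [Fintype.card_fin] at hs; omega)
  refine det_mem_of_mem_span (fun i => if i ∈ s' then {w i} else
    Set.range fun j => (Pi.single j 1 : Fin q → R)) (fun w' hw' => ?_) w fun i => ?_
  swap
  · split_ifs
    · exact Submodule.subset_span rfl
    · exact single_mem_span_range _
  have h1 : ∀ i ∈ s', w' i = w i := fun i hi => by simpa [hi] using hw' i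
  have h2 : ∀ i : {i // i ∉ s'}, ∃ j, Pi.single j 1 = w' i := fun i => by
    simpa [i.2] using hw' i
  choose c hc using h2
  by_cases hci : Function.Injective c
  · let E : {i // i ∉ s'} ≃ {i // i ∈ Set.range c} := Equiv.ofInjective c hci
    let σ : Equiv.Perm (Fin q) := E.extendSubtype
    have hσ : ∀ i : {i // i ∉ s'}, σ i = c i := fun i => E.extendSubtype_apply_of_mem i i.2
    let e := Finset.equivFinOfCardEq hcard
    have h3 : (w'.submatrix id σ).det =
        (Matrix.of fun a b => w (e.symm a) (σ (e.symm b))).det := by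
      rw [det_eq_det_submatrix (w'.submatrix id σ) (· ∈ s') e.symm fun i hi => ?_]
      · congr 1
        ext a b
        change w' (e.symm a) _ = _
        rw [h1 _ (e.symm a).2]
        rfl
      · ext j
        change w' i (σ j) = _
        rw [← hc ⟨i, hi⟩, ← hσ]
        simp [Pi.single_apply]
    rw [Matrix.det_permute'] at h3
    have h5 : w'.det = (Equiv.Perm.sign σ : ℤ) *
        (Matrix.of fun a b => w (e.symm a) (σ (e.symm b))).det := by
      rw [← h3, ← mul_assoc, ← Int.cast_mul, ← Units.val_mul, Int.units_mul_self]
      simp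
    rw [h5]
    exact Ideal.mul_mem_left _ _ (Ideal.subset_span ⟨q, g, fun a => w (e.symm a),
      fun b => σ (e.symm b), hg, fun a => hw _ (hs' (e.symm a).2), rfl⟩)
  · obtain ⟨a, b, hab, hne⟩ : ∃ a b, c a = c b ∧ a ≠ b := by
      simpa only [Function.Injective, not_forall, exists_prop] using hci
    rw [Matrix.det_zero_of_row_eq (i := (a : Fin q)) (j := (b : Fin q))
      (fun h => hne (Subtype.ext h)) (by rw [← hc, ← hc, hab])]
    exact zero_mem _

lemma fittingIdeal_eq_fittingSpan {ι : Type*} [Fintype ι] [DecidableEq ι] {g : ι → M}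
    (hg : Submodule.span R (Set.range g) = ⊤) (n : ℕ) :
    fittingIdeal R M n = fittingSpan (n : ℤ) g := by
  apply le_antisymm
  · rw [fittingIdeal, Ideal.span_le]
    rintro _ ⟨q, g', ρ, c, hg', hρ, rfl⟩
    rw [fittingSpan_eq hg hg']
    exact minor_mem_fittingSpan ρ c hρ
  · let e := (Fintype.equivFin ι).symm
    rw [← fittingSpan_comp_equiv e]
    exact fittingSpan_le_fittingIdeal (by rw [e.surjective.range_comp, hg])

section
variable {S : Type u} [CommRing S] [Algebra R S] {ι : Type*} [Fintype ι] [DecidableEq ι]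
  {i : ℤ} {g : ι → M}

/-- By right exactness of the tensor product, the relations after base change are generated by the
relations over `R`. -/
lemma mem_span_relations (hg : Submodule.span R (Set.range g) = ⊤) (w : ι → S)
    (hw : ∑ j, w j • ((1 : S) ⊗ₜ[R] g j) = 0) :
    w ∈ Submodule.span S {v | ∃ r : ι → R, ∑ j, r j • g j = 0 ∧ v = fun j => algebraMap R S (r j)} := by
  let π : (ι → R) →ₗ[R] M := Fintype.linearCombination R g
  have hπ : Function.Surjective π := by
    rw [← LinearMap.range_eq_top, Fintype.range_linearCombination, hg]
  have hex := lTensor_exact S (π.exact_subtype_ker_map) hπ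
  let P := TensorProduct.piScalarRight R S S ι
  have hx : π.lTensor S (P.symm w) = 0 := by
    rw [← hw, ← Finset.univ_sum_single w, map_sum, map_sum]
    refine Finset.sum_congr rfl fun j _ => ?_
    simp [P, π, TensorProduct.smul_tmul']
  obtain ⟨y, hy⟩ := (hex _).1 hx
  rw [← P.apply_symm_apply w, ← hy]
  clear hy hx
  induction y with
  | zero => simp
  | add y z hy hz =>
    rw [map_add, map_add]
    exact Submodule.add_mem _ hy hz
  | tmul s r =>
    have : P ((LinearMap.ker π).subtype.lTensor S (s ⊗ₜ r)) =
        s • fun j => algebraMap R S (r.1 j) := by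
      ext j
      simp [P, Algebra.smul_def, mul_comm]
    rw [this]
    refine Submodule.smul_mem _ _ (Submodule.subset_span ⟨r.1, ?_, rfl⟩)
    have := r.2
    rwa [LinearMap.mem_ker, Fintype.linearCombination_apply] at this

/-- The ideals are compatible with base change. -/
lemma fittingSpan_tensor (hg : Submodule.span R (Set.range g) = ⊤) :
    fittingSpan i (fun j => (1 : S) ⊗ₜ[R] g j) = (fittingSpan i g).map (algebraMap R S) := by
  apply le_antisymm
  · refine fittingSpan_le.2 fun w s hs hw => ?_
    refine det_mem_of_mem_span (fun a => if a ∈ s then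
      {v | ∃ r : ι → R, ∑ j, r j • g j = 0 ∧ v = fun j => algebraMap R S (r j)} else
      Set.range fun j => (Pi.single j 1 : ι → S)) (fun w' hw' => ?_) w fun a => ?_
    · have h1 : ∀ a, ∃ r : ι → R, (a ∈ s → ∑ j, r j • g j = 0) ∧
          w' a = fun j => algebraMap R S (r j) := fun a => by
        have h2 := hw' a
        by_cases ha : a ∈ s
        · rw [if_pos ha] at h2
          obtain ⟨r, hr, h3⟩ := h2
          exact ⟨r, fun _ => hr, h3⟩
        · rw [if_neg ha] at h2
          obtain ⟨j, hj⟩ := h2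
          refine ⟨Pi.single j 1, fun h => absurd h ha, ?_⟩
          rw [← hj]
          ext l
          by_cases hl : l = j <;> simp [hl]
      choose r hr hr' using h1
      have h2 : w' = (Matrix.of r).map (algebraMap R S) := by
        ext a j
        exact congrFun (hr' a) j
      rw [h2, ← RingHom.mapMatrix_apply, ← RingHom.map_det]
      exact Ideal.mem_map_of_mem _ (det_mem_fittingSpan s hs hr)
    · split_ifs with ha
      · exact mem_span_relations hg _ (hw a ha)
      · exact single_mem_span_range _
  · rw [Ideal.map_le_iff_le_comap]
    refine fittingSpan_le.2 fun w s hs hw => ?_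
    rw [Ideal.mem_comap, RingHom.map_det]
    refine det_mem_fittingSpan s hs fun a ha => ?_
    have := congrArg (TensorProduct.mk R S M 1) (hw a ha)
    rw [map_sum, map_zero] at this
    rw [← this]
    refine Finset.sum_congr rfl fun j _ => ?_
    rw [map_smul, ← algebraMap_smul S (w a j)]
    rfl

lemma fittingSpan_isBaseChange {M' : Type*} [AddCommGroup M'] [Module R M'] [Module S M']
    [IsScalarTower R S M'] {f : M →ₗ[R] M'} (hf : IsBaseChange S f)
    (hg : Submodule.span R (Set.range g) = ⊤) :
    fittingSpan i (f ∘ g) = (fittingSpan i g).map (algebraMap R S) := by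
  rw [← fittingSpan_tensor hg, ← fittingSpan_comp_injective (f := hf.equiv.toLinearMap)
    hf.equiv.injective]
  congr 1
  ext j
  simp [hf.equiv_tmul]

end
end

end Jets
end

/-! ### Modules over `k[X]` killed by a power of `X`. -/

noncomputable section
namespace Jets

section
variable {k : Type u} [Field k] {M : Type v} [AddCommGroup M]

lemma exists_generators_polynomial [Module k[X] M] [Module.Finite k[X] M] {l : ℕ}
    (hM : ∀ x : M, (Polynomial.X ^ l : k[X]) • x = 0) :
    ∃ (r : ℕ) (a : Fin r → ℕ) (g : Fin r → M), Submodule.span k[X] (Set.range g) = ⊤ ∧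
      ∀ W : Fin r → k[X], ∑ i, W i • g i = 0 ↔ ∀ i, Polynomial.X ^ a i ∣ W i := by
  obtain ⟨r, a, ⟨E⟩⟩ := Module.torsion_by_prime_power_decomposition (M := M)
    (Polynomial.irreducible_X (R := k)) fun {x} => ⟨⟨Polynomial.X ^ l, l, rfl⟩, hM x⟩
  let Q : Fin r → Type u := fun i => k[X] ⧸ k[X] ∙ (Polynomial.X ^ a i : k[X])
  let E' : M ≃ₗ[k[X]] ∀ i, Q i := E.trans (DirectSum.linearEquivFunOnFintype k[X] (Fin r) Q)
  let mk : ∀ i, k[X] →ₗ[k[X]] Q i := fun i => Submodule.mkQ _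
  let g : Fin r → M := fun i => E'.symm (Pi.single i (mk i 1))
  have hg : ∀ W : Fin r → k[X], E' (∑ i, W i • g i) = fun i => mk i (W i) := fun W => by
    rw [map_sum, ← Finset.univ_sum_single (fun i => mk i (W i))]
    refine Finset.sum_congr rfl fun i _ => ?_
    rw [map_smul, LinearEquiv.apply_symm_apply, ← Pi.single_smul, ← map_smul, smul_eq_mul, mul_one]
  refine ⟨r, a, g, ?_, fun W => ?_⟩
  · rw [eq_top_iff]
    rintro x -
    have h : ∀ i, ∃ y, mk i y = E' x i := fun i => Submodule.mkQ_surjective _ _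
    choose W hW using h
    rw [show x = ∑ i, W i • g i from E'.injective (by rw [hg]; exact funext fun i => (hW i).symm)]
    exact Submodule.sum_mem _ fun i _ =>
      Submodule.smul_mem _ _ (Submodule.subset_span (Set.mem_range_self i))
  · rw [← map_eq_zero_iff E' E'.injective, hg, funext_iff]
    refine forall_congr' fun i => ?_
    refine (Submodule.Quotient.mk_eq_zero _).trans ?_
    rw [Submodule.mem_span_singleton]
    exact ⟨fun ⟨c, hc⟩ => ⟨c, by rw [← hc, smul_eq_mul, mul_comm]⟩,
      fun ⟨c, hc⟩ => ⟨c, by rw [hc, smul_eq_mul, mul_comm]⟩⟩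

/-- The generators split `M` into cyclic modules `k[X]/(X^{a_i})`, and reducing such a module modulo
`X^q` leaves `k[X]/(X^{min(a_i, q)})`. -/
lemma finrank_quotient_X_pow [Module k[X] M] [Module k M] [IsScalarTower k k[X] M] {r q : ℕ}
    {a : Fin r → ℕ} {g : Fin r → M} (hg : Submodule.span k[X] (Set.range g) = ⊤)
    (hrel : ∀ W : Fin r → k[X], ∑ i, W i • g i = 0 ↔ ∀ i, Polynomial.X ^ a i ∣ W i)
    (T : Submodule k[X] M) (hT : ∀ x, x ∈ T ↔ ∃ y, (Polynomial.X ^ q : k[X]) • y = x) :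
    Module.finrank k (M ⧸ T) = ∑ i, min (a i) q := by
  have hex : ∀ x, ∃ W : Fin r → k[X], ∑ i, W i • g i = x := fun x =>
    (Submodule.mem_span_range_iff_exists_fun k[X]).1 (hg ▸ Submodule.mem_top)
  let Φ : (Fin r → k[X]) →ₗ[k[X]] M ⧸ T := T.mkQ ∘ₗ Fintype.linearCombination k[X] g
  have hΦ : Function.Surjective Φ := T.mkQ_surjective.comp fun x => hex x
  have hker : LinearMap.ker Φ =
      Submodule.pi Set.univ fun i => Ideal.span {(Polynomial.X ^ min (a i) q : k[X])} := by
    ext W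
    simp only [Submodule.mem_pi, Set.mem_univ, true_imp_iff, Ideal.mem_span_singleton]
    refine (Submodule.Quotient.mk_eq_zero T).trans ((hT _).trans ?_)
    rw [Fintype.linearCombination_apply]
    have h1 : (∃ y, (Polynomial.X ^ q : k[X]) • y = ∑ i, W i • g i) ↔
        ∃ V : Fin r → k[X], ∀ i, Polynomial.X ^ a i ∣ W i - Polynomial.X ^ q * V i := by
      have h2 : ∀ V : Fin r → k[X], ∑ i, W i • g i - (Polynomial.X ^ q : k[X]) • ∑ i, V i • g i =
          ∑ i, (W i - Polynomial.X ^ q * V i) • g i := fun V => by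
        rw [Finset.smul_sum, ← Finset.sum_sub_distrib]
        exact Finset.sum_congr rfl fun i _ => by rw [sub_smul, mul_smul]
      constructor
      · rintro ⟨y, hy⟩
        obtain ⟨V, rfl⟩ := hex y
        exact ⟨V, (hrel fun i => W i - Polynomial.X ^ q * V i).1 (by rw [← h2, hy, sub_self])⟩
      · rintro ⟨V, hV⟩
        exact ⟨_, (sub_eq_zero.1 ((h2 V).trans
          ((hrel fun i => W i - Polynomial.X ^ q * V i).2 hV))).symm⟩
    rw [h1]
    constructor
    · rintro ⟨V, hV⟩ i
      rw [← sub_add_cancel (W i) (Polynomial.X ^ q * V i)]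
      exact dvd_add ((pow_dvd_pow _ (min_le_left _ _)).trans (hV i))
        ((pow_dvd_pow _ (min_le_right _ _)).mul_right _)
    · intro h
      have h3 : ∀ i, ∃ V, Polynomial.X ^ a i ∣ W i - Polynomial.X ^ q * V := fun i => by
        rcases le_total (a i) q with h4 | h4
        · exact ⟨0, by simpa [min_eq_left h4] using h i⟩
        · obtain ⟨V, hV⟩ := h i
          exact ⟨V, by rw [hV, min_eq_right h4, sub_self]; exact dvd_zero _⟩
      choose V hV using h3
      exact ⟨V, hV⟩
  let e := (Φ.quotKerEquivOfSurjective hΦ).symm.trans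
    ((Submodule.quotEquivOfEq _ _ hker).trans (Submodule.quotientPi _))
  rw [(e.restrictScalars k).finrank_eq]
  have : ∀ i, Module.Finite k (k[X] ⧸ Ideal.span {(Polynomial.X ^ min (a i) q : k[X])}) :=
    fun i => (Polynomial.monic_X_pow _).finite_quotient
  rw [Module.finrank_pi_fintype]
  refine Finset.sum_congr rfl fun i _ => ?_
  rw [finrank_quotient_span_eq_natDegree, Polynomial.natDegree_X_pow]

end

end Jets
end

/-! ### Fitting ideals and dimensions over `k[t]/(t^{m+1})`. -/

noncomputable section
namespace Jets

section
variable {k : Type u} [Field k] {m : ℕ}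

lemma TruncPoly.t_pow_ne_zero {i : ℕ} (hi : i ≤ m) : TruncPoly.t k m ^ i ≠ 0 := by
  intro h
  have h1 := congrArg (TruncPoly.coeff ⟨i, by omega⟩) h
  rw [← mul_one (TruncPoly.t k m ^ i), TruncPoly.coeff_t_pow_mul, if_pos le_rfl,
    TruncPoly.coeff_congr (j := 0) (by simp), ← TruncPoly.aug_eq_coeff (k := k), map_one,
    map_zero] at h1
  exact one_ne_zero h1

lemma TruncPoly.le_of_t_pow_dvd {i j : ℕ} (hj : j ≤ m)
    (h : TruncPoly.t k m ^ i ∣ TruncPoly.t k m ^ j) : i ≤ j := by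
  by_contra! hij
  obtain ⟨c, hc⟩ := h
  apply TruncPoly.t_pow_ne_zero (k := k) (le_refl m)
  rw [show TruncPoly.t k m ^ m = TruncPoly.t k m ^ (m - j) * TruncPoly.t k m ^ j by
    rw [← pow_add, Nat.sub_add_cancel hj], hc, ← mul_assoc, ← pow_add,
    TruncPoly.t_pow_eq_zero (by omega), zero_mul]

variable {M : Type v} [AddCommGroup M] [Module (TruncPoly k m) M]

lemma t_pow_mem_fittingSpan {r : ℕ} {a : Fin r → ℕ} {g : Fin r → M}
    (hrel : ∀ W : Fin r → TruncPoly k m, ∑ i, W i • g i = 0 ↔ ∀ i, TruncPoly.t k m ^ a i ∣ W i)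
    (T : Finset (Fin r)) {i : ℤ} (hT : (r : ℤ) ≤ T.card + i) :
    TruncPoly.t k m ^ (∑ j ∈ T, a j) ∈ fittingSpan i g := by
  have h1 : (Matrix.diagonal fun j => if j ∈ T then TruncPoly.t k m ^ a j else 1).det =
      TruncPoly.t k m ^ (∑ j ∈ T, a j) := by
    rw [Matrix.det_diagonal, Finset.prod_ite_mem, Finset.univ_inter, Finset.prod_pow_eq_pow_sum]
  rw [← h1]
  refine det_mem_fittingSpan T (by rwa [Fintype.card_fin]) fun j hj => (hrel _).2 fun l => ?_
  rw [Matrix.diagonal_apply]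
  split_ifs with h2
  · rw [← h2]
  · exact dvd_zero _

/-- In the Leibniz expansion, an entry in column `j` of a relation row is divisible by `t^{a_j}`.
Each term therefore contains `t` to the sum of the `a_j` over the columns met by the relation rows.
-/
lemma fittingSpan_le_t_pow {r : ℕ} {a : Fin r → ℕ} {g : Fin r → M}
    (hrel : ∀ W : Fin r → TruncPoly k m, ∑ i, W i • g i = 0 ↔ ∀ i, TruncPoly.t k m ^ a i ∣ W i)
    {i : ℤ} {l : ℕ} (h : ∀ T : Finset (Fin r), (r : ℤ) ≤ T.card + i → l ≤ ∑ j ∈ T, a j) :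
    fittingSpan i g ≤ Ideal.span {TruncPoly.t k m ^ l} := by
  refine fittingSpan_le.2 fun w s hs hw => ?_
  rw [Fintype.card_fin] at hs
  rw [Matrix.det_apply']
  refine Ideal.sum_mem _ fun σ _ => Ideal.mul_mem_left _ _ (Ideal.mem_span_singleton.2 ?_)
  let T := s.map σ.symm.toEmbedding
  refine (pow_dvd_pow _ (h T (by rwa [Finset.card_map]))).trans ?_
  rw [← Finset.prod_pow_eq_pow_sum]
  refine (Finset.prod_dvd_prod_of_dvd _ _ fun j hj => ?_).trans
    (Finset.prod_dvd_prod_of_subset T Finset.univ _ (Finset.subset_univ _))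
  rw [Finset.mem_map_equiv] at hj
  exact (hrel _).1 (hw _ hj) j

/-- By `h0`, any `r - n + 1` exponents add up to at least `m + 1`. By `h1`, some set `T` of at least
`r - n` exponents has sum exactly `e`; as `e ≤ m`, it has exactly `r - n` elements. The exponents in
`T` are at most `e ≤ q`. Adding one more index to `T` pushes the sum to `m + 1`, so each of the
other `n` exponents is at least `m + 1 - e ≥ q`. -/
lemma sum_min_eq {r n e q : ℕ} {a : Fin r → ℕ} {g : Fin r → M}
    (hrel : ∀ W : Fin r → TruncPoly k m, ∑ i, W i • g i = 0 ↔ ∀ i, TruncPoly.t k m ^ a i ∣ W i)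
    (h1 : fittingSpan (n : ℤ) g = Ideal.span {TruncPoly.t k m ^ e})
    (h0 : fittingSpan (n - 1 : ℤ) g = (⊥ : Ideal (TruncPoly k m)))
    (heq : e ≤ q) (hqm : q + e ≤ m + 1) : ∑ i, min (a i) q = q * n + e := by
  have h2 : ∀ T : Finset (Fin r), (r : ℤ) ≤ T.card + (n - 1 : ℤ) → m + 1 ≤ ∑ j ∈ T, a j := by
    intro T hT
    by_contra! h3
    have h4 := t_pow_mem_fittingSpan hrel T hT
    rw [h0] at h4
    exact TruncPoly.t_pow_ne_zero (by omega) ((Submodule.mem_bot _).1 h4)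
  have hnr : n ≤ r := by
    by_contra! h3
    have := h2 ∅ (by rw [Finset.card_empty]; omega)
    rw [Finset.sum_empty] at this
    omega
  obtain ⟨T, hT, hTe⟩ : ∃ T : Finset (Fin r), (r : ℤ) ≤ T.card + (n : ℤ) ∧ ∑ j ∈ T, a j ≤ e := by
    by_contra! h3
    have h4 := fittingSpan_le_t_pow hrel (l := e + 1) h3
    rw [h1, Ideal.span_singleton_le_span_singleton] at h4
    have := TruncPoly.le_of_t_pow_dvd (by omega) h4
    omega
  have hTe' : e ≤ ∑ j ∈ T, a j := by
    have h4 := t_pow_mem_fittingSpan hrel T hT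
    rw [h1, Ideal.mem_span_singleton] at h4
    exact TruncPoly.le_of_t_pow_dvd (by omega) h4
  have hcard : T.card + n = r := by
    refine le_antisymm ?_ (by omega)
    by_contra! h3
    have := h2 T (by omega)
    omega
  have h5 : ∀ i ∈ T, min (a i) q = a i := fun i hi => by
    have := Finset.single_le_sum (f := a) (fun _ _ => Nat.zero_le _) hi
    omega
  have h6 : ∀ i ∈ Tᶜ, min (a i) q = q := fun i hi => by
    rw [Finset.mem_compl] at hi
    have := h2 (insert i T) (by rw [Finset.card_insert_of_notMem hi]; omega)
    rw [Finset.sum_insert hi] at this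
    omega
  rw [← Finset.sum_add_sum_compl T, Finset.sum_congr rfl h5, Finset.sum_congr rfl h6,
    Finset.sum_const, Finset.card_compl, Fintype.card_fin, smul_eq_mul,
    show r - T.card = n by omega, mul_comm]
  change ∑ j ∈ T, a j + q * n = _
  omega

/-- The dimension of a reduction of a module with given Fitting ideals. -/
theorem finrank_quotient_t_pow [Module k M] [IsScalarTower k (TruncPoly k m) M]
    [Module.Finite (TruncPoly k m) M] {ι : Type*} [Fintype ι] [DecidableEq ι] {g : ι → M}
    (hg : Submodule.span (TruncPoly k m) (Set.range g) = ⊤) {n e q : ℕ}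
    (h1 : fittingSpan (n : ℤ) g = Ideal.span {TruncPoly.t k m ^ e})
    (h0 : fittingSpan (n - 1 : ℤ) g = (⊥ : Ideal (TruncPoly k m)))
    (heq : e ≤ q) (hqm : q + e ≤ m + 1) (T : Submodule (TruncPoly k m) M)
    (hT : T = LinearMap.range (LinearMap.lsmul (TruncPoly k m) M (TruncPoly.t k m ^ q))) :
    Module.finrank k (M ⧸ T) = q * n + e := by
  -- The module is regarded over the principal ideal domain `k[X]`, where the structure theorem
  -- applies; the generators found there are carried back to the truncated ring.
  let mk : k[X] →+* TruncPoly k m := Ideal.Quotient.mk _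
  have hmk : Function.Surjective mk := Ideal.Quotient.mk_surjective
  let : Module k[X] M := Module.compHom M mk
  have hsm : ∀ (p : k[X]) (x : M), p • x = mk p • x := fun _ _ => rfl
  have t1 : IsScalarTower k k[X] M := ⟨fun c p x => by
    rw [hsm, hsm, ← smul_assoc]
    rfl⟩
  have hX : ∀ i, mk (Polynomial.X ^ i) = TruncPoly.t k m ^ i := fun i => map_pow _ _ _
  have hspan : ∀ s : Set M, Submodule.span (TruncPoly k m) s = ⊤ → Submodule.span k[X] s = ⊤ := by
    intro s hs
    rw [eq_top_iff]
    rintro x -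
    have hx : x ∈ Submodule.span (TruncPoly k m) s := hs ▸ Submodule.mem_top
    induction hx using Submodule.span_induction with
    | mem x hx => exact Submodule.subset_span hx
    | zero => exact zero_mem _
    | add x y _ _ hx hy => exact add_mem hx hy
    | smul c x _ hx =>
      obtain ⟨c, rfl⟩ := hmk c
      exact Submodule.smul_mem _ c hx
  have t2 : Module.Finite k[X] M := by
    obtain ⟨s, hs⟩ := (inferInstance : Module.Finite (TruncPoly k m) M)
    exact ⟨⟨s, hspan _ hs⟩⟩
  obtain ⟨r, a, g', hg', hrel⟩ := exists_generators_polynomial (k := k) (M := M) (l := m + 1)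
    fun x => by
      rw [hsm, hX, TruncPoly.t_pow_eq_zero (Nat.lt_succ_self m)]
      exact zero_smul (TruncPoly k m) x
  have hg'' : Submodule.span (TruncPoly k m) (Set.range g') = ⊤ := by
    rw [eq_top_iff]
    rintro x -
    have hx : x ∈ Submodule.span k[X] (Set.range g') := hg' ▸ Submodule.mem_top
    obtain ⟨c, rfl⟩ := (Submodule.mem_span_range_iff_exists_fun k[X]).1 hx
    exact Submodule.sum_mem _ fun i _ =>
      Submodule.smul_mem _ (mk (c i)) (Submodule.subset_span (Set.mem_range_self i))
  have hrel' : ∀ W : Fin r → TruncPoly k m,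
      ∑ i, W i • g' i = 0 ↔ ∀ i, TruncPoly.t k m ^ a i ∣ W i := fun W => by
    choose V hV using fun i => hmk (W i)
    obtain rfl : (fun i => mk (V i)) = W := funext hV
    have hzero : ∀ i, mk (Polynomial.X ^ a i) = 0 ∨ a i ≤ m := fun i => by
      rcases le_or_gt (a i) m with h | h
      · exact Or.inr h
      · exact Or.inl (by rw [hX, TruncPoly.t_pow_eq_zero h])
    constructor
    · intro h i
      rw [← hX]
      exact map_dvd mk ((hrel V).1 h i)
    · intro h
      refine Finset.sum_eq_zero fun i _ => ?_
      obtain ⟨c, hc⟩ := h i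
      obtain ⟨c, rfl⟩ := hmk c
      have h3 : (Polynomial.X ^ a i : k[X]) • g' i = 0 := by
        have := (hrel (Pi.single i (Polynomial.X ^ a i))).2 fun j => by
          by_cases hj : j = i
          · subst hj; simp
          · simp [hj]
        rwa [Finset.sum_eq_single i (fun j _ hj => by simp [hj]) (by simp), Pi.single_eq_same]
          at this
      rw [hc, mul_comm, mul_smul, ← hX, ← hsm (Polynomial.X ^ a i), h3, smul_zero]
  rw [fittingSpan_eq hg hg''] at h1 h0
  rw [← sum_min_eq hrel' h1 h0 heq hqm]
  let T' : Submodule k[X] M :=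
    { T with smul_mem' := fun c x hx => T.smul_mem (mk c) hx }
  have hT' : ∀ x, x ∈ T' ↔ ∃ y, (Polynomial.X ^ q : k[X]) • y = x := fun x => by
    change x ∈ T ↔ _
    rw [hT]
    exact exists_congr fun y => by rw [LinearMap.lsmul_apply, hsm, hX]
  have h3 := finrank_quotient_X_pow hg' hrel T' hT'
  rw [← h3]
  exact LinearEquiv.finrank_eq
    { QuotientAddGroup.congr T.toAddSubgroup T'.toAddSubgroup (AddEquiv.refl M)
        (AddSubgroup.map_id _) with
      map_smul' := fun c x => by
        obtain ⟨x, rfl⟩ := T.mkQ_surjective x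
        rfl }

end

end Jets
end

/-! ### Inverse images of the Jacobian ideal under jets. -/

noncomputable section
namespace Jets

section
variable {Y Z : Scheme.{u}}

lemma ideal_comap_image (I : Y.IdealSheafData) (i : Z ⟶ Y) [IsOpenImmersion i] (U : Z.affineOpens)
    (W : Y.affineOpens) (hW : W.1 = i ''ᵁ U.1) (e : U.1 ≤ i ⁻¹ᵁ W.1) :
    (I.comap i).ideal U = (I.ideal W).map (i.appLE W.1 U.1 e).hom := by
  obtain ⟨W, hW'⟩ := W
  dsimp only at hW e
  subst hW
  rw [Scheme.IdealSheafData.ideal_comap_of_isOpenImmersion, ← Scheme.Hom.appIso_hom']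
  exact (Ideal.map_comap_of_equiv (i.appIso U.1).commRingCatIsoToRingEquiv).symm

/-- Both inclusions come from the adjunction between inverse and direct image of ideal sheaves: one
by testing against the sheaf of the extended ideal, the other from its unit. -/
lemma ideal_comap_of_isAffine [IsAffine Y] [IsAffine Z] (I : Y.IdealSheafData) (g : Z ⟶ Y) :
    (I.comap g).ideal ⟨⊤, isAffineOpen_top Z⟩ =
      (I.ideal ⟨⊤, isAffineOpen_top Y⟩).map g.appTop.hom := by
  apply le_antisymm
  · let K := Scheme.IdealSheafData.ofIdealTop ((I.ideal ⟨⊤, isAffineOpen_top Y⟩).map g.appTop.hom)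
    have hK : K.ideal ⟨⊤, isAffineOpen_top Z⟩ =
        (I.ideal ⟨⊤, isAffineOpen_top Y⟩).map g.appTop.hom := by
      simp [K]
    rw [← hK]
    have h1 : I.comap g ≤ K := by
      rw [← Scheme.IdealSheafData.le_map_iff_comap_le]
      refine Scheme.IdealSheafData.le_of_isAffine ?_
      rw [Scheme.IdealSheafData.ideal_map_of_isAffineHom, ← Ideal.map_le_iff_le_comap]
      exact hK.ge
    exact h1 _
  · rw [Ideal.map_le_iff_le_comap]
    have h1 := I.le_map_comap g ⟨⊤, isAffineOpen_top Y⟩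
    rwa [Scheme.IdealSheafData.ideal_map_of_isAffineHom] at h1

/-- The inverse image of an ideal sheaf under a morphism into an affine open set. -/
lemma ideal_comap_fromSpec (I : Y.IdealSheafData) {V : Y.Opens} (hV : IsAffineOpen V)
    {A : CommRingCat.{u}} (f : Spec A ⟶ Y) (φ : Γ(Y, V) ⟶ A) (h : f = Spec.map φ ≫ hV.fromSpec) :
    ((I.comap f).ideal ⟨⊤, isAffineOpen_top (Spec A)⟩).map (Scheme.ΓSpecIso A).hom.hom =
      (I.ideal ⟨V, hV⟩).map φ.hom := by
  have h0 : (⊤ : (Spec Γ(Y, V)).Opens) ≤ hV.fromSpec ⁻¹ᵁ V := fun x _ => by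
    have : hV.fromSpec x ∈ Set.range hV.fromSpec := ⟨x, rfl⟩
    rwa [hV.range_fromSpec] at this
  have h1 : V = hV.fromSpec ''ᵁ ⊤ := by
    rw [Scheme.Hom.image_top_eq_opensRange, hV.opensRange_fromSpec]
  have hf : ⊤ ≤ f ⁻¹ᵁ V := fun x _ => by
    rw [h]
    exact h0 trivial
  have h2 : f.appLE V ⊤ hf = hV.fromSpec.appLE V ⊤ h0 ≫ (Spec.map φ).appTop := by
    subst h
    have h4 : (Spec.map φ).appTop = (Spec.map φ).appLE ⊤ ⊤ le_rfl := Scheme.Hom.app_eq_appLE _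
    rw [h4]
    exact (Scheme.Hom.appLE_comp_appLE (Spec.map φ) hV.fromSpec V ⊤ ⊤ h0 le_rfl).symm
  have h3 := appLE_eq_of_eq_fromSpec hV f hf φ h
  rw [← h3, CommRingCat.hom_comp, ← Ideal.map_map, h2, CommRingCat.hom_comp, ← Ideal.map_map,
    ← ideal_comap_image I hV.fromSpec ⟨⊤, isAffineOpen_top _⟩ ⟨V, hV⟩ h1 h0,
    ← ideal_comap_of_isAffine, ← Scheme.IdealSheafData.comap_comp, ← h]

end

section
variable {k : Type u} [Field k] {X : SchOver k}

lemma sections_map_comp {U V : X.left.Opens} (i : V ⟶ U) :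
    (X.left.presheaf.map i.op).hom.comp (algebraMap k Γ(X.left, U)) =
      algebraMap k Γ(X.left, V) := by
  have h := Scheme.Hom.appLE_map X.hom (U := ⊤) (V := U) le_top i.op
  exact congrArg (fun f => f.hom.comp (Scheme.ΓSpecIso (CommRingCat.of k)).inv.hom) h

variable [LocallyOfFiniteType X.hom]

/-- A localization is formally étale, so the differentials of the localization are a base change,
and Fitting ideals commute with base change. -/
lemma fittingIdeal_basicOpen (n : ℕ) (U : X.left.affineOpens) (f : Γ(X.left, U)) :
    (fittingIdeal Γ(X.left, U) Ω[Γ(X.left, U)⁄k] n).map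
      (X.left.presheaf.map (homOfLE <| X.left.basicOpen_le f).op).hom =
      fittingIdeal Γ(X.left, X.left.affineBasicOpen f)
        Ω[Γ(X.left, X.left.affineBasicOpen f)⁄k] n := by
  let R := Γ(X.left, U)
  let S := Γ(X.left, X.left.affineBasicOpen f)
  let : Algebra R S := (X.left.presheaf.map (homOfLE <| X.left.basicOpen_le f).op).hom.toAlgebra
  have : IsScalarTower k R S := IsScalarTower.of_algebraMap_eq' (sections_map_comp _).symm
  have : IsLocalization.Away f S := U.2.isLocalization_basicOpen f
  have : Algebra.FormallyEtale R S := Algebra.FormallyEtale.of_isLocalization (Submonoid.powers f)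
  have : Algebra.FiniteType k R := finiteType_sections U.2
  obtain ⟨q, g, hg⟩ := Module.Finite.exists_fin (R := R) (M := Ω[R⁄k])
  have h1 := KaehlerDifferential.isBaseChange_of_formallyEtale k R S
  have h2 : Submodule.span S (Set.range (KaehlerDifferential.map k k R S ∘ g)) = ⊤ := by
    rw [Set.range_comp]
    exact span_eq_top_of_isLocalizedModule S (Submonoid.powers f) (KaehlerDifferential.map k k R S) hg
  refine (congrArg (Ideal.map (algebraMap R S)) (fittingIdeal_eq_fittingSpan hg n)).trans ?_
  rw [← fittingSpan_isBaseChange h1 hg]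
  exact (fittingIdeal_eq_fittingSpan h2 n).symm

/-- `ofIdeals` yields the largest ideal sheaf contained in a family of ideals. This family is
compatible with localization, so nothing is lost. -/
lemma jacobianIdeal_ideal (n : ℕ) (U : X.left.affineOpens) :
    (jacobianIdeal X n).ideal U = fittingIdeal Γ(X.left, U) Ω[Γ(X.left, U)⁄k] n := by
  apply le_antisymm
  · exact Scheme.IdealSheafData.ideal_ofIdeals_le _ U
  · let J : X.left.IdealSheafData :=
      { ideal := fun U => fittingIdeal Γ(X.left, U) Ω[Γ(X.left, U)⁄k] n
        map_ideal_basicOpen := fittingIdeal_basicOpen n }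
    have h : J ≤ jacobianIdeal X n := Scheme.IdealSheafData.le_ofIdeals_iff.2 le_rfl
    exact h U

lemma jetInverseImage_jacobianIdeal {U : X.left.Opens} (hU : IsAffineOpen U) (n : ℕ) {m : ℕ}
    {γ : KPoint (jetScheme X m)} {φ : Γ(X.left, U) →ₐ[k] TruncPoly k m}
    (hγ : (unitSpec k).inv ≫ γ = affJet hU φ) :
    jetInverseImage (jacobianIdeal X n) γ =
      (fittingIdeal Γ(X.left, U) Ω[Γ(X.left, U)⁄k] n).map φ.toRingHom := by
  have h2 : (jetMap γ).left = Spec.map (CommRingCat.ofHom φ.toRingHom) ≫ hU.fromSpec := by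
    rw [jetMap_eq_of_affJet hU hγ]; rfl
  exact (ideal_comap_fromSpec (jacobianIdeal X n) hU (jetMap γ).left
    (CommRingCat.ofHom φ.toRingHom) h2).trans
      (congrArg (Ideal.map φ.toRingHom) (jacobianIdeal_ideal n ⟨U, hU⟩))

end

end Jets
end

/-! ### Order of contact and the fibers over the contact locus. -/

noncomputable section
namespace Jets

section
variable {k : Type u} [Field k] {m p : ℕ}

/-- An order of contact `e ≤ p` is visible modulo `t^{p+1}`: an element congruent to `t^e` equals
`t^e (1 + t^{p+1-e} z)`, and the second factor is a unit. -/
lemma map_trunc_eq_span_iff (h : p ≤ m) {e : ℕ} (he : e ≤ p) (J : Ideal (TruncPoly k m)) :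
    J.map (TruncPoly.trunc k h) = Ideal.span {TruncPoly.t k p ^ e} ↔
      J = Ideal.span {TruncPoly.t k m ^ e} := by
  have ht : TruncPoly.trunc k h (TruncPoly.t k m ^ e) = TruncPoly.t k p ^ e := by
    rw [map_pow, TruncPoly.trunc_t]
  constructor
  · intro hJ
    apply le_antisymm
    · intro y hy
      have h1 : TruncPoly.trunc k h y ∈ Ideal.span {TruncPoly.t k p ^ e} :=
        hJ ▸ Ideal.mem_map_of_mem _ hy
      obtain ⟨c, hc⟩ := Ideal.mem_span_singleton.1 h1
      obtain ⟨c, rfl⟩ := TruncPoly.trunc_surjective k h c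
      obtain ⟨z, hz⟩ := TruncPoly.exists_eq_t_pow_mul_of_trunc_eq_zero h
        (y - TruncPoly.t k m ^ e * c) (by rw [map_sub, map_mul, ht, hc, sub_self])
      rw [Ideal.mem_span_singleton, ← sub_add_cancel y (TruncPoly.t k m ^ e * c), hz]
      exact dvd_add ((pow_dvd_pow _ (by omega)).mul_right _) (dvd_mul_right _ _)
    · rw [Ideal.span_singleton_le_iff_mem]
      have h1 : TruncPoly.t k p ^ e ∈ J.map (TruncPoly.trunc k h) :=
        hJ ▸ Ideal.mem_span_singleton_self _
      obtain ⟨y, hy, hyt⟩ := (Ideal.mem_map_iff_of_surjective _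
        (TruncPoly.trunc_surjective k h)).1 h1
      obtain ⟨z, hz⟩ := TruncPoly.exists_eq_t_pow_mul_of_trunc_eq_zero h
        (y - TruncPoly.t k m ^ e) (by rw [map_sub, ht, hyt, sub_self])
      have h2 : y = TruncPoly.t k m ^ e * (1 + TruncPoly.t k m ^ (p + 1 - e) * z) := by
        rw [mul_add, mul_one, ← mul_assoc, ← pow_add, Nat.add_sub_cancel' (by omega), ← hz]
        ring
      have h3 : IsUnit (1 + TruncPoly.t k m ^ (p + 1 - e) * z) := by
        refine IsNilpotent.isUnit_one_add ⟨m + 1, ?_⟩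
        rw [mul_pow, ← pow_mul, TruncPoly.t_pow_eq_zero, zero_mul]
        have : 1 * (m + 1) ≤ (p + 1 - e) * (m + 1) := Nat.mul_le_mul_right _ (by omega)
        omega
      rwa [h2, Ideal.mul_unit_mem_iff_mem _ h3] at hy
  · rintro rfl
    rw [Ideal.map_span, Set.image_singleton, ht]

end

section
variable {k : Type u} [Field k] {R B : Type u} [CommRing R] [Algebra k R] [CommRing B]
  [Algebra k B] {m p : ℕ}

lemma fittingSpan_pull {ι : Type*} [Fintype ι] [DecidableEq ι] (ψ : R →ₐ[k] TruncPoly B m) {g : ι → Ω[R⁄k]}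
    (hg : Submodule.span R (Set.range g) = ⊤) (i : ℤ) :
    fittingSpan i (fun j => JetDiff.pull ψ (g j)) = (fittingSpan i g).map ψ.toRingHom := by
  let := ψ.toRingHom.toAlgebra
  exact fittingSpan_tensor (S := TruncPoly B m) hg

lemma span_range_pull_comp {ι : Type*} (ψ : R →ₐ[k] TruncPoly B m) {g : ι → Ω[R⁄k]}
    (hg : Submodule.span R (Set.range g) = ⊤) :
    Submodule.span (TruncPoly B m) (Set.range fun j => JetDiff.pull ψ (g j)) = ⊤ := by
  rw [← JetDiff.span_pull_of_span ψ hg, ← Set.range_comp]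
  rfl

/-- Here `q = m - p`. The numerical conditions of `finrank_quotient_t_pow` hold because `e ≤ m - p ≤
p`, which gives `e ≤ q` and `q + e ≤ m`. -/
lemma finrank_jetDiffQuot [Algebra.FiniteType k R] {n e : ℕ}
    (hR : ∀ (q : ℕ) (g : Fin q → Ω[R⁄k]), Submodule.span R (Set.range g) = ⊤ →
      fittingSpan (n - 1 : ℤ) g = (⊥ : Ideal R))
    (h : p ≤ m) (hm : m ≤ 2 * p) (he : p + e ≤ m) (ψ : R →ₐ[k] TruncPoly k m)
    (hψ : (fittingIdeal R Ω[R⁄k] n).map ((TruncPoly.truncₐ k k h).comp ψ).toRingHom =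
      Ideal.span {TruncPoly.t k p ^ e}) :
    Module.finrank k (JetDiffQuot ψ (m - p)) = (m - p) * n + e := by
  obtain ⟨q, g, hg⟩ := Module.Finite.exists_fin (R := R) (M := Ω[R⁄k])
  have h1 : (fittingIdeal R Ω[R⁄k] n).map ψ.toRingHom = Ideal.span {TruncPoly.t k m ^ e} := by
    rw [← map_trunc_eq_span_iff h (by omega), ← hψ]
    exact Ideal.map_map ψ.toRingHom (TruncPoly.trunc k h).toRingHom
  rw [fittingIdeal_eq_fittingSpan hg] at h1
  refine finrank_quotient_t_pow (span_range_pull_comp ψ hg)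
    ((fittingSpan_pull ψ hg _).trans h1) ?_ (by omega) (by omega) _ rfl
  rw [fittingSpan_pull ψ hg, hR q g hg, Ideal.map_bot]

end

section
variable {k : Type u} [Field k] {X : SchOver k} {U : X.left.Opens} {m p : ℕ}

lemma exists_affJet (γ : KPoint (jetScheme X m)) :
    ∃ (U : X.left.Opens) (hU : IsAffineOpen U) (φ : Γ(X.left, U) →ₐ[k] TruncPoly k m),
      (unitSpec k).inv ≫ γ = affJet hU φ := by
  let γ' := (unitSpec k).inv ≫ γ
  let x₀ : (specOver k k).left := (⊥ : PrimeSpectrum k)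
  obtain ⟨_, ⟨U, hU, rfl⟩, hxU, -⟩ := X.left.isBasis_affineOpens.exists_subset_of_mem_open
    (Set.mem_univ ((γ' ≫ jetCenter X m).left x₀)) isOpen_univ
  refine ⟨U, hU, (exists_affJet_iff hU γ').2 fun y _ => ?_⟩
  have : y = x₀ := Subsingleton.elim (α := PrimeSpectrum k) y x₀
  rw [this]
  exact hxU

variable [LocallyOfFiniteType X.hom]

lemma mem_contactLocus_iff {hU : IsAffineOpen U} {γ : KPoint (jetScheme X m)}
    {φ : Γ(X.left, U) →ₐ[k] TruncPoly k m} (hφ : (unitSpec k).inv ≫ γ = affJet hU φ) (n e : ℕ) :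
    γ ∈ contactLocus (jacobianIdeal X n) e m ↔ e ≤ m ∧
      (fittingIdeal Γ(X.left, U) Ω[Γ(X.left, U)⁄k] n).map φ.toRingHom =
        Ideal.span {TruncPoly.t k m ^ e} := by
  rw [← jetInverseImage_jacobianIdeal hU n hφ]
  rfl

/-- The contact locus of order `m` is thus the full preimage of that of order `p`, so no condition
has to be imposed on the lifts. -/
lemma mem_contactLocus_iff_proj (n : ℕ) {e : ℕ} (h : p ≤ m) (he : e ≤ p)
    (δ : KPoint (jetScheme X m)) :
    δ ≫ jetProj X h ∈ contactLocus (jacobianIdeal X n) e p ↔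
      δ ∈ contactLocus (jacobianIdeal X n) e m := by
  obtain ⟨U, hU, ψ, hψ⟩ := exists_affJet δ
  have hφ : (unitSpec k).inv ≫ δ ≫ jetProj X h =
      affJet hU ((TruncPoly.truncₐ k k h).comp ψ) := by
    rw [← Category.assoc, hψ, affJet_proj]
  rw [mem_contactLocus_iff hψ, mem_contactLocus_iff hφ, ← map_trunc_eq_span_iff h he,
    and_iff_right he, and_iff_right (he.trans h)]
  exact (congrArg (· = _) (Ideal.map_map ψ.toRingHom (TruncPoly.trunc k h).toRingHom).symm).to_iff

/-- The fibers over the contact locus of the Jacobian ideal are affine spaces. -/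
theorem nonempty_pullback_iso_affineSpace {n e : ℕ}
    (hX : ∀ U : X.left.Opens, IsAffineOpen U → ∀ (q : ℕ) (g : Fin q → Ω[Γ(X.left, U)⁄k]),
      Submodule.span Γ(X.left, U) (Set.range g) = ⊤ →
      fittingSpan (n - 1 : ℤ) g = (⊥ : Ideal Γ(X.left, U)))
    (h : p ≤ m) (hm : m ≤ 2 * p) (he : p + e ≤ m) (γ : KPoint (jetScheme X p))
    (hγ : γ ∈ contactLocus (jacobianIdeal X n) e p)
    (hδ : ∃ δ : KPoint (jetScheme X m), δ ≫ jetProj X h = γ) :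
    Nonempty (pullback (jetProj X h) γ ≅ affineSpace k ((m - p) * n + e)) := by
  obtain ⟨δ, hδ⟩ := hδ
  obtain ⟨U, hU, φ, hφ⟩ := exists_affJet γ
  obtain ⟨ψ, hψ, rfl⟩ := exists_lift_of_affJet hU h hφ hδ
  have := finiteType_sections hU
  have h1 := finrank_jetDiffQuot (hX U hU) h hm he ψ ((mem_contactLocus_iff hφ n e).1 hγ).2
  exact nonempty_pullback_iso hU h (by omega) ψ hφ (Module.finBasisOfFinrankEq k _ h1)

end

end Jets
end

/-! ### Dimension and differentials of domains of finite type. -/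

noncomputable section
namespace Jets

section

/-- Incomparability gives one inequality; lying over and going up give the other. -/
lemma ringKrullDim_eq_of_isIntegral {A B : Type*} [CommRing A] [CommRing B] [Algebra A B]
    [Algebra.IsIntegral A B] (hinj : Function.Injective (algebraMap A B)) :
    ringKrullDim B = ringKrullDim A := by
  apply le_antisymm
  · refine Order.krullDim_le_of_strictMono (PrimeSpectrum.comap (algebraMap A B)) fun P Q hPQ => ?_
    exact Ideal.IsIntegral.comap_lt_comap (R := A) hPQ
  · refine iSup_le fun l => ?_
    obtain ⟨P, -, hP, hP'⟩ := Ideal.exists_ideal_over_prime_of_isIntegral (R := A)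
      (RelSeries.head l).asIdeal (⊥ : Ideal B) (by
        rw [← RingHom.ker_eq_comap_bot, (RingHom.injective_iff_ker_eq_bot _).1 hinj]
        exact bot_le)
    have : P.LiesOver (RelSeries.head l).asIdeal := ⟨hP'.symm⟩
    obtain ⟨L, hL, -⟩ := Ideal.exists_ltSeries_of_hasGoingUp (S := B) l P
    rw [← hL]
    exact Order.LTSeries.length_le_krullDim L

variable {k : Type u} [Field k]

/-- The dimension of a domain of finite type is its transcendence degree. -/
lemma exists_trdeg_eq (D : Type u) [CommRing D] [IsDomain D] [Algebra k D]
    [Algebra.FiniteType k D] :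
    ∃ s : ℕ, ringKrullDim D = s ∧ Algebra.trdeg k D = s := by
  obtain ⟨s, g, hg, hgi⟩ := exists_integral_inj_algHom_of_fg k D
  let := g.toRingHom.toAlgebra
  have h1 : Algebra.IsIntegral (MvPolynomial (Fin s) k) D := ⟨hgi⟩
  have h2 : IsScalarTower k (MvPolynomial (Fin s) k) D :=
    IsScalarTower.of_algebraMap_eq fun a => (g.commutes a).symm
  have h3 : FaithfulSMul (MvPolynomial (Fin s) k) D := (faithfulSMul_iff_algebraMap_injective _ _).2 hg
  refine ⟨s, ?_, ?_⟩
  · rw [ringKrullDim_eq_of_isIntegral (A := MvPolynomial (Fin s) k) hg,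
      MvPolynomial.ringKrullDim_of_isNoetherianRing, ringKrullDim_eq_zero_of_field, zero_add,
      Nat.card_fin]
  · rw [← trdeg_add_eq k (MvPolynomial (Fin s) k) (A := D),
      trdeg_eq_zero (R := MvPolynomial (Fin s) k) (A := D), add_zero,
      MvPolynomial.trdeg_of_isDomain]
    simp

lemma trdeg_isLocalization {D K : Type u} [CommRing D] [IsDomain D] [Algebra k D] [CommRing K]
    [IsDomain K] [Algebra D K] [Algebra k K] [IsScalarTower k D K] (S : Submonoid D)
    (hS : S ≤ nonZeroDivisors D) [IsLocalization S K] : Algebra.trdeg k K = Algebra.trdeg k D := by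
  have h1 := IsLocalization.isAlgebraic (R := D) (S := K) S
  have h2 : FaithfulSMul D K :=
    (faithfulSMul_iff_algebraMap_injective _ _).2 (IsLocalization.injective K hS)
  rw [← trdeg_add_eq k D (A := K), trdeg_eq_zero (R := D) (A := K), add_zero]

lemma ringKrullDim_away {D K : Type u} [CommRing D] [IsDomain D] [Algebra k D]
    [Algebra.FiniteType k D] [CommRing K] [IsDomain K] [Algebra D K] [Algebra k K]
    [IsScalarTower k D K] (f : D) (hf : f ≠ 0) [IsLocalization.Away f K] :
    ringKrullDim K = ringKrullDim D := by
  have : Algebra.FiniteType D K := IsLocalization.finiteType_of_monoid_fg (Submonoid.powers f) K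
  have : Algebra.FiniteType k K := Algebra.FiniteType.trans (S := D) inferInstance inferInstance
  obtain ⟨s, hs, hst⟩ := exists_trdeg_eq (k := k) D
  obtain ⟨r, hr, hrt⟩ := exists_trdeg_eq (k := k) K
  rw [trdeg_isLocalization (D := D) (Submonoid.powers f)
    (powers_le_nonZeroDivisors_of_noZeroDivisors hf), hst] at hrt
  rw [hs, hr, Nat.cast_injective hrt]

/-- The dimension of the space of differentials of a separably generated extension. -/
lemma finrank_kaehlerDifferential (K : Type u) [Field K] [Algebra k K] [PerfectField k]
    [Algebra.EssFiniteType k K] :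
    ∃ r : ℕ, Algebra.trdeg k K = r ∧ Module.finrank K Ω[K⁄k] = r := by
  obtain ⟨s, hs, H⟩ := exists_isTranscendenceBasis_and_isSeparable_of_perfectField k K
  refine ⟨s.card, ?_, ?_⟩
  · rw [← hs.cardinalMk_eq_trdeg]
    simp
  · let v : s → K := (↑)
    have hv : AlgebraicIndependent k v := hs.1
    have H' : Algebra.IsSeparable (IntermediateField.adjoin k (Set.range v)) K := by
      convert! H <;> simp [v]
    let P := MvPolynomial s k
    let A := Algebra.adjoin k (Set.range v)
    let e : P ≃ₐ[k] A := hv.aevalEquiv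
    let i1 : Algebra P A := e.toAlgHom.toRingHom.toAlgebra
    let i2 : Algebra P K := ((algebraMap A K).comp e.toAlgHom.toRingHom).toAlgebra
    have t1 : IsScalarTower P A K := IsScalarTower.of_algebraMap_eq' rfl
    have t2 : IsScalarTower k P K := IsScalarTower.of_algebraMap_eq fun a => by
      change _ = algebraMap A K (e (algebraMap k P a))
      rw [e.commutes]
      rfl
    -- For a separating transcendence basis `v`, the steps `P ≅ k[v] → k(v) → K` are an isomorphism,
    -- a localization and a separable algebraic extension. So `K` is formally étale over a
    -- polynomial ring, and its differentials are the base change of a free module.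
    have E1 : Algebra.FormallyEtale P A :=
      Algebra.FormallyEtale.of_equiv
        ({ e.toRingEquiv with commutes' := fun _ => rfl } : P ≃ₐ[P] A)
    have E2 : Algebra.FormallyEtale A K := by
      open scoped IntermediateField.algebraAdjoinAdjoin in
      have : Algebra.FormallyEtale A (IntermediateField.adjoin k (Set.range v)) :=
        .of_isLocalization (nonZeroDivisors _)
      have : Algebra.FormallyEtale (IntermediateField.adjoin k (Set.range v)) K :=
        Algebra.FormallyEtale.of_isSeparable _ K
      exact .comp _ (IntermediateField.adjoin k (Set.range v)) _
    have E3 : Algebra.FormallyEtale P K := .comp P A K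
    have e2 := KaehlerDifferential.tensorKaehlerEquivOfFormallyEtale k P K
    have h5 := Module.finrank_eq_card_basis
      ((KaehlerDifferential.mvPolynomialBasis k s).baseChange K)
    rw [← e2.finrank_eq, h5, Fintype.card_coe]

/-- The differentials of a domain of dimension at least `n` have no `(n - 1)`-st Fitting ideal. -/
lemma fittingSpan_le_of_le_ringKrullDim [PerfectField k] {R : Type u} [CommRing R] [Algebra k R]
    [Algebra.FiniteType k R] (P : Ideal R) [P.IsPrime] {n : ℕ} (hn : n ≤ ringKrullDim (R ⧸ P))
    {q : ℕ} {g : Fin q → Ω[R⁄k]} (hg : Submodule.span R (Set.range g) = ⊤) :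
    fittingSpan (n - 1 : ℤ) g ≤ P := by
  let D := R ⧸ P
  let K := FractionRing D
  obtain ⟨s, hs, hst⟩ := exists_trdeg_eq (k := k) D
  have : Algebra.EssFiniteType D K := Algebra.EssFiniteType.of_isLocalization K (nonZeroDivisors D)
  have : Algebra.EssFiniteType k K := Algebra.EssFiniteType.comp k D K
  obtain ⟨r, hr, hrt⟩ := finrank_kaehlerDifferential (k := k) K
  rw [trdeg_isLocalization (D := D) (nonZeroDivisors D) le_rfl, hst] at hr
  have hnr : n ≤ r := by
    rw [show ringKrullDim (R ⧸ P) = s from hs] at hn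
    have := Nat.cast_injective hr
    have := Nat.cast_le.1 hn
    omega
  let α := KaehlerDifferential.map k k R K
  have hspan : Submodule.span K (Set.range (α ∘ g)) = ⊤ := by
    rw [eq_top_iff, ← KaehlerDifferential.span_range_map_derivation_of_isLocalization k D K
      (nonZeroDivisors D), Submodule.span_le]
    rintro _ ⟨d, rfl⟩
    obtain ⟨r, rfl⟩ := Ideal.Quotient.mk_surjective d
    have h1 : (KaehlerDifferential.map k k D K ∘ KaehlerDifferential.D k D)
        (Ideal.Quotient.mk P r) = α (KaehlerDifferential.D k R r) := by
      rw [Function.comp_apply, KaehlerDifferential.map_D, KaehlerDifferential.map_D]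
      rfl
    rw [h1]
    obtain ⟨c, hc⟩ := (Submodule.mem_span_range_iff_exists_fun R).1
      (hg ▸ Submodule.mem_top : KaehlerDifferential.D k R r ∈ Submodule.span R (Set.range g))
    rw [← hc, map_sum]
    refine Submodule.sum_mem _ fun j _ => ?_
    rw [map_smul, ← algebraMap_smul K (c j)]
    exact Submodule.smul_mem _ _ (Submodule.subset_span ⟨j, rfl⟩)
  have hfin : Module.Finite K Ω[K⁄k] := inferInstance
  let b : Module.Basis (Fin r) K Ω[K⁄k] := Module.finBasisOfFinrankEq K _ hrt
  have h0 : fittingSpan (n - 1 : ℤ) (α ∘ g) = (⊥ : Ideal K) := by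
    rw [fittingSpan_eq hspan b.span_eq, eq_bot_iff]
    refine fittingSpan_le.2 fun w t ht hw => ?_
    rw [Fintype.card_fin] at ht
    obtain ⟨a, ha⟩ : t.Nonempty := Finset.card_pos.1 (by omega)
    have h1 := Fintype.linearIndependent_iff.1 b.linearIndependent _ (hw a ha)
    rw [Matrix.det_eq_zero_of_row_eq_zero a h1]
    exact zero_mem _
  refine fittingSpan_le.2 fun w t ht hw => ?_
  -- Relations in `Ω[R⁄k]` map to relations in `Ω[K⁄k]`. This is enough, and no base change
  -- isomorphism between the two modules is needed.
  have h1 : ((algebraMap R K).mapMatrix w).det ∈ fittingSpan (n - 1 : ℤ) (α ∘ g) := by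
    refine det_mem_fittingSpan t ht fun a ha => ?_
    have := congrArg α (hw a ha)
    rw [map_sum, map_zero] at this
    rw [← this]
    refine Finset.sum_congr rfl fun j _ => ?_
    rw [map_smul]
    exact algebraMap_smul K (w a j) _
  rw [h0, ← RingHom.map_det, Submodule.mem_bot, IsScalarTower.algebraMap_apply R D K,
    IsFractionRing.to_map_eq_zero_iff] at h1
  exact Ideal.Quotient.eq_zero_iff_mem.1 h1

end

end Jets
end

/-! ### Differentials of complete intersections. -/

noncomputable section
namespace Jets

section
variable {k : Type u} [Field k] {S : Type u} [CommRing S] [Algebra k S] {N r n : ℕ}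
  (φ : MvPolynomial (Fin N) k →ₐ[k] S) {f : Fin r → MvPolynomial (Fin N) k}

lemma D_eq_sum_pderiv (F : MvPolynomial (Fin N) k) :
    KaehlerDifferential.D k (MvPolynomial (Fin N) k) F =
      ∑ i, MvPolynomial.pderiv i F • KaehlerDifferential.D k _ (MvPolynomial.X i) := by
  rw [← (KaehlerDifferential.mvPolynomialBasis k (Fin N)).sum_repr (KaehlerDifferential.D k _ F)]
  refine Finset.sum_congr rfl fun i _ => ?_
  rw [KaehlerDifferential.mvPolynomialBasis_repr_apply, KaehlerDifferential.mvPolynomialBasis_apply]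

lemma span_range_D_X (hφ : Function.Surjective φ) :
    Submodule.span S (Set.range fun i => KaehlerDifferential.D k S (φ (MvPolynomial.X i))) = ⊤ := by
  let := φ.toRingHom.toAlgebra
  have : IsScalarTower k (MvPolynomial (Fin N) k) S :=
    IsScalarTower.of_algebraMap_eq fun a => (φ.commutes a).symm
  rw [eq_top_iff, ← KaehlerDifferential.span_range_derivation, Submodule.span_le]
  rintro _ ⟨x, rfl⟩
  obtain ⟨F, rfl⟩ := hφ x
  have h1 : KaehlerDifferential.D k S (φ F) =
      KaehlerDifferential.map k k (MvPolynomial (Fin N) k) S (KaehlerDifferential.D k _ F) :=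
    (KaehlerDifferential.map_D k k (MvPolynomial (Fin N) k) S F).symm
  rw [h1, D_eq_sum_pderiv, map_sum]
  refine Submodule.sum_mem _ fun i _ => ?_
  rw [map_smul, KaehlerDifferential.map_D, ← algebraMap_smul S (MvPolynomial.pderiv i F)]
  exact Submodule.smul_mem _ _ (Submodule.subset_span ⟨i, rfl⟩)

/-- By the conormal sequence, a relation among the `dx_i` is the gradient of some `F` in the kernel
of `φ`. Writing `F = ∑ c_j f_j`, the Leibniz terms containing `f_j` vanish in `S` and only
combinations of the gradients of the `f_j` remain. -/
lemma mem_span_jacobian (hφ : Function.Surjective φ)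
    (hf : RingHom.ker φ = Ideal.span (Set.range f)) (w : Fin N → S)
    (hw : ∑ i, w i • KaehlerDifferential.D k S (φ (MvPolynomial.X i)) = 0) :
    w ∈ Submodule.span S (Set.range fun j => fun i => φ (MvPolynomial.pderiv i (f j))) := by
  let P := MvPolynomial (Fin N) k
  let := φ.toRingHom.toAlgebra
  have : IsScalarTower k P S := IsScalarTower.of_algebraMap_eq fun a => (φ.commutes a).symm
  let b := (KaehlerDifferential.mvPolynomialBasis k (Fin N)).baseChange S
  have hb : ∀ i, b i = (1 : S) ⊗ₜ KaehlerDifferential.D k P (MvPolynomial.X i) := fun i => by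
    rw [Module.Basis.baseChange_apply, KaehlerDifferential.mvPolynomialBasis_apply]
  have h1 : KaehlerDifferential.mapBaseChange k P S (∑ i, w i • b i) = 0 := by
    rw [← hw, map_sum]
    refine Finset.sum_congr rfl fun i _ => ?_
    rw [hb, map_smul, KaehlerDifferential.mapBaseChange_tmul, one_smul, KaehlerDifferential.map_D]
    rfl
  obtain ⟨y, hy⟩ := (KaehlerDifferential.exact_kerCotangentToTensor_mapBaseChange k P S hφ _).1 h1
  obtain ⟨⟨F, hF⟩, rfl⟩ := Ideal.toCotangent_surjective _ y
  rw [KaehlerDifferential.kerCotangentToTensor_toCotangent] at hy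
  have h2 : w = fun i => φ (MvPolynomial.pderiv i F) := by
    have h3 : (1 : S) ⊗ₜ[P] KaehlerDifferential.D k P F =
        ∑ i, φ (MvPolynomial.pderiv i F) • b i := by
      rw [D_eq_sum_pderiv, TensorProduct.tmul_sum]
      refine Finset.sum_congr rfl fun i _ => ?_
      rw [hb, TensorProduct.tmul_smul, ← algebraMap_smul S (MvPolynomial.pderiv i F)]
      rfl
    rw [h3] at hy
    ext i
    have h4 := congrArg (fun x => b.repr x i) hy
    simpa only [b.repr_sum_self] using h4.symm
  have hF' : F ∈ Ideal.span (Set.range f) := hf ▸ hF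
  rw [h2]
  obtain ⟨c, rfl⟩ := (Submodule.mem_span_range_iff_exists_fun P).1 hF'
  have hfj : ∀ j, φ (f j) = 0 := fun j => by
    rw [← RingHom.mem_ker, hf]
    exact Ideal.subset_span ⟨j, rfl⟩
  have h5 : (fun i => φ (MvPolynomial.pderiv i (∑ j, c j • f j))) =
      ∑ j, φ (c j) • fun i => φ (MvPolynomial.pderiv i (f j)) := by
    ext i
    rw [map_sum, map_sum, Finset.sum_apply]
    refine Finset.sum_congr rfl fun j _ => ?_
    rw [smul_eq_mul, Derivation.leibniz, map_add, smul_eq_mul, smul_eq_mul, map_mul, map_mul,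
      hfj, zero_mul, add_zero]
    rfl
  rw [h5]
  exact Submodule.sum_mem _ fun j _ => Submodule.smul_mem _ _ (Submodule.subset_span ⟨j, rfl⟩)

/-- The Fitting ideals of the differentials of a complete intersection. -/
lemma fittingSpan_eq_bot_of_presentation (hφ : Function.Surjective φ)
    (hf : RingHom.ker φ = Ideal.span (Set.range f)) (hn : n + r ≤ N)
    {q : ℕ} {g : Fin q → Ω[S⁄k]} (hg : Submodule.span S (Set.range g) = ⊤) :
    fittingSpan (n - 1 : ℤ) g = (⊥ : Ideal S) := by
  classical
  rw [fittingSpan_eq hg (span_range_D_X φ hφ), eq_bot_iff]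
  refine fittingSpan_le.2 fun w s hs hw => ?_
  rw [Fintype.card_fin] at hs
  -- The relation rows may be taken to be rows of the Jacobian matrix. There are at least `N - n + 1
  -- > r` of them and only `r` such rows, so two coincide.
  refine det_mem_of_mem_span (fun a => if a ∈ s then
      Set.range (fun j => fun i => φ (MvPolynomial.pderiv i (f j))) else Set.univ)
    (fun w' hw' => ?_) w fun a => ?_
  · have h1 : ∀ a : s, ∃ j : Fin r, (fun i => φ (MvPolynomial.pderiv i (f j))) = w' a :=
      fun a => by
        have := hw' a
        rwa [if_pos a.2] at this
    choose c hc using h1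
    obtain ⟨a, b, hne, hab⟩ := Fintype.exists_ne_map_eq_of_card_lt c (by
      rw [Fintype.card_fin, Fintype.card_coe]; omega)
    rw [Matrix.det_zero_of_row_eq (i := (a : Fin N)) (j := (b : Fin N))
      (fun h => hne (Subtype.ext h)) (by rw [← hc, ← hc, hab])]
    exact zero_mem _
  · split_ifs with ha
    · exact mem_span_jacobian φ hφ hf _ (hw a ha)
    · exact Submodule.subset_span trivial

end

end Jets
end

/-! ### Dimension at the generic points of the components. -/

noncomputable section
namespace Jets

section
variable {k : Type u} [Field k]

/-- The dimension of a subvariety can be computed on a principal open subset. -/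
lemma ringKrullDim_quotient_comap {R S : Type u} [CommRing R] [Algebra k R]
    [Algebra.FiniteType k R] [CommRing S] [Algebra R S] (f : R) [IsLocalization.Away f S]
    (P : Ideal S) [P.IsPrime] :
    ringKrullDim (S ⧸ P) = ringKrullDim (R ⧸ P.comap (algebraMap R S)) := by
  let Q := P.comap (algebraMap R S)
  let : Algebra (R ⧸ Q) (S ⧸ P) := (Ideal.quotientMap P (algebraMap R S) le_rfl).toAlgebra
  let : Algebra k (S ⧸ P) := ((algebraMap (R ⧸ Q) (S ⧸ P)).comp (algebraMap k (R ⧸ Q))).toAlgebra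
  have : IsScalarTower k (R ⧸ Q) (S ⧸ P) := IsScalarTower.of_algebraMap_eq fun _ => rfl
  have h1 : IsLocalization ((Submonoid.powers f).map (Ideal.Quotient.mk Q)) (S ⧸ P) := by
    refine IsLocalization.of_surjective (Submonoid.powers f) S (Ideal.Quotient.mk Q)
      Ideal.Quotient.mk_surjective (Ideal.Quotient.mk P) Ideal.Quotient.mk_surjective ?_ ?_
    · ext x
      rfl
    · rw [Ideal.mk_ker, Ideal.mk_ker, IsLocalization.map_under (Submonoid.powers f) S P]
  rw [Submonoid.map_powers] at h1
  have : IsLocalization.Away (Ideal.Quotient.mk Q f) (S ⧸ P) := h1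
  refine ringKrullDim_away (k := k) (Ideal.Quotient.mk Q f) fun h => ?_
  have h2 : algebraMap R S f ∈ P := by rwa [Ideal.Quotient.eq_zero_iff_mem] at h
  exact Ideal.IsPrime.ne_top inferInstance
    (Ideal.eq_top_of_isUnit_mem P h2 (IsLocalization.Away.algebraMap_isUnit f))

end

section
variable {X : Scheme.{u}}

/-- Chains of irreducible closed subsets are replaced by chains of their generic points, which are
easier to move into an affine open set. -/
lemma exists_ltSeries_of_le_topologicalKrullDim {Z : Set X} (hZ : IsClosed Z) {n : ℕ}
    (h : n ≤ topologicalKrullDim Z) : ∃ l : LTSeries X, l.length = n ∧ ∀ i, l i ∈ Z := by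
  obtain ⟨l, hl⟩ := Order.le_krullDim_iff.1 h
  have h1 : StrictMono (TopologicalSpace.IrreducibleCloseds.map (Subtype.val : Z → X)
      continuous_subtype_val) :=
    TopologicalSpace.IrreducibleCloseds.map_strictMono_of_isInducing Topology.IsInducing.subtypeVal
  refine ⟨(l.map _ h1).map (fun T => irreducibleSetEquivPoints T) fun S T hST => ?_, hl, fun i => ?_⟩
  · exact irreducibleSetEquivPoints.lt_iff_lt.2 hST
  · have h2 : irreducibleSetEquivPoints (TopologicalSpace.IrreducibleCloseds.map Subtype.val
      continuous_subtype_val (l i)) ∈ closure (Subtype.val '' (l i : Set Z)) :=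
        (IsIrreducible.isGenericPoint_genericPoint
          ((l i).isIrreducible.image _ continuous_subtype_val.continuousOn).closure isClosed_closure).mem
    refine closure_minimal ?_ hZ h2
    rintro _ ⟨z, -, rfl⟩
    exact z.2

lemma le_iff_fromSpec_specializes {V : X.Opens} (hV : IsAffineOpen V)
    (x y : PrimeSpectrum Γ(X, V)) : x ≤ y ↔ hV.fromSpec x ⤳ hV.fromSpec y :=
  (PrimeSpectrum.le_iff_specializes x y).trans
    hV.fromSpec.isOpenEmbedding.toIsInducing.specializes_iff.symm

lemma le_ringKrullDim_of_ltSeries {V : X.Opens} (hV : IsAffineOpen V) (P : PrimeSpectrum Γ(X, V))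
    (l : LTSeries X) (hl : l.head ∈ V) (h : ∀ i, hV.fromSpec P ⤳ l i) :
    l.length ≤ ringKrullDim (Γ(X, V) ⧸ P.asIdeal) := by
  rw [ringKrullDim_quotient, Order.le_krullDim_iff]
  have hli : ∀ i, l i ∈ V := fun i =>
    (show l i ⤳ l.head from LTSeries.head_le l i).mem_open V.2 hl
  let p : Fin (l.length + 1) → PrimeSpectrum Γ(X, V) := fun i => hV.primeIdealOf ⟨l i, hli i⟩
  have hp : ∀ i, hV.fromSpec (p i) = l i := fun i => hV.fromSpec_primeIdealOf ⟨l i, hli i⟩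
  have hle := le_iff_fromSpec_specializes hV
  -- The order of points of a scheme puts generizations above, whereas primes increase under
  -- specialization; hence the reversal.
  refine ⟨⟨l.length, fun i => ⟨p i.rev, ?_⟩, fun i => ?_⟩, rfl⟩
  · change P ≤ p i.rev
    rw [hle, hp]
    exact h _
  · change p _ < p _
    have h1 : l i.succ.rev < l i.castSucc.rev :=
      l.strictMono (by rw [Fin.rev_lt_rev]; exact Fin.castSucc_lt_succ)
    rw [lt_iff_le_not_ge] at h1 ⊢
    rw [hle, hle, hp, hp]
    exact h1

end

section
variable {k : Type u} [Field k] {X : SchOver k} [LocallyOfFiniteType X.hom]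

lemma ringKrullDim_quotient_basicOpen {U : X.left.Opens} (hU : IsAffineOpen U)
    {W : X.left.Opens} (f : Γ(X.left, U)) (hW : W = X.left.basicOpen f)
    (hW' : IsAffineOpen W)
    (P : PrimeSpectrum Γ(X.left, U)) (Q : PrimeSpectrum Γ(X.left, W))
    (h : hU.fromSpec P = hW'.fromSpec Q) :
    ringKrullDim (Γ(X.left, W) ⧸ Q.asIdeal) = ringKrullDim (Γ(X.left, U) ⧸ P.asIdeal) := by
  have i : W ⟶ U := homOfLE (hW ▸ X.left.basicOpen_le f)
  let : Algebra Γ(X.left, U) Γ(X.left, W) := (X.left.presheaf.map i.op).hom.toAlgebra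
  have : IsLocalization.Away f Γ(X.left, W) := hU.isLocalization_of_eq_basicOpen f i hW
  have : Algebra.FiniteType k Γ(X.left, U) := finiteType_sections hU
  have h1 : P.asIdeal = Q.asIdeal.comap (algebraMap Γ(X.left, U) Γ(X.left, W)) := by
    have h2 : hU.fromSpec (Spec.map (X.left.presheaf.map i.op) Q) = hU.fromSpec P := by
      rw [h]
      exact congr($(hU.map_fromSpec hW' i.op) Q)
    have h3 := hU.fromSpec.isOpenEmbedding.injective h2
    rw [← h3]
    rfl
  rw [h1]
  exact ringKrullDim_quotient_comap (k := k) f Q.asIdeal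

lemma ringKrullDim_quotient_eq {U V : X.left.Opens} (hU : IsAffineOpen U) (hV : IsAffineOpen V)
    (P : PrimeSpectrum Γ(X.left, U)) (Q : PrimeSpectrum Γ(X.left, V))
    (h : hU.fromSpec P = hV.fromSpec Q) :
    ringKrullDim (Γ(X.left, U) ⧸ P.asIdeal) = ringKrullDim (Γ(X.left, V) ⧸ Q.asIdeal) := by
  have hxU : hU.fromSpec P ∈ U := hU.range_fromSpec.le ⟨P, rfl⟩
  have hxV : hU.fromSpec P ∈ V := by rw [h]; exact hV.range_fromSpec.le ⟨Q, rfl⟩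
  obtain ⟨f, g, hfg, hf⟩ := exists_basicOpen_le_affine_inter hU hV _ ⟨hxU, hxV⟩
  have hW := hU.basicOpen f
  have hx := hW.fromSpec_primeIdealOf ⟨_, hf⟩
  rw [← ringKrullDim_quotient_basicOpen hU f rfl hW P _ hx.symm,
    ← ringKrullDim_quotient_basicOpen hV g hfg hW Q _ (h.symm.trans hx.symm)]

/-- A minimal prime is the generic point of a component of `X`. A chain of length `n` in this
component need not meet `U`, so it is placed in an affine neighbourhood `V` of its most special
point; the dimensions computed in `U` and `V` agree, as the generic point lies in both. -/
lemma le_ringKrullDim_of_mem_minimalPrimes {n : ℕ} (hX : IsPureDimensional X.left n)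
    {U : X.left.Opens} (hU : IsAffineOpen U) (P : PrimeSpectrum Γ(X.left, U))
    (hP : P.asIdeal ∈ minimalPrimes Γ(X.left, U)) :
    n ≤ ringKrullDim (Γ(X.left, U) ⧸ P.asIdeal) := by
  let x := hU.fromSpec P
  have hxU : x ∈ U := hU.range_fromSpec.le ⟨P, rfl⟩
  have hZ : closure {x} ∈ irreducibleComponents X.left := by
    refine ⟨isIrreducible_singleton.closure, fun T hT hxT => ?_⟩
    obtain ⟨y, hy⟩ := QuasiSober.sober hT.closure isClosed_closure
    have h1 : y ⤳ x := hy.specializes (subset_closure (hxT (subset_closure rfl)))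
    have hyU : y ∈ U := h1.mem_open U.2 hxU
    have h2 : hU.primeIdealOf ⟨y, hyU⟩ ≤ P := by
      rw [le_iff_fromSpec_specializes hU, hU.fromSpec_primeIdealOf]
      exact h1
    have h3 : P ≤ hU.primeIdealOf ⟨y, hyU⟩ :=
      hP.2 ⟨(hU.primeIdealOf ⟨y, hyU⟩).2, bot_le⟩ h2
    have h4 : y = x :=
      (hU.fromSpec_primeIdealOf ⟨y, hyU⟩).symm.trans (congrArg hU.fromSpec
        (le_antisymm (α := PrimeSpectrum Γ(X.left, U)) h2 h3))
    rw [← h4, show closure {y} = closure T from hy]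
    exact subset_closure
  obtain ⟨l, hl, hlZ⟩ := exists_ltSeries_of_le_topologicalKrullDim isClosed_closure
    (hX _ hZ).ge
  obtain ⟨V, hV, hVx, -⟩ := exists_isAffineOpen_mem_and_subset (X := X.left) (x := l.head)
    (U := ⊤) trivial
  have hs : ∀ i, x ⤳ l i := fun i => specializes_iff_mem_closure.2 (hlZ i)
  have hxV : x ∈ V := (hs 0).mem_open V.2 hVx
  rw [ringKrullDim_quotient_eq hU hV P (hV.primeIdealOf ⟨x, hxV⟩)
    (hV.fromSpec_primeIdealOf ⟨x, hxV⟩).symm, ← hl]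
  refine le_ringKrullDim_of_ltSeries hV _ l hVx fun i => ?_
  rw [hV.fromSpec_primeIdealOf]
  exact hs i

end

end Jets
end

/-! ### Vanishing of the Fitting ideal of index `n - 1`. -/

noncomputable section
namespace Jets

section
variable {k : Type u} [Field k] {X : SchOver k}

lemma exists_fittingSpan_basicOpen {U W : X.left.Opens} (hU : IsAffineOpen U)
    (f : Γ(X.left, U)) (hW : W = X.left.basicOpen f) (i : W ⟶ U) {q : ℕ}
    {g : Fin q → Ω[Γ(X.left, U)⁄k]} (hg : Submodule.span Γ(X.left, U) (Set.range g) = ⊤) :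
    ∃ g' : Fin q → Ω[Γ(X.left, W)⁄k], Submodule.span Γ(X.left, W) (Set.range g') = ⊤ ∧
      ∀ j : ℤ, fittingSpan j g' =
        (fittingSpan (R := Γ(X.left, U)) j g).map (X.left.presheaf.map i.op).hom := by
  let R := Γ(X.left, U)
  let S := Γ(X.left, W)
  let : Algebra R S := (X.left.presheaf.map i.op).hom.toAlgebra
  have : IsScalarTower k R S := IsScalarTower.of_algebraMap_eq' (sections_map_comp _).symm
  have : IsLocalization.Away f S := hU.isLocalization_of_eq_basicOpen f i hW
  have : Algebra.FormallyEtale R S := Algebra.FormallyEtale.of_isLocalization (Submonoid.powers f)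
  have h1 := KaehlerDifferential.isBaseChange_of_formallyEtale k R S
  refine ⟨KaehlerDifferential.map k k R S ∘ g, ?_, fun j => fittingSpan_isBaseChange h1 hg⟩
  rw [Set.range_comp]
  exact span_eq_top_of_isLocalizedModule S (Submonoid.powers f) (KaehlerDifferential.map k k R S) hg

variable [LocallyOfFiniteType X.hom]

/-- Vanishing of a Fitting ideal of the differentials can be checked on an affine cover. -/
lemma fittingSpan_eq_bot_of_cover {j : ℤ}
    (h : ∀ x : X.left, ∃ V : X.left.Opens, IsAffineOpen V ∧ x ∈ V ∧
      ∀ (q : ℕ) (g : Fin q → Ω[Γ(X.left, V)⁄k]),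
        Submodule.span Γ(X.left, V) (Set.range g) = ⊤ → fittingSpan j g = (⊥ : Ideal Γ(X.left, V)))
    {U : X.left.Opens} (hU : IsAffineOpen U) {q : ℕ} {g : Fin q → Ω[Γ(X.left, U)⁄k]}
    (hg : Submodule.span Γ(X.left, U) (Set.range g) = ⊤) :
    fittingSpan j g = (⊥ : Ideal Γ(X.left, U)) := by
  rw [eq_bot_iff]
  intro d hd
  have key : ∀ x : U, ∃ (W : X.left.Opens) (i : W ⟶ U), x.1 ∈ W ∧
      (X.left.presheaf.map i.op).hom d = 0 := by
    intro x
    obtain ⟨V, hV, hxV, hVan⟩ := h x.1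
    obtain ⟨a, b, hab, ha⟩ := exists_basicOpen_le_affine_inter hU hV x.1 ⟨x.2, hxV⟩
    let i : X.left.basicOpen a ⟶ U := homOfLE (X.left.basicOpen_le a)
    let i' : X.left.basicOpen a ⟶ V := homOfLE (hab.le.trans (X.left.basicOpen_le b))
    refine ⟨X.left.basicOpen a, i, ha, ?_⟩
    have : Algebra.FiniteType k Γ(X.left, V) := finiteType_sections hV
    obtain ⟨r, w, hw⟩ := Module.Finite.exists_fin (R := Γ(X.left, V)) (M := Ω[Γ(X.left, V)⁄k])
    obtain ⟨g', hg', hgj⟩ := exists_fittingSpan_basicOpen hU a rfl i hg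
    obtain ⟨w', hw', hwj⟩ := exists_fittingSpan_basicOpen hV b hab i' hw
    have h1 : fittingSpan j g' = (⊥ : Ideal Γ(X.left, X.left.basicOpen a)) := by
      rw [fittingSpan_eq hg' hw', hwj, hVan r w hw, Ideal.map_bot]
    have h2 := Ideal.mem_map_of_mem (X.left.presheaf.map i.op).hom hd
    rwa [← hgj, h1] at h2
  choose W i hxW hd0 using key
  refine X.left.sheaf.eq_of_locally_eq' W U i (fun x hx => ?_) d 0 fun x => ?_
  · exact TopologicalSpace.Opens.mem_iSup.2 ⟨⟨x, hx⟩, hxW _⟩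
  · exact (hd0 x).trans (map_zero (X.left.presheaf.map (i x).op).hom).symm

/-- On a reduced or lci scheme of pure dimension `n`, the differentials have rank at least `n`. -/
lemma fittingSpan_eq_bot [PerfectField k] {n : ℕ} (hX : IsPureDimensional X.left n)
    (hX' : IsReduced X.left ∨ IsLCI X) {U : X.left.Opens} (hU : IsAffineOpen U) {q : ℕ}
    {g : Fin q → Ω[Γ(X.left, U)⁄k]} (hg : Submodule.span Γ(X.left, U) (Set.range g) = ⊤) :
    fittingSpan (n - 1 : ℤ) g = (⊥ : Ideal Γ(X.left, U)) := by
  rcases hX' with hX' | hX'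
  · have : Algebra.FiniteType k Γ(X.left, U) := finiteType_sections hU
    -- In a reduced ring the minimal primes intersect in zero, so containment in each of them
    -- suffices.
    rw [eq_bot_iff, ← nilradical_eq_bot_iff.2 (inferInstance : _root_.IsReduced Γ(X.left, U)),
      nilradical, ← Ideal.sInf_minimalPrimes]
    refine le_sInf fun P hP => ?_
    have := hP.1.1
    exact fittingSpan_le_of_le_ringKrullDim P
      (le_ringKrullDim_of_mem_minimalPrimes hX hU ⟨P, this⟩ hP) hg
  · refine fittingSpan_eq_bot_of_cover (fun x => ?_) hU hg
    obtain ⟨V, hV, hxV, N, r, φ, f, hφ, hf, hN⟩ := hX' x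
    refine ⟨V, hV, hxV, fun q g hg => fittingSpan_eq_bot_of_presentation φ hφ hf ?_ hg⟩
    -- The point `x` provides a minimal prime. Its quotient has dimension at least `n`, so `n` is at
    -- most the dimension of the ring, and `n + r ≤ N`.
    have hne : Nonempty (PrimeSpectrum Γ(X.left, V)) := ⟨hV.primeIdealOf ⟨x, hxV⟩⟩
    have := PrimeSpectrum.nonempty_iff_nontrivial.1 hne
    obtain ⟨P, hP⟩ := Ideal.nonempty_minimalPrimes (I := (⊥ : Ideal Γ(X.left, V))) bot_ne_top
    have := (le_ringKrullDim_of_mem_minimalPrimes hX hV ⟨P, hP.1.1⟩ hP).trans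
      (ringKrullDim_quotient_le P)
    have h2 : ((n + r : ℕ) : WithBot ℕ∞) ≤ (N : ℕ) := by
      rw [← hN, Nat.cast_add]
      gcongr
    exact_mod_cast h2

end

end Jets
end

/-! ### Generic freeness of the pulled back differentials. -/

noncomputable section
namespace Jets

section
variable {k : Type u} [Field k] {R B B' : Type u} [CommRing R] [Algebra k R] [CommRing B]
  [Algebra k B] [CommRing B'] [Algebra k B'] {m q : ℕ}

namespace JetDiffQuot

/-- A basis of a localization of the pulled back differentials gives coordinates. -/
lemma exists_isCoordinates_of_isLocalizedModule [Algebra B B'] [IsScalarTower k B B']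
    (S : Submonoid B) [IsLocalization S B'] {ψ : R →ₐ[k] TruncPoly B m}
    {N : Type*} [AddCommGroup N] [Module B N] [Module B' N] [IsScalarTower B B' N]
    (μ : JetDiffQuot ψ q →ₗ[B] N) [IsLocalizedModule S μ] {d : ℕ}
    (b : Module.Basis (Fin d) B' N) :
    ∃ lam : Fin d → JetDiffQuot ψ q →ₛₗ[(IsScalarTower.toAlgHom k B B').toRingHom] B',
      IsCoordinates (IsScalarTower.toAlgHom k B B') lam := by
  refine ⟨fun j =>
    { toFun := fun x => b.repr (μ x) j
      map_add' := fun x y => by rw [map_add, map_add]; rfl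
      map_smul' := fun a x => by
        rw [map_smul, ← algebraMap_smul B' a, map_smul]
        rfl }, fun C _ _ f l => ?_⟩
  let : Module B' C := Module.compHom C f.toRingHom
  let : Module B C := Module.compHom C (f.comp (IsScalarTower.toAlgHom k B B')).toRingHom
  have : IsScalarTower B B' C := ⟨fun a b c => by
    change f (a • b) * c = f (algebraMap B B' a) * (f b * c)
    rw [Algebra.smul_def, map_mul, mul_assoc]⟩
  have hS : ∀ x : S, IsUnit (algebraMap B (Module.End B C) x) := fun x => by
    obtain ⟨u, hu⟩ := IsLocalization.map_units B' x
    rw [Module.End.isUnit_iff]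
    have h1 : ∀ c : C, algebraMap B (Module.End B C) x c = f u * c := fun c => by
      rw [hu]
      rfl
    constructor
    · intro c c' hc
      rw [h1, h1] at hc
      have h2 := congrArg (f ↑u⁻¹ * ·) hc
      simpa only [← mul_assoc, ← map_mul, Units.inv_mul, map_one, one_mul] using h2
    · intro c
      refine ⟨f ↑u⁻¹ * c, ?_⟩
      rw [h1, ← mul_assoc, ← map_mul, Units.mul_inv, map_one, one_mul]
  let l' : JetDiffQuot ψ q →ₗ[B] C :=
    { toFun := l
      map_add' := map_add l
      map_smul' := fun a x => LinearMap.map_smulₛₗ l a x }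
  let L : N →ₗ[B'] C :=
    (IsLocalizedModule.lift S μ l' hS).extendScalarsOfIsLocalization S B'
  have hL : ∀ x, L (μ x) = l x := fun x => IsLocalizedModule.lift_apply S μ l' hS x
  have hLb : ∀ y, L y = ∑ j, f (b.repr y j) * L (b j) := fun y => by
    conv_lhs => rw [← b.sum_repr y, map_sum]
    exact Finset.sum_congr rfl fun j _ => map_smul L _ _
  refine ⟨fun j => L (b j), fun x => (hL x).symm.trans (hLb _), fun v hv => funext fun j => ?_⟩
  let L' : N →ₗ[B'] C := b.constr B' v
  have h1 : L'.restrictScalars B = L.restrictScalars B := by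
    refine IsLocalizedModule.ext S μ hS (LinearMap.ext fun x => ?_)
    change L' (μ x) = L (μ x)
    rw [hL, hv, ← b.sum_repr (μ x), map_sum]
    refine Finset.sum_congr rfl fun j _ => ?_
    rw [map_smul, b.constr_basis]
    rfl
  have h2 := congr($h1 (b j))
  exact (b.constr_basis B' v j).symm.trans h2

variable [Algebra.FiniteType k R]

/-- Over a dense open subset the pulled back differentials have coordinates. -/
lemma exists_isCoordinates [IsDomain B] [Algebra.FiniteType k B] (ψ : R →ₐ[k] TruncPoly B m) (q : ℕ) :
    ∃ s : B, s ≠ 0 ∧ ∃ (d : ℕ) (lam : Fin d → JetDiffQuot ψ q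
        →ₛₗ[(IsScalarTower.toAlgHom k B (Localization.Away s)).toRingHom] Localization.Away s),
      IsCoordinates (IsScalarTower.toAlgHom k B (Localization.Away s)) lam := by
  have : IsNoetherianRing B := Algebra.FiniteType.isNoetherianRing k B
  have : Module.Finite B (JetDiffQuot ψ q) :=
    Module.Finite.of_surjective ((proj ψ q).restrictScalars B) (proj_surjective ψ q)
  have : Module.FinitePresentation B (JetDiffQuot ψ q) :=
    Module.finitePresentation_of_finite B _
  let S := nonZeroDivisors B
  -- Over the fraction field the module is free, and freeness of a finitely presented module spreads
  -- out to a principal open subset.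
  obtain ⟨s, hs, hfree, -⟩ := Module.FinitePresentation.exists_free_localizedModule_powers S
    (LocalizedModule.mkLinearMap S (JetDiffQuot ψ q)) (FractionRing B)
  refine ⟨s, nonZeroDivisors.ne_zero hs, ?_⟩
  have : IsDomain (Localization.Away s) :=
    IsLocalization.isDomain_localization (powers_le_nonZeroDivisors_of_noZeroDivisors
      (nonZeroDivisors.ne_zero hs))
  let b := Module.finBasis (Localization.Away s) (LocalizedModule.Away s (JetDiffQuot ψ q))
  exact ⟨_, exists_isCoordinates_of_isLocalizedModule (.powers s)
    (LocalizedModule.mkLinearMap (.powers s) (JetDiffQuot ψ q)) b⟩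

/-- The number of coordinates is the rank at any point. -/
lemma IsCoordinates.finrank_eq {ψ : R →ₐ[k] TruncPoly B m} {d : ℕ} {i : B →ₐ[k] B'}
    {lam : Fin d → JetDiffQuot ψ q →ₛₗ[i.toRingHom] B'} (h : IsCoordinates i lam) (χ : B' →ₐ[k] k) :
    Module.finrank k (JetDiffQuot ((TruncPoly.mapₐ m (χ.comp i)).comp ψ) q) = d := by
  let ψ' := (TruncPoly.mapₐ m (χ.comp i)).comp ψ
  let F : (Fin d → k) →ₗ[k] (JetDiffQuot ψ q →ₛₗ[(χ.comp i).toRingHom] k) :=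
    { toFun := fun v =>
        { toFun := fun x => ∑ j, χ (lam j x) * v j
          map_add' := fun x y => by simp only [map_add, add_mul, Finset.sum_add_distrib]
          map_smul' := fun a x => by
            rw [smul_eq_mul, Finset.mul_sum]
            refine Finset.sum_congr rfl fun j _ => ?_
            rw [LinearMap.map_smulₛₗ, smul_eq_mul, map_mul, mul_assoc]
            rfl }
      map_add' := fun v w => LinearMap.ext fun x => by
        change ∑ j, _ * (v j + w j) = ∑ j, _ * v j + ∑ j, _ * w j
        simp only [mul_add, Finset.sum_add_distrib]
      map_smul' := fun a v => LinearMap.ext fun x => by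
        change ∑ j, _ * (a * v j) = a * ∑ j, _ * v j
        rw [Finset.mul_sum]
        exact Finset.sum_congr rfl fun j _ => mul_left_comm _ _ _ }
  have hF : Function.Bijective F := by
    constructor
    · intro v w hvw
      exact (h k χ (F w)).unique (fun x => congr($hvw.symm x)) fun x => rfl
    · intro l
      obtain ⟨v, hv, -⟩ := h k χ l
      exact ⟨v, LinearMap.ext fun x => (hv x).symm⟩
  have h1 : relDer ((TruncPoly.mapₐ m (AlgHom.id k k)).comp ψ') q = relDer ψ' q := by
    rw [TruncPoly.mapₐ_id, AlgHom.id_comp]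
  -- Derivations along the specialized jet `ψ'` are computed twice: from the family they form `k^d`,
  -- and from `ψ'` itself they form the dual of its reduced differentials.
  let e := (LinearEquiv.ofBijective F hF).trans ((relDerEquiv (χ.comp i) ψ q).trans
    ((LinearEquiv.ofEq _ _ h1).symm.trans ((relDerEquiv (AlgHom.id k k) ψ' q).symm.trans
      (semilinearEquiv (AlgHom.id k k).toRingHom (Module.finBasis k (JetDiffQuot ψ' q))))))
  simpa using e.finrank_eq.symm

end JetDiffQuot

end

end Jets
end

/-! ### Descent and spreading out of lifts. -/

noncomputable section
namespace Jets

section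
variable {k : Type u} [Field k] {R : Type u} [CommRing R] [Algebra k R] {m p : ℕ}

namespace TruncPoly
variable {K A : Type u} [CommRing K] [CommRing A] [Algebra K A]

/-- The coefficientwise extension of a functional. -/
def mapLinear (m : ℕ) (τ : A →ₗ[K] K) : TruncPoly A m →+ TruncPoly K m where
  toFun x := ofCoeff fun i => τ (coeff i x)
  map_zero' := ext_coeff fun i => by rw [coeff_ofCoeff, _root_.map_zero, _root_.map_zero, _root_.map_zero]
  map_add' x y := ext_coeff fun i => by
    rw [_root_.map_add, coeff_ofCoeff, coeff_ofCoeff, coeff_ofCoeff, _root_.map_add, _root_.map_add]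

lemma coeff_mapLinear (τ : A →ₗ[K] K) (x : TruncPoly A m) (i : Fin (m + 1)) :
    coeff i (mapLinear m τ x) = τ (coeff i x) := coeff_ofCoeff _ _

/-- Linearity over `K[t]/(t^{m+1})`, checked on constants and on `t`. -/
lemma mapLinear_mul (τ : A →ₗ[K] K) (a : TruncPoly K m) (x : TruncPoly A m) :
    mapLinear m τ (map m (algebraMap K A) a * x) = a * mapLinear m τ x := by
  induction a using TruncPoly.induction generalizing x with
  | const b =>
    refine ext_coeff fun i => ?_
    rw [map_algebraMap, coeff_mapLinear, coeff_algebraMap_mul, coeff_algebraMap_mul,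
      coeff_mapLinear, ← Algebra.smul_def, _root_.map_smul, smul_eq_mul]
  | add a b ha hb => rw [_root_.map_add, add_mul, _root_.map_add, ha, hb, add_mul]
  | mul_t a ha =>
    rw [_root_.map_mul (map m (algebraMap K A)), mul_assoc, ha, mul_assoc, map_t]
    congr 1
    refine ext_coeff fun i => ?_
    rw [← pow_one (t A m), ← pow_one (t K m), coeff_mapLinear, coeff_t_pow_mul, coeff_t_pow_mul]
    split_ifs
    · rw [coeff_mapLinear]
    · exact _root_.map_zero _

lemma mapLinear_map {τ : A →ₗ[K] K} (hτ : τ 1 = 1) (a : TruncPoly K m) :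
    mapLinear m τ (map m (algebraMap K A) a) = a := by
  have h : mapLinear m τ 1 = 1 := by
    refine ext_coeff fun i => ?_
    have h1 : (1 : TruncPoly A m) = map m (algebraMap K A) 1 := (_root_.map_one _).symm
    rw [coeff_mapLinear, h1, coeff_map, Algebra.algebraMap_eq_smul_one, _root_.map_smul, hτ,
      smul_eq_mul, mul_one]
  rw [← mul_one (map m (algebraMap K A) a), mapLinear_mul, h, mul_one]

lemma trunc_mapLinear (h : p ≤ m) (τ : A →ₗ[K] K) (x : TruncPoly A m) :
    trunc K h (mapLinear m τ x) = mapLinear p τ (trunc A h x) :=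
  ext_coeff fun i => by rw [coeff_trunc, coeff_mapLinear, coeff_mapLinear, coeff_trunc]

end TruncPoly

/-- A jet which can be lifted after a split extension of scalars can be lifted. -/
lemma exists_lift_of_retraction {K A : Type u} [CommRing K] [CommRing A] [Algebra k K] [Algebra k A]
    [Algebra K A] [IsScalarTower k K A] {τ : A →ₗ[K] K} (hτ : τ 1 = 1)
    (h : p ≤ m) (hm : m ≤ 2 * p + 1) (φ : R →ₐ[k] TruncPoly K p) (χ : R →ₐ[k] TruncPoly A m)
    (hχ : (TruncPoly.truncₐ k A h).comp χ =
      (TruncPoly.mapₐ p (IsScalarTower.toAlgHom k K A)).comp φ) :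
    ∃ ψ : R →ₐ[k] TruncPoly K m, (TruncPoly.truncₐ k K h).comp ψ = φ := by
  let M := TruncPoly.mapLinear m τ
  have hχ' : ∀ x, TruncPoly.trunc A h (χ x) = TruncPoly.map p (algebraMap K A) (φ x) :=
    fun x => congr($hχ x)
  have hM : ∀ x, TruncPoly.trunc K h (M (χ x)) = φ x := fun x => by
    rw [TruncPoly.trunc_mapLinear, hχ', TruncPoly.mapLinear_map hτ]
  choose σ hσ using fun x => TruncPoly.trunc_surjective K h (φ x)
  have hη : ∀ x, TruncPoly.trunc A h (χ x - TruncPoly.map m (algebraMap K A) (σ x)) = 0 := by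
    intro x
    have h1 := congr($(TruncPoly.mapₐ_truncₐ h (IsScalarTower.toAlgHom k K A)) (σ x))
    have h2 : TruncPoly.trunc A h (TruncPoly.map m (algebraMap K A) (σ x)) =
      TruncPoly.map p (algebraMap K A) (TruncPoly.trunc K h (σ x)) := h1.symm
    rw [map_sub, hχ', h2, hσ, sub_self]
  have hMη : ∀ x, TruncPoly.trunc K h (M (χ x) - σ x) = 0 := fun x => by
    rw [map_sub, hM, hσ, sub_self]
  -- Although `M` is only linear, `M ∘ χ` is multiplicative. Both `χ x` and `M (χ x)` differ from `σ
  -- x`, which has coefficients in `K`, by an element of a square-zero ideal. So `χ (x * y) = σ x *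
  -- χ y + σ y * χ x - σ x * σ y`, an expression to which linearity applies, and the same formula
  -- holds for `M ∘ χ`.
  have hmul : ∀ x y, M (χ (x * y)) = M (χ x) * M (χ y) := fun x y => by
    have h1 := TruncPoly.mul_eq_zero_of_trunc_eq_zero h hm (hη x) (hη y)
    have h2 := TruncPoly.mul_eq_zero_of_trunc_eq_zero h hm (hMη x) (hMη y)
    have h3 : χ (x * y) = TruncPoly.map m (algebraMap K A) (σ x) * χ y +
        TruncPoly.map m (algebraMap K A) (σ y) * χ x -
        TruncPoly.map m (algebraMap K A) (σ x * σ y) := by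
      rw [map_mul, map_mul]
      linear_combination h1
    rw [h3, map_sub, map_add, TruncPoly.mapLinear_mul, TruncPoly.mapLinear_mul,
      TruncPoly.mapLinear_map hτ]
    linear_combination -h2
  have halg : ∀ a : k, M (χ (algebraMap k R a)) = algebraMap k (TruncPoly K m) a := fun a => by
    have h1 : algebraMap k (TruncPoly A m) a =
        TruncPoly.map m (algebraMap K A) (algebraMap k (TruncPoly K m) a) :=
      ((TruncPoly.mapₐ m (IsScalarTower.toAlgHom k K A)).commutes a).symm
    rw [χ.commutes, h1, TruncPoly.mapLinear_map hτ]
  refine ⟨{ toFun := fun x => M (χ x), map_one' := ?_, map_mul' := hmul, map_zero' := ?_,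
            map_add' := fun x y => by rw [map_add, map_add], commutes' := halg },
    AlgHom.ext fun x => hM x⟩
  · rw [← map_one (algebraMap k R), halg, map_one]
  · rw [map_zero, map_zero]

/-- The lifts of a jet over `B` are parametrized by a `B`-algebra of finite type. -/
lemma exists_lift_algebra [Algebra.FiniteType k R] {B : Type u} [CommRing B] [Algebra k B]
    (h : p ≤ m) (φ : R →ₐ[k] TruncPoly B p) :
    ∃ (E : Type u) (_ : CommRing E) (_ : Algebra B E) (_ : Algebra k E) (_ : IsScalarTower k B E)
      (_ : Algebra.FiniteType B E) (Ψ : R →ₐ[k] TruncPoly E m),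
      (TruncPoly.truncₐ k E h).comp Ψ = (TruncPoly.mapₐ p (IsScalarTower.toAlgHom k B E)).comp φ ∧
      ∀ (C : Type u) [CommRing C] [Algebra k C] (f : B →ₐ[k] C) (χ : R →ₐ[k] TruncPoly C m),
        (TruncPoly.truncₐ k C h).comp χ = (TruncPoly.mapₐ p f).comp φ →
        ∃ g : E →ₐ[k] C, g.comp (IsScalarTower.toAlgHom k B E) = f := by
  obtain ⟨H, _, _, _, Φ, hΦ⟩ := TruncPoly.exists_universal_algHom k R m
  obtain ⟨H', _, _, _, Φ', hΦ'⟩ := TruncPoly.exists_universal_algHom k R p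
  obtain ⟨θ, hθ, -⟩ := hΦ' H ((TruncPoly.truncₐ k H h).comp Φ)
  obtain ⟨β, hβ, -⟩ := hΦ' B φ
  let : Algebra H' H := θ.toRingHom.toAlgebra
  let : Algebra H' B := β.toRingHom.toAlgebra
  have : IsScalarTower k H' H := IsScalarTower.of_algebraMap_eq fun a => (θ.commutes a).symm
  have : IsScalarTower k H' B := IsScalarTower.of_algebraMap_eq fun a => (β.commutes a).symm
  have : Algebra.FiniteType H' H := Algebra.FiniteType.of_restrictScalars_finiteType k H' H
  -- The rings `H` and `H'` represent the jets of orders `m` and `p`, so `E` is the coordinate ring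
  -- of the pullback of the projection along the family `φ`.
  let E := B ⊗[H'] H
  let iH : H →ₐ[k] E := (Algebra.TensorProduct.includeRight : H →ₐ[H'] E).restrictScalars k
  let iB : B →ₐ[k] E := IsScalarTower.toAlgHom k B E
  have hcomm : iH.comp θ = iB.comp β := AlgHom.ext fun a =>
    (Algebra.TensorProduct.includeRight : H →ₐ[H'] E).commutes a
  refine ⟨E, inferInstance, inferInstance, inferInstance, inferInstance, inferInstance,
    (TruncPoly.mapₐ m iH).comp Φ, ?_, fun C _ _ f χ hχ => ?_⟩
  · rw [← AlgHom.comp_assoc, ← TruncPoly.mapₐ_truncₐ, AlgHom.comp_assoc, ← hθ, ← AlgHom.comp_assoc,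
      ← TruncPoly.mapₐ_comp, hcomm, TruncPoly.mapₐ_comp, AlgHom.comp_assoc, hβ]
  · obtain ⟨g, hg, -⟩ := hΦ C χ
    have hgθ : g.comp θ = f.comp β := by
      refine (hΦ' C ((TruncPoly.truncₐ k C h).comp χ)).unique ?_ ?_
      · rw [TruncPoly.mapₐ_comp, AlgHom.comp_assoc, hθ, ← AlgHom.comp_assoc,
          TruncPoly.mapₐ_truncₐ, AlgHom.comp_assoc, hg]
      · rw [TruncPoly.mapₐ_comp, AlgHom.comp_assoc, hβ, hχ]
    let : Algebra H' C := (f.comp β).toRingHom.toAlgebra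
    have : IsScalarTower k H' C := IsScalarTower.of_algebraMap_eq fun a =>
      ((f.comp β).commutes a).symm
    let f' : B →ₐ[H'] C := { f with commutes' := fun a => rfl }
    let g' : H →ₐ[H'] C := { g with commutes' := fun a => congr($hgθ a) }
    refine ⟨(Algebra.TensorProduct.productMap f' g').restrictScalars k, AlgHom.ext fun b => ?_⟩
    exact Algebra.TensorProduct.productMap_left_apply f' g' b

end

section

/-- A point of a family over the generic point extends to a dense open subset. -/
lemma exists_algHom_away {B E K : Type*} [CommRing B] [IsDomain B] [CommRing E] [Algebra B E]
    [Algebra.FiniteType B E] [Field K] [Algebra B K] [IsFractionRing B K] (e : E →ₐ[B] K) :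
    ∃ s : B, s ≠ 0 ∧ Nonempty (E →ₐ[B] Localization.Away s) := by
  classical
  obtain ⟨S, hS⟩ := (inferInstance : Algebra.FiniteType B E)
  -- A common denominator `s` of the images of finitely many generators of `E`.
  obtain ⟨⟨s, hs⟩, hsS⟩ :=
    IsLocalization.exist_integer_multiples_of_finset (nonZeroDivisors B) (S.image e)
  have hs0 : s ≠ 0 := nonZeroDivisors.ne_zero hs
  have hle : Submonoid.powers s ≤ nonZeroDivisors B := powers_le_nonZeroDivisors_of_noZeroDivisors hs0
  let Bs := Localization.Away s
  have : IsDomain Bs := IsLocalization.isDomain_localization hle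
  let : Algebra Bs K :=
    IsLocalization.localizationAlgebraOfSubmonoidLe Bs K (.powers s) (nonZeroDivisors B) hle
  have : IsScalarTower B Bs K :=
    IsLocalization.localization_isScalarTower_of_submonoid_le Bs K (.powers s) (nonZeroDivisors B) hle
  have : IsFractionRing Bs K :=
    IsFractionRing.isFractionRing_of_isDomain_of_isLocalization (.powers s) Bs K
  let j : Bs →ₐ[B] K := IsScalarTower.toAlgHom B Bs K
  have hj : Function.Injective j := IsFractionRing.injective Bs K
  have hr : ∀ x, e x ∈ j.range := by
    have h1 : Algebra.adjoin B (S : Set E) ≤ j.range.comap e := by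
      refine Algebra.adjoin_le fun x hx => ?_
      obtain ⟨a, ha⟩ := hsS (e x) (Finset.mem_image_of_mem _ hx)
      refine ⟨IsLocalization.mk' Bs a ⟨s, Submonoid.mem_powers s⟩, ?_⟩
      have h2 : s • IsLocalization.mk' Bs a ⟨s, Submonoid.mem_powers s⟩ = algebraMap B Bs a := by
        rw [Algebra.smul_def]
        exact IsLocalization.mk'_spec' Bs a ⟨s, Submonoid.mem_powers s⟩
      have h3 : algebraMap B K s ≠ 0 := fun h => hs0 (IsFractionRing.injective B K (by rw [h, map_zero]))
      refine mul_left_cancel₀ h3 ?_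
      rw [← Algebra.smul_def, ← Algebra.smul_def]
      refine (map_smul j s _).symm.trans ?_
      rw [h2]
      exact (j.commutes a).trans ha
    rw [hS] at h1
    exact fun x => h1 trivial
  exact ⟨s, hs0, ⟨(AlgEquiv.ofInjective j hj).symm.toAlgHom.comp (e.codRestrict j.range hr)⟩⟩

end

end Jets
end

/-! ### Alternatives over a dense open subset of the base. -/

noncomputable section
namespace Jets

section
variable {k : Type u} [Field k] {R : Type u} [CommRing R] [Algebra k R] {m p : ℕ}

/-- Over a dense open subset of the base, either no jet of the family can be lifted or the family
has a lift. -/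
lemma exists_lift_or_forall_not [Algebra.FiniteType k R] {B : Type u} [CommRing B] [IsDomain B]
    [Algebra k B] (h : p ≤ m) (hm : m ≤ 2 * p + 1) (φ : R →ₐ[k] TruncPoly B p) :
    ∃ s : B, s ≠ 0 ∧
      ((∀ χ : B →ₐ[k] k, χ s ≠ 0 → ¬ ∃ ψ : R →ₐ[k] TruncPoly k m,
        (TruncPoly.truncₐ k k h).comp ψ = (TruncPoly.mapₐ p χ).comp φ) ∨
      ∃ ψ : R →ₐ[k] TruncPoly (Localization.Away s) m, (TruncPoly.truncₐ k _ h).comp ψ =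
        (TruncPoly.mapₐ p (IsScalarTower.toAlgHom k B (Localization.Away s))).comp φ) := by
  obtain ⟨E, _, _, _, _, _, Ψ, hΨ, hE⟩ := exists_lift_algebra h φ
  -- If `B → E` is injective, the generic fiber `A` is nonzero and hence has a `K`-linear retraction
  -- onto `K`. The universal lift over `A` then yields a lift over `K`, that is, a point of the
  -- generic fiber, which spreads out. Otherwise some `s ≠ 0` vanishes in `E`, and no jet over a
  -- point with `s ≠ 0` lifts.
  by_cases hinj : Function.Injective (algebraMap B E)
  · let K := FractionRing B
    let A := K ⊗[B] E
    let iE : E →ₐ[k] A := (Algebra.TensorProduct.includeRight : E →ₐ[B] A).restrictScalars k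
    have hi : iE.comp (IsScalarTower.toAlgHom k B E) =
        (IsScalarTower.toAlgHom k K A).comp (IsScalarTower.toAlgHom k B K) :=
      AlgHom.ext fun b => ((Algebra.TensorProduct.includeRight : E →ₐ[B] A).commutes b).trans
        (IsScalarTower.algebraMap_apply B K A b)
    have : Nontrivial A := (Algebra.TensorProduct.includeLeft_injective (S := K) hinj :
      Function.Injective (Algebra.TensorProduct.includeLeft : K →ₐ[K] A)).nontrivial
    obtain ⟨τ, hτ⟩ := LinearMap.exists_leftInverse_of_injective (Algebra.linearMap K A)
      (LinearMap.ker_eq_bot.2 (algebraMap K A).injective)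
    have hτ1 : τ 1 = 1 := by simpa using congr($hτ 1)
    obtain ⟨ψ, hψ⟩ := exists_lift_of_retraction hτ1 h hm
      ((TruncPoly.mapₐ p (IsScalarTower.toAlgHom k B K)).comp φ) ((TruncPoly.mapₐ m iE).comp Ψ) (by
        rw [← AlgHom.comp_assoc, ← TruncPoly.mapₐ_truncₐ, AlgHom.comp_assoc, hΨ,
          ← AlgHom.comp_assoc, ← TruncPoly.mapₐ_comp, hi, TruncPoly.mapₐ_comp, AlgHom.comp_assoc])
    obtain ⟨g, hg⟩ := hE K (IsScalarTower.toAlgHom k B K) ψ hψ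
    let e : E →ₐ[B] K := { g with commutes' := fun b => congr($hg b) }
    obtain ⟨s, hs, ⟨e'⟩⟩ := exists_algHom_away e
    refine ⟨s, hs, Or.inr ⟨(TruncPoly.mapₐ m (e'.restrictScalars k)).comp Ψ, ?_⟩⟩
    rw [← AlgHom.comp_assoc, ← TruncPoly.mapₐ_truncₐ, AlgHom.comp_assoc, hΨ, ← AlgHom.comp_assoc,
      ← TruncPoly.mapₐ_comp]
    congr 2
    exact AlgHom.ext e'.commutes
  · rw [injective_iff_map_eq_zero] at hinj
    push Not at hinj
    obtain ⟨s, hs, hs0⟩ := hinj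
    refine ⟨s, hs0, Or.inl ?_⟩
    rintro χ hχ ⟨ψ, hψ⟩
    obtain ⟨g, hg⟩ := hE k χ ψ hψ
    apply hχ
    rw [← hg]
    exact (congrArg g hs).trans (map_zero g)

lemma TruncPoly.exists_eq_t_pow_mul {A : Type u} [CommRing A] (e : ℕ) (x : TruncPoly A m)
    (hx : ∀ i : Fin (m + 1), (i : ℕ) < e → coeff i x = 0) :
    ∃ y, x = t A m ^ e * y ∧ ∀ i : Fin (m + 1), (i : ℕ) = e → coeff 0 y = coeff i x := by
  refine ⟨ofCoeff fun i => if hi : i + e < m + 1 then coeff ⟨i + e, hi⟩ x else 0, ?_, ?_⟩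
  · refine ext_coeff fun i => ?_
    rw [coeff_t_pow_mul]
    split_ifs with hi
    · rw [coeff_ofCoeff, dif_pos (show (i : ℕ) - e + e < m + 1 by omega)]
      exact coeff_congr (Nat.sub_add_cancel hi).symm x
    · exact hx i (by omega)
  · rintro i rfl
    rw [coeff_ofCoeff, dif_pos (by simp; omega)]
    exact coeff_congr (by simp) x

lemma TruncPoly.isUnit_of_coeff_zero_ne_zero (y : TruncPoly k m) (hy : coeff 0 y ≠ 0) :
    IsUnit y := by
  have h1 : IsNilpotent (y - algebraMap k _ (coeff 0 y)) := ⟨m + 1,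
    isNilpotent_of_aug_eq_zero (k := k) m _ (by
      rw [_root_.map_sub, aug_algebraMap, aug_eq_coeff, sub_self])⟩
  have h2 := (Ne.isUnit hy).map (algebraMap k (TruncPoly k m))
  have h3 := h1.isUnit_add_left_of_commute h2 (Commute.all _ _)
  rwa [add_sub_cancel] at h3

/-- The order of contact in terms of coefficients. -/
lemma map_eq_span_t_pow_iff {e : ℕ} (he : e < p + 1) (I : Ideal R) (φ : R →ₐ[k] TruncPoly k p) :
    I.map φ.toRingHom = Ideal.span {TruncPoly.t k p ^ e} ↔
      (∀ g ∈ I, ∀ i : Fin (p + 1), (i : ℕ) < e → TruncPoly.coeff i (φ g) = 0) ∧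
      ∃ g ∈ I, TruncPoly.coeff ⟨e, he⟩ (φ g) ≠ 0 := by
  have key : ∀ l, (∀ g ∈ I, ∀ i : Fin (p + 1), (i : ℕ) < l → TruncPoly.coeff i (φ g) = 0) ↔
      I.map φ.toRingHom ≤ Ideal.span {TruncPoly.t k p ^ l} := by
    intro l
    rw [Ideal.map_le_iff_le_comap]
    refine forall₂_congr fun g hg => ?_
    rw [Ideal.mem_comap, Ideal.mem_span_singleton]
    constructor
    · intro h
      obtain ⟨y, hy, -⟩ := TruncPoly.exists_eq_t_pow_mul l (φ g) h
      exact ⟨y, hy⟩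
    · rintro ⟨y, hy⟩ i hi
      rw [show φ g = TruncPoly.t k p ^ l * y from hy, TruncPoly.coeff_t_pow_mul, if_neg (by omega)]
  rw [key]
  constructor
  · intro h
    refine ⟨h.le, ?_⟩
    by_contra! hc
    have h1 := (key (e + 1)).1 fun g hg i hi => by
      rcases Nat.lt_succ_iff_lt_or_eq.1 hi with hi | hi
      · exact (key e).2 h.le g hg i hi
      · rw [TruncPoly.coeff_congr (j := ⟨e, he⟩) hi, hc g hg]
    rw [h, Ideal.span_singleton_le_span_singleton] at h1
    have := TruncPoly.le_of_t_pow_dvd (Nat.lt_succ_iff.1 he) h1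
    omega
  · rintro ⟨h, g, hg, hge⟩
    refine le_antisymm h ?_
    rw [Ideal.span_singleton_le_iff_mem]
    obtain ⟨y, hy, hy0⟩ := TruncPoly.exists_eq_t_pow_mul e (φ g) ((key e).2 h g hg)
    have hu := TruncPoly.isUnit_of_coeff_zero_ne_zero y (by rwa [hy0 ⟨e, he⟩ rfl])
    rw [← Ideal.mul_unit_mem_iff_mem _ hu, ← hy]
    exact Ideal.mem_map_of_mem φ.toRingHom hg

/-- Over a dense open subset of the base, either all jets or no jets have a given order of
contact. -/
lemma exists_forall_map_eq_or {B : Type u} [CommRing B] [IsDomain B] [Algebra k B] {e : ℕ}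
    (he : e ≤ p) (I : Ideal R) (φ : R →ₐ[k] TruncPoly B p) :
    ∃ s : B, s ≠ 0 ∧
      ((∀ χ : B →ₐ[k] k, χ s ≠ 0 → I.map ((TruncPoly.mapₐ p χ).comp φ).toRingHom ≠
        Ideal.span {TruncPoly.t k p ^ e}) ∨
      (∀ χ : B →ₐ[k] k, χ s ≠ 0 → I.map ((TruncPoly.mapₐ p χ).comp φ).toRingHom =
        Ideal.span {TruncPoly.t k p ^ e})) := by
  have he' := Nat.lt_succ_of_le he
  have hc : ∀ (χ : B →ₐ[k] k) (g : R) (i : Fin (p + 1)), TruncPoly.coeff i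
      (((TruncPoly.mapₐ p χ).comp φ) g) = χ (TruncPoly.coeff i (φ g)) := fun χ g i => by
    rw [AlgHom.comp_apply, TruncPoly.coeff_mapₐ]
  simp only [Ne, map_eq_span_t_pow_iff he', hc]
  -- The element `s` is a nonzero coefficient that decides the order: one of degree below `e` makes
  -- the order of contact too small, and if those all vanish, one of degree `e` makes it equal to
  -- `e`. If degree `e` vanishes as well, the order is never `e`.
  by_cases h1 : ∀ g ∈ I, ∀ i : Fin (p + 1), (i : ℕ) < e → TruncPoly.coeff i (φ g) = 0
  · by_cases h2 : ∃ g ∈ I, TruncPoly.coeff ⟨e, he'⟩ (φ g) ≠ 0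
    · obtain ⟨g, hg, hge⟩ := h2
      exact ⟨_, hge, Or.inr fun χ hχ =>
        ⟨fun g hg i hi => by rw [h1 g hg i hi, map_zero], g, hg, hχ⟩⟩
    · push Not at h2
      refine ⟨1, one_ne_zero, Or.inl ?_⟩
      rintro χ - ⟨-, g, hg, hge⟩
      exact hge (by rw [h2 g hg, map_zero])
  · push Not at h1
    obtain ⟨g, hg, i, hi, hgi⟩ := h1
    exact ⟨_, hgi, Or.inl fun χ hχ h => hχ (h.1 g hg i hi)⟩

end

end Jets
end

/-! ### Trivialization over a dense open subset. -/

noncomputable section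
namespace Jets

section
variable {k : Type u} [Field k]

lemma exists_algHom_of_finiteType [IsAlgClosed k] (B : Type u) [CommRing B] [Nontrivial B]
    [Algebra k B] [Algebra.FiniteType k B] : Nonempty (B →ₐ[k] k) := by
  obtain ⟨M, hM⟩ := Ideal.exists_maximal B
  let : Field (B ⧸ M) := Ideal.Quotient.field M
  have : Module.Finite k (B ⧸ M) := finite_of_finite_type_of_isJacobsonRing k (B ⧸ M)
  let e := AlgEquiv.ofBijective (Algebra.ofId k (B ⧸ M))
    IsAlgClosed.algebraMap_bijective_of_isIntegral
  exact ⟨e.symm.toAlgHom.comp (Ideal.Quotient.mkₐ k M)⟩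

variable {B : Type u} [CommRing B] [Algebra k B]

lemma isOpenImmersion_away (s : B) :
    IsOpenImmersion (specOverMap (IsScalarTower.toAlgHom k B (Localization.Away s))).left :=
  inferInstanceAs (IsOpenImmersion (Spec.map (CommRingCat.ofHom
    (algebraMap B (Localization.Away s)))))

lemma algHom_away_ne_zero {C : Type u} [CommRing C] [Nontrivial C] [Algebra k C] {s : B}
    (χ : Localization.Away s →ₐ[k] C) :
    (χ.comp (IsScalarTower.toAlgHom k B (Localization.Away s))) s ≠ 0 :=
  ((IsLocalization.Away.algebraMap_isUnit s).map χ).ne_zero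

lemma isDomain_away [IsDomain B] {s : B} (hs : s ≠ 0) : IsDomain (Localization.Away s) :=
  IsLocalization.isDomain_localization (powers_le_nonZeroDivisors_of_noZeroDivisors hs)

lemma finiteType_away [Algebra.FiniteType k B] (s : B) :
    Algebra.FiniteType k (Localization.Away s) :=
  have : Algebra.FiniteType B (Localization.Away s) :=
    IsLocalization.finiteType_of_monoid_fg (Submonoid.powers s) _
  Algebra.FiniteType.trans (S := B) inferInstance inferInstance

variable [IsDomain B] [Algebra.FiniteType k B]

variable [IsAlgClosed k] {X : SchOver k} {U : X.left.Opens} {m p : ℕ}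

/-- A family of jets becomes, over a dense open subset of the base, either disjoint from the
image of the contact locus or a base of a trivial bundle of jets of higher order. -/
lemma exists_dense_trivial [LocallyOfFiniteType X.hom] {n e : ℕ} (hU : IsAffineOpen U)
    (hX : ∀ (q : ℕ) (g : Fin q → Ω[Γ(X.left, U)⁄k]),
      Submodule.span Γ(X.left, U) (Set.range g) = ⊤ →
      fittingSpan (n - 1 : ℤ) g = (⊥ : Ideal Γ(X.left, U)))
    (h : p ≤ m) (hm : m ≤ 2 * p) (he : p + e ≤ m) (φ : Γ(X.left, U) →ₐ[k] TruncPoly B p) :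
    ∃ (B' : Type u) (_ : CommRing B') (_ : IsDomain B') (_ : Algebra k B')
      (_ : Algebra.FiniteType k B') (i : B →ₐ[k] B'), IsOpenImmersion (specOverMap i).left ∧
      ((∀ χ : B' →ₐ[k] k, ¬ ((fittingIdeal Γ(X.left, U) Ω[Γ(X.left, U)⁄k] n).map
          ((TruncPoly.mapₐ p (χ.comp i)).comp φ).toRingHom = Ideal.span {TruncPoly.t k p ^ e} ∧
        ∃ ψ : Γ(X.left, U) →ₐ[k] TruncPoly k m,
          (TruncPoly.truncₐ k k h).comp ψ = (TruncPoly.mapₐ p (χ.comp i)).comp φ)) ∨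
      (∀ χ : B' →ₐ[k] k, (fittingIdeal Γ(X.left, U) Ω[Γ(X.left, U)⁄k] n).map
          ((TruncPoly.mapₐ p (χ.comp i)).comp φ).toRingHom = Ideal.span {TruncPoly.t k p ^ e}) ∧
      ∃ q : specOver k (MvPolynomial (Fin ((m - p) * n + e)) B') ⟶ jetScheme X m,
        IsPullback q (affineProj k B' ((m - p) * n + e)) (jetProj X h)
          (affJet hU ((TruncPoly.mapₐ p i).comp φ))) := by
  have := finiteType_sections hU
  -- Three successive localizations: the first settles the order of contact, the second the
  -- existence of a lift, and the third makes the reduced differentials free.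
  obtain ⟨s₁, hs₁, H₁⟩ := exists_forall_map_eq_or (show e ≤ p by omega)
    (fittingIdeal Γ(X.left, U) Ω[Γ(X.left, U)⁄k] n) φ
  let B₁ := Localization.Away s₁
  have := isDomain_away hs₁
  have := finiteType_away (k := k) s₁
  let i₁ : B →ₐ[k] B₁ := IsScalarTower.toAlgHom k B B₁
  have o₁ : IsOpenImmersion (specOverMap i₁).left := isOpenImmersion_away s₁
  rcases H₁ with H₁ | H₁
  · exact ⟨B₁, inferInstance, inferInstance, inferInstance, inferInstance, i₁, o₁,
      Or.inl fun χ hχ => H₁ _ (algHom_away_ne_zero χ) hχ.1⟩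
  let φ₁ := (TruncPoly.mapₐ p i₁).comp φ
  obtain ⟨s₂, hs₂, H₂⟩ := exists_lift_or_forall_not h (by omega) φ₁
  let B₂ := Localization.Away s₂
  have := isDomain_away hs₂
  have := finiteType_away (k := k) s₂
  let i₂ : B₁ →ₐ[k] B₂ := IsScalarTower.toAlgHom k B₁ B₂
  have o₂ : IsOpenImmersion (specOverMap i₂).left := isOpenImmersion_away s₂
  have hcomp : ∀ {C : Type u} [CommRing C] [Algebra k C] (χ : B₁ →ₐ[k] C),
      (TruncPoly.mapₐ p (χ.comp i₁)).comp φ = (TruncPoly.mapₐ p χ).comp φ₁ := fun χ => by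
    rw [TruncPoly.mapₐ_comp, AlgHom.comp_assoc]
  rcases H₂ with H₂ | ⟨ψ, hψ⟩
  · refine ⟨B₂, inferInstance, inferInstance, inferInstance, inferInstance, i₂.comp i₁, ?_,
      Or.inl fun χ hχ => H₂ _ (algHom_away_ne_zero χ) ?_⟩
    · rw [specOverMap_comp]
      exact MorphismProperty.comp_mem @IsOpenImmersion _ _ o₂ o₁
    · rw [← hcomp]
      exact hχ.2
  obtain ⟨s₃, hs₃, d, lam, hlam⟩ := JetDiffQuot.exists_isCoordinates ψ (m - p)
  let B₃ := Localization.Away s₃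
  have := isDomain_away hs₃
  have := finiteType_away (k := k) s₃
  let i₃ : B₂ →ₐ[k] B₃ := IsScalarTower.toAlgHom k B₂ B₃
  have o₃ : IsOpenImmersion (specOverMap i₃).left := isOpenImmersion_away s₃
  have hφ : ∀ {C : Type u} [CommRing C] [Algebra k C] (χ : B₃ →ₐ[k] C),
      (TruncPoly.mapₐ p (χ.comp (i₃.comp (i₂.comp i₁)))).comp φ =
        (TruncPoly.mapₐ p (χ.comp i₃)).comp ((TruncPoly.truncₐ k _ h).comp ψ) := fun χ => by
    rw [hψ, ← AlgHom.comp_assoc, ← AlgHom.comp_assoc, hcomp, TruncPoly.mapₐ_comp,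
      AlgHom.comp_assoc]
  have hcont : ∀ χ : B₃ →ₐ[k] k, (fittingIdeal Γ(X.left, U) Ω[Γ(X.left, U)⁄k] n).map
      ((TruncPoly.mapₐ p (χ.comp (i₃.comp (i₂.comp i₁)))).comp φ).toRingHom =
        Ideal.span {TruncPoly.t k p ^ e} := fun χ =>
    H₁ (χ.comp (i₃.comp (i₂.comp i₁))) (algHom_away_ne_zero ((χ.comp i₃).comp i₂))
  have hd : d = (m - p) * n + e := by
    -- The number of coordinates is constant on the family, so evaluating it at one `k`-point is
    -- enough; there the Fitting ideal computation applies.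
    obtain ⟨χ⟩ := exists_algHom_of_finiteType (k := k) B₃
    rw [← hlam.finrank_eq χ]
    refine finrank_jetDiffQuot hX h hm he _ ?_
    rw [← hcont χ, hφ, ← AlgHom.comp_assoc, ← AlgHom.comp_assoc, TruncPoly.mapₐ_truncₐ]
  subst hd
  refine ⟨B₃, inferInstance, inferInstance, inferInstance, inferInstance, i₃.comp (i₂.comp i₁), ?_,
    Or.inr ⟨hcont, ?_⟩⟩
  · rw [specOverMap_comp, specOverMap_comp]
    exact MorphismProperty.comp_mem @IsOpenImmersion _ _ o₃
      (MorphismProperty.comp_mem @IsOpenImmersion _ _ o₂ o₁)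
  · obtain ⟨q, hq⟩ := exists_isPullback_affineProj hU h (by omega) ψ i₃ lam hlam
    have h1 := hφ (AlgHom.id k B₃)
    rw [AlgHom.id_comp, AlgHom.id_comp] at h1
    rw [h1]
    exact ⟨q, hq⟩

end

end Jets
end

/-! ### Piecewise trivial fibrations by Noetherian induction. -/

noncomputable section
namespace Jets

section
variable {k : Type u} [Field k]

/-- The product of an affine scheme with an affine space. -/
lemma exists_iso_tensor_affineSpace (B : Type u) [CommRing B] [Algebra k B] (d : ℕ) :
    ∃ φ : specOver k (MvPolynomial (Fin d) B) ≅ specOver k B ⊗ affineSpace k d,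
      φ.hom ≫ fst _ _ = affineProj k B d := by
  let c : MvPolynomial (Fin d) k →ₐ[k] MvPolynomial (Fin d) B := MvPolynomial.aeval MvPolynomial.X
  let w : specOver k (MvPolynomial (Fin d) B) ⟶ specOver k B ⊗ affineSpace k d :=
    lift (affineProj k B d) (specOverMap c)
  have hw : IsIso w := by
    refine isIso_of_affine w fun C _ _ z => ?_
    obtain ⟨f, hf⟩ := specOverMap_surjective (z ≫ fst _ _)
    obtain ⟨g, hg⟩ := specOverMap_surjective (z ≫ snd _ _)
    let r : MvPolynomial (Fin d) B →ₐ[k] C :=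
      { MvPolynomial.eval₂Hom f.toRingHom fun j => g (MvPolynomial.X j) with
        commutes' := fun a => by
          change MvPolynomial.eval₂Hom f.toRingHom _ (MvPolynomial.C (algebraMap k B a)) = _
          rw [MvPolynomial.eval₂Hom_C]
          exact f.commutes a }
    have hrX : ∀ j, r (MvPolynomial.X j) = g (MvPolynomial.X j) :=
      fun j => MvPolynomial.eval₂Hom_X' _ _ _
    have hrC : r.comp (IsScalarTower.toAlgHom k B _) = f :=
      AlgHom.ext fun a => MvPolynomial.eval₂Hom_C _ _ _
    have hrc : r.comp c = g := MvPolynomial.algHom_ext fun j => by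
      rw [AlgHom.comp_apply, MvPolynomial.aeval_X, hrX]
    refine ⟨specOverMap r, ?_, fun y hy => ?_⟩
    · apply CartesianMonoidalCategory.hom_ext
      · rw [Category.assoc, lift_fst, ← specOverMap_comp, hrC, hf]
      · rw [Category.assoc, lift_snd, ← specOverMap_comp, hrc, hg]
    · obtain ⟨r', rfl⟩ := specOverMap_surjective y
      have h1 : r'.comp (IsScalarTower.toAlgHom k B _) = f := by
        apply specOverMap_injective
        rw [specOverMap_comp, ← hf, ← hy, Category.assoc, lift_fst]
      have h2 : r'.comp c = g := by
        apply specOverMap_injective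
        rw [specOverMap_comp, ← hg, ← hy, Category.assoc, lift_snd]
      congr 1
      apply AlgHom.coe_ringHom_injective
      apply MvPolynomial.ringHom_ext
      · intro a
        exact congr($(h1.trans hrC.symm) a)
      · intro j
        have h3 := congr($(h2.trans hrc.symm) (MvPolynomial.X j))
        rwa [AlgHom.comp_apply, AlgHom.comp_apply, MvPolynomial.aeval_X] at h3
  exact ⟨asIso w, lift_fst _ _⟩

/-- The underlying point of a `k`-valued point. -/
def KPoint.pt {Y : SchOver k} (x : KPoint Y) : Y.left :=
  ((unitSpec k).inv ≫ x).left (⊥ : PrimeSpectrum k)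

variable [IsAlgClosed k]

/-- The fiber of `i` over `x` is nonempty and locally of finite type over `k`, so it has a closed
point, which is rational because `k` is algebraically closed. -/
lemma exists_kPoint_of_pt_mem_range {T Y : SchOver k} (i : T ⟶ Y) [LocallyOfFiniteType i.left]
    (x : KPoint Y) (hx : x.pt ∈ Set.range i.left) : ∃ y : KPoint T, y ≫ i = x := by
  obtain ⟨t, ht⟩ := hx
  let x' : Spec (CommRingCat.of k) ⟶ Y.left := ((unitSpec k).inv ≫ x).left
  obtain ⟨z, -⟩ := Scheme.Pullback.exists_preimage_pullback (f := i.left) (g := x') t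
    (⊥ : PrimeSpectrum k) ht
  have : JacobsonSpace ↥(pullback i.left x') :=
    LocallyOfFiniteType.jacobsonSpace (pullback.snd i.left x')
  obtain ⟨c, -, hc⟩ := nonempty_inter_closedPoints (X := ↥(pullback i.left x')) (Z := Set.univ)
    ⟨z, trivial⟩ isClosed_univ.isLocallyClosed
  let w := pointOfClosedPoint (pullback.snd i.left x') c hc
  have hw : w ≫ pullback.snd i.left x' = 𝟙 _ := pointOfClosedPoint_comp _ _ _
  have hwx : (w ≫ pullback.fst i.left x') ≫ i.left = x' := by
    rw [Category.assoc, pullback.condition, ← Category.assoc, hw, Category.id_comp]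
  let y : specOver k k ⟶ T := Over.homMk (w ≫ pullback.fst i.left x') (by
    rw [← Over.w i, ← Category.assoc, hwx]
    exact Over.w ((unitSpec k).inv ≫ x))
  have hy : y ≫ i = (unitSpec k).inv ≫ x := Over.OverMorphism.ext hwx
  exact ⟨(unitSpec k).hom ≫ y, by rw [Category.assoc, hy, Iso.hom_inv_id_assoc]⟩

/-- Reduces disjointness and unions of sets of `k`-points to statements about subsets of the
underlying space. -/
lemma ReducedLocallyClosed.mem_points_iff {V : SchOver k} (T : ReducedLocallyClosed V)
    (x : KPoint V) : x ∈ T.points ↔ x.pt ∈ Set.range T.ι.left := by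
  have := T.immersion
  constructor
  · rintro ⟨y, rfl⟩
    exact ⟨y.pt, rfl⟩
  · intro hx
    obtain ⟨y, hy⟩ := exists_kPoint_of_pt_mem_range T.ι x hx
    exact ⟨y, hy⟩

/-- Noetherian induction for piecewise trivial fibrations. -/
lemma isPiecewiseTrivial_of_forall_isClosed {V' V F : SchOver k}
    [TopologicalSpace.NoetherianSpace V.left] {g : V' ⟶ V} {W' : Set (KPoint V')}
    {W : Set (KPoint V)} (hW : ∀ x ∈ W', x ≫ g ∈ W)
    (key : ∀ Z : Set V.left, IsClosed Z → Z.Nonempty → ∃ (T : ReducedLocallyClosed V)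
      (O : Set V.left), IsOpen O ∧ (Z ∩ O).Nonempty ∧ Set.range T.ι.left = Z ∩ O ∧
      (Disjoint T.points W ∨ T.points ⊆ W ∧
        ∃ Q : ReducedLocallyClosed V', Q.points = {x | x ∈ W' ∧ x ≫ g ∈ T.points} ∧
          ∃ φ : Q.obj ≅ T.obj ⊗ F, φ.hom ≫ fst T.obj F ≫ T.ι = Q.ι ≫ g)) :
    IsPiecewiseTrivial g W' W F := by
  refine ⟨hW, ?_⟩
  have ind : ∀ Z : TopologicalSpace.Closeds V.left,
      ∃ (r : ℕ) (T : Fin r → ReducedLocallyClosed V),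
        (∀ i j, i ≠ j → Disjoint (T i).points (T j).points) ∧
        (⋃ i, (T i).points) = {x | x ∈ W ∧ x.pt ∈ Z} ∧
        ∀ i, ∃ Q : ReducedLocallyClosed V', Q.points = {x | x ∈ W' ∧ x ≫ g ∈ (T i).points} ∧
          ∃ φ : Q.obj ≅ (T i).obj ⊗ F, φ.hom ≫ fst (T i).obj F ≫ (T i).ι = Q.ι ≫ g := by
    intro Z
    induction Z using WellFoundedLT.induction with
    | ind Z ih =>
    by_cases hZ : (Z : Set V.left).Nonempty
    · obtain ⟨T, O, hO, ⟨z, hzZ, hzO⟩, hTr, hT⟩ := key Z Z.isClosed hZ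
      -- The piece `Z ∩ O` is split off and the induction continues on the rest. It joins the
      -- decomposition if it lies in `W`, and is dropped if it is disjoint from `W`.
      let Z' : TopologicalSpace.Closeds V.left := ⟨Z ∩ Oᶜ, Z.isClosed.inter hO.isClosed_compl⟩
      have hZ' : Z' < Z := by
        refine lt_of_le_of_ne (fun x hx => hx.1) fun h => ?_
        have h1 : z ∈ Z' := h ▸ hzZ
        exact h1.2 hzO
      have hTp : ∀ x, x ∈ T.points ↔ x.pt ∈ Z ∧ x.pt ∈ O := fun x => by
        rw [T.mem_points_iff, hTr]
        rfl
      have hZ'p : ∀ x : KPoint V, x.pt ∈ Z' ↔ x.pt ∈ Z ∧ x.pt ∉ O := fun x => Iff.rfl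
      obtain ⟨r, T', hd, hU, htriv⟩ := ih Z' hZ'
      have hT' : ∀ i x, x ∈ (T' i).points → x ∈ W ∧ x.pt ∈ Z' := fun i x hx => by
        have h1 : x ∈ ⋃ i, (T' i).points := Set.mem_iUnion.2 ⟨i, hx⟩
        rw [hU] at h1
        exact h1
      rcases hT with hT | ⟨hTW, hQ⟩
      · refine ⟨r, T', hd, hU.trans (Set.ext fun x => and_congr_right fun hx => ?_), htriv⟩
        rw [hZ'p, and_iff_left_iff_imp]
        exact fun h1 h2 => Set.disjoint_left.1 hT ((hTp x).2 ⟨h1, h2⟩) hx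
      · refine ⟨r + 1, Fin.cons T T', ?_, ?_, ?_⟩
        · have h0 : ∀ i, Disjoint T.points (T' i).points := fun i =>
            Set.disjoint_left.2 fun x hx hx' => (hT' i x hx').2.2 ((hTp x).1 hx).2
          intro i j
          induction i using Fin.cases with
          | zero =>
            induction j using Fin.cases with
            | zero => exact fun h => absurd rfl h
            | succ j => exact fun _ => h0 j
          | succ i =>
            induction j using Fin.cases with
            | zero => exact fun _ => (h0 i).symm
            | succ j => exact fun h => hd i j fun hij => h (by rw [hij])
        · ext x
          rw [Set.mem_iUnion, Fin.exists_fin_succ]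
          constructor
          · rintro (hx | ⟨i, hx⟩)
            · exact ⟨hTW hx, ((hTp x).1 hx).1⟩
            · exact ⟨(hT' i x hx).1, (hT' i x hx).2.1⟩
          · rintro ⟨hxW, hxZ⟩
            by_cases hxO : x.pt ∈ O
            · exact Or.inl ((hTp x).2 ⟨hxZ, hxO⟩)
            · have h1 : x ∈ ⋃ i, (T' i).points := hU ▸ ⟨hxW, hxZ, hxO⟩
              exact Or.inr (Set.mem_iUnion.1 h1)
        · intro i
          induction i using Fin.cases with
          | zero => exact hQ
          | succ i => exact htriv i
    · refine ⟨0, Fin.elim0, fun i => i.elim0, ?_, fun i => i.elim0⟩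
      rw [Set.iUnion_of_empty]
      refine (Set.eq_empty_of_forall_notMem fun x hx => hZ ⟨_, hx.2⟩).symm
  obtain ⟨r, T, hd, hU, htriv⟩ := ind ⊤
  refine ⟨r, T, hd, hU.trans (Set.ext fun x => and_iff_left trivial), htriv⟩

end

end Jets
end

/-! ### Piecewise triviality of the projections of jet schemes. -/

noncomputable section
namespace Jets

section
variable {k : Type u} [Field k]

/-- Every nonempty closed subset of an affine scheme of finite type has a nonempty open subset
which is the spectrum of a domain of finite type. -/
lemma exists_domain_chart {H : Type u} [CommRing H] [Algebra k H] [Algebra.FiniteType k H]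
    {Z : Set (PrimeSpectrum H)} (hZ : IsClosed Z) (hZ' : Z.Nonempty) :
    ∃ (D : Type u) (_ : CommRing D) (_ : IsDomain D) (_ : Algebra k D) (_ : Algebra.FiniteType k D)
      (π : H →ₐ[k] D), IsImmersion (specOverMap π).left ∧
      ∃ O : Set (PrimeSpectrum H), IsOpen O ∧ Set.range (PrimeSpectrum.comap π.toRingHom) = Z ∩ O := by
  classical
  have : IsNoetherianRing H := Algebra.FiniteType.isNoetherianRing k H
  obtain ⟨I, rfl⟩ := (PrimeSpectrum.isClosed_iff_zeroLocus_ideal Z).1 hZ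
  obtain ⟨Q₀, hQ₀⟩ := hZ'
  obtain ⟨P, hP, -⟩ := Ideal.exists_minimalPrimes_le (I := I) (J := Q₀.asIdeal) hQ₀
  have hPp : P.IsPrime := hP.1.1
  have hfin := I.finite_minimalPrimes_of_isNoetherianRing H
  let S := hfin.toFinset.erase P
  -- Prime avoidance gives `h` in all minimal primes of `I` other than `P` and not in `P`. Within
  -- the open set where `h` does not vanish, `Z` coincides with the irreducible closed set defined
  -- by `P`.
  obtain ⟨h, hhS, hhP⟩ : ∃ h ∈ S.inf id, h ∉ P := by
    by_contra! hc
    obtain ⟨P', hP', hle⟩ := hPp.inf_le'.1 (show S.inf id ≤ P from hc)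
    rw [Finset.mem_erase, Set.Finite.mem_toFinset] at hP'
    exact hP'.1 (le_antisymm hle (hP.2 hP'.2.1 hle))
  let D := H ⧸ P
  let s : D := Ideal.Quotient.mk P h
  have hs : s ≠ 0 := fun h0 => hhP (Ideal.Quotient.eq_zero_iff_mem.1 h0)
  let q : H →ₐ[k] D := Ideal.Quotient.mkₐ k P
  let i : D →ₐ[k] Localization.Away s := IsScalarTower.toAlgHom k D _
  have hq : IsClosedImmersion (specOverMap q).left :=
    IsClosedImmersion.spec_of_surjective _ Ideal.Quotient.mk_surjective
  have hi : IsOpenImmersion (specOverMap i).left := isOpenImmersion_away s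
  refine ⟨Localization.Away s, inferInstance, isDomain_away hs, inferInstance, finiteType_away s,
    i.comp q, ?_, PrimeSpectrum.basicOpen h, (PrimeSpectrum.basicOpen h).2, ?_⟩
  · rw [specOverMap_comp]
    exact IsImmersion.comp (specOverMap i).left (specOverMap q).left
  · have h1 : Set.range (PrimeSpectrum.comap (i.comp q).toRingHom) =
        PrimeSpectrum.comap (Ideal.Quotient.mk P) '' (PrimeSpectrum.basicOpen s) := by
      rw [← PrimeSpectrum.localization_away_comap_range (Localization.Away s) s, ← Set.range_comp]
      rfl
    have h2 : ∀ Q : PrimeSpectrum H, P ≤ Q.asIdeal ↔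
        Q ∈ Set.range (PrimeSpectrum.comap (Ideal.Quotient.mk P)) := fun Q => by
      rw [range_comap_of_surjective _ _ Ideal.Quotient.mk_surjective, Ideal.mk_ker]
      rfl
    rw [h1]
    ext Q
    constructor
    · rintro ⟨Q', hQ', rfl⟩
      exact ⟨hP.1.2.trans ((h2 _).2 ⟨Q', rfl⟩), hQ'⟩
    · rintro ⟨hQ, hQh⟩
      obtain ⟨P', hP', hle⟩ := Ideal.exists_minimalPrimes_le (I := I) (J := Q.asIdeal) hQ
      have hPQ : P ≤ Q.asIdeal := by
        by_cases hPP : P' = P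
        · exact hPP ▸ hle
        · have h3 : P' ∈ S := Finset.mem_erase.2 ⟨hPP, hfin.mem_toFinset.2 hP'⟩
          exact absurd (hle (Finset.inf_le (f := id) h3 hhS)) hQh
      obtain ⟨Q', rfl⟩ := (h2 Q).1 hPQ
      exact ⟨Q', hQh, rfl⟩

end

section

lemma exists_isOpen_range_comp {A B C D : Type*} [TopologicalSpace A] [TopologicalSpace B]
    [TopologicalSpace C] [TopologicalSpace D] {j : C → D} (hj : Topology.IsOpenEmbedding j)
    {c : B → C} (hc : Topology.IsInducing c) {i : A → B} (hi : Topology.IsOpenEmbedding i) {Z : Set D}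
    {O : Set C} (hO : IsOpen O) (h : Set.range c = j ⁻¹' Z ∩ O) :
    ∃ O' : Set D, IsOpen O' ∧ Set.range (j ∘ c ∘ i) = Z ∩ O' := by
  obtain ⟨O₁, hO₁, h1⟩ := hc.isOpen_iff.1 hi.isOpen_range
  refine ⟨j '' (O ∩ O₁), hj.isOpenMap _ (hO.inter hO₁), ?_⟩
  rw [Set.range_comp, Set.range_comp, ← h1, Set.image_preimage_eq_inter_range, h,
    ← Set.image_preimage_inter]
  congr 1
  ext x
  simp only [Set.mem_inter_iff, Set.mem_preimage]
  tauto

variable {k : Type u} [Field k] {X : SchOver k} {m p : ℕ}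

lemma range_left_comp {A B C D : SchOver k} (i : A ⟶ B) (c : B ⟶ C) (j : C ⟶ D) :
    Set.range (i ≫ c ≫ j).left = Set.range (j.left ∘ c.left ∘ i.left) := rfl

lemma isImmersion_left_comp {A B C : SchOver k} (i : A ⟶ B) (j : B ⟶ C) (hi : IsImmersion i.left)
    (hj : IsImmersion j.left) : IsImmersion (i ≫ j).left :=
  IsImmersion.comp i.left j.left

/-- By `hW` the part of `W'` over `S` is the whole preimage of `S`. The fiber product, being
reduced, carries its reduced structure. -/
lemma exists_reducedLocallyClosed_of_isPullback {V' V P S F : SchOver k} {g : V' ⟶ V} {ι : S ⟶ V}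
    (hS : IsReduced S.left) (hι : IsImmersion ι.left) {q : P ⟶ V'} {a : P ⟶ S}
    (hq : IsPullback q a g ι) (hP : IsReduced P.left) (θ : P ≅ S ⊗ F) (hθ : θ.hom ≫ fst _ _ = a)
    {W' : Set (KPoint V')} {W : Set (KPoint V)} (hSW : ∀ y : KPoint S, y ≫ ι ∈ W)
    (hW : ∀ x, x ≫ g ∈ W → x ∈ W') :
    let T : ReducedLocallyClosed V := ⟨S, ι, hS, hι⟩
    T.points ⊆ W ∧
      ∃ Q : ReducedLocallyClosed V', Q.points = {x | x ∈ W' ∧ x ≫ g ∈ T.points} ∧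
        ∃ φ : Q.obj ≅ T.obj ⊗ F, φ.hom ≫ fst T.obj F ≫ T.ι = Q.ι ≫ g := by
  intro T
  have hTW : T.points ⊆ W := by
    rintro _ ⟨y, rfl⟩
    exact hSW y
  have hqi : IsImmersion q.left :=
    MorphismProperty.of_isPullback (P := @IsImmersion) (hq.map (Over.forget _)).flip hι
  refine ⟨hTW, ⟨P, q, hP, hqi⟩, ?_, θ, ?_⟩
  · ext x
    constructor
    · rintro ⟨y, rfl⟩
      have h1 : (y ≫ q) ≫ g ∈ T.points :=
        ⟨y ≫ a, by
          change (y ≫ a) ≫ ι = _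
          rw [Category.assoc, Category.assoc, hq.w]⟩
      exact ⟨hW _ (hTW h1), h1⟩
    · rintro ⟨-, y, hy⟩
      exact ⟨hq.lift x y hy.symm, hq.lift_fst _ _ _⟩
  · change θ.hom ≫ fst S F ≫ ι = q ≫ g
    rw [← Category.assoc, hθ, hq.w]

lemma exists_section_affineProj (B : Type u) [CommRing B] [Algebra k B] (d : ℕ) :
    ∃ σ : specOver k B ⟶ specOver k (MvPolynomial (Fin d) B), σ ≫ affineProj k B d = 𝟙 _ := by
  let s : MvPolynomial (Fin d) B →ₐ[k] B :=
    (MvPolynomial.aeval (R := B) fun _ => (0 : B)).restrictScalars k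
  refine ⟨specOverMap s, ?_⟩
  rw [← specOverMap_comp, ← specOverMap_id]
  congr 1
  exact AlgHom.ext fun b => (MvPolynomial.aeval (R := B) fun _ => (0 : B)).commutes b

lemma isReduced_specOver (B : Type u) [CommRing B] [IsDomain B] [Algebra k B] :
    IsReduced (specOver k B).left :=
  inferInstanceAs (IsReduced (Spec (CommRingCat.of B)))

lemma kPoint_comp_affJet {B : Type u} [CommRing B] [Algebra k B] {U : X.left.Opens}
    {hU : IsAffineOpen U} {φ : Γ(X.left, U) →ₐ[k] TruncPoly B p} (y : KPoint (specOver k B)) :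
    ∃ χ : B →ₐ[k] k, (unitSpec k).inv ≫ y = specOverMap χ ∧
      (unitSpec k).inv ≫ y ≫ affJet hU φ = affJet hU ((TruncPoly.mapₐ p χ).comp φ) := by
  obtain ⟨χ, hχ⟩ := specOverMap_surjective ((unitSpec k).inv ≫ y)
  exact ⟨χ, hχ, by rw [← Category.assoc, hχ, specOverMap_comp_affJet]⟩

/-- Over the contact locus of the Jacobian ideal the projection between jet schemes is a piecewise
trivial fibration. -/
theorem isPiecewiseTrivial_jetProj [IsAlgClosed k] [LocallyOfFiniteType X.hom]
    [QuasiCompact X.hom] {n e : ℕ}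
    (hX : ∀ U : X.left.Opens, IsAffineOpen U → ∀ (q : ℕ) (g : Fin q → Ω[Γ(X.left, U)⁄k]),
      Submodule.span Γ(X.left, U) (Set.range g) = ⊤ →
      fittingSpan (n - 1 : ℤ) g = (⊥ : Ideal Γ(X.left, U)))
    (h : p ≤ m) (hm : m ≤ 2 * p) (he : p + e ≤ m) :
    IsPiecewiseTrivial (jetProj X h) (contactLocus (jacobianIdeal X n) e m)
      (contactLocus (jacobianIdeal X n) e p ∩
        Set.range fun δ : KPoint (jetScheme X m) => δ ≫ jetProj X h)
      (affineSpace k ((m - p) * n + e)) := by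
  have hep : e ≤ p := by omega
  have := noetherianSpace_jetScheme X p
  refine isPiecewiseTrivial_of_forall_isClosed
    (fun x hx => ⟨(mem_contactLocus_iff_proj n h hep x).2 hx, x, rfl⟩) fun Z hZ ⟨z, hz⟩ => ?_
  obtain ⟨U, hU, hzU, -⟩ := exists_isAffineOpen_mem_and_subset (X := X.left)
    (x := (jetCenter X p).left z) (U := ⊤) trivial
  obtain ⟨H, _, _, _, Φ, hΦ, hΦr⟩ := exists_chart hU p
  let j := affJet hU Φ
  have hjz : ∃ z', j.left z' = z := by
    have h1 : z ∈ Set.range j.left := hΦr.ge hzU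
    exact h1
  obtain ⟨z', hz'⟩ := hjz
  obtain ⟨D, _, _, _, _, π, hπ, O, hO, hπr⟩ := exists_domain_chart (k := k) (H := H)
    (Z := j.left ⁻¹' Z) (hZ.preimage j.left.continuous) ⟨z', by rwa [← hz'] at hz⟩
  let φ := (TruncPoly.mapₐ p π).comp Φ
  obtain ⟨B, _, _, _, _, i, hi, H⟩ := exists_dense_trivial hU (hX U hU) h hm he φ
  have hι : affJet hU ((TruncPoly.mapₐ p i).comp φ) = specOverMap i ≫ specOverMap π ≫ j := by
    rw [specOverMap_comp_affJet, specOverMap_comp_affJet]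
  have himm : IsImmersion (affJet hU ((TruncPoly.mapₐ p i).comp φ)).left := by
    rw [hι]
    exact isImmersion_left_comp _ _ inferInstance (isImmersion_left_comp _ _ hπ inferInstance)
  have hred : IsReduced (specOver k B).left := isReduced_specOver B
  obtain ⟨O', hO', hr⟩ := exists_isOpen_range_comp j.left.isOpenEmbedding
    (specOverMap π).left.isEmbedding.toIsInducing (specOverMap i).left.isOpenEmbedding hO hπr
  rw [← range_left_comp, ← hι] at hr
  have hne : (Z ∩ O').Nonempty := by
    rw [← hr]
    exact ⟨_, Set.mem_range_self (⊥ : PrimeSpectrum B)⟩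
  have hpt : ∀ y : KPoint (specOver k B), ∃ χ : B →ₐ[k] k,
      (unitSpec k).inv ≫ y ≫ affJet hU ((TruncPoly.mapₐ p i).comp φ) =
      affJet hU ((TruncPoly.mapₐ p (χ.comp i)).comp φ) := fun y => by
    obtain ⟨χ, -, hχ⟩ := kPoint_comp_affJet (hU := hU) (φ := (TruncPoly.mapₐ p i).comp φ) y
    exact ⟨χ, by rw [TruncPoly.mapₐ_comp, AlgHom.comp_assoc]; exact hχ⟩
  generalize affJet hU ((TruncPoly.mapₐ p i).comp φ) = ι at H himm hr hpt
  refine ⟨⟨specOver k B, ι, hred, himm⟩, O', hO', hne, hr, ?_⟩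
  rcases H with H | ⟨H, q, hq⟩
  · refine Or.inl (Set.disjoint_left.2 ?_)
    rintro _ ⟨y, rfl⟩ ⟨hc, δ, hδ⟩
    obtain ⟨χ, hχ⟩ := hpt y
    obtain ⟨ψ, -, hψ⟩ := exists_lift_of_affJet hU h hχ hδ
    exact H χ ⟨((mem_contactLocus_iff hχ n e).1 hc).2, ψ, hψ⟩
  · have hTW : ∀ y : KPoint (specOver k B), y ≫ ι ∈ contactLocus (jacobianIdeal X n) e p ∩
        Set.range fun δ : KPoint (jetScheme X m) => δ ≫ jetProj X h := by
      intro y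
      obtain ⟨χ, hχ⟩ := hpt y
      -- The zero section of the trivial bundle supplies a lift for every `k`-point of the piece,
      -- which therefore lies in the image of the projection.
      obtain ⟨σ, hσ⟩ := exists_section_affineProj (k := k) B ((m - p) * n + e)
      refine ⟨(mem_contactLocus_iff hχ n e).2 ⟨hep, H χ⟩, y ≫ σ ≫ q, ?_⟩
      change (y ≫ σ ≫ q) ≫ jetProj X h = y ≫ _
      rw [Category.assoc, Category.assoc, hq.w, ← Category.assoc σ, hσ, Category.id_comp]
    obtain ⟨θ, hθ⟩ := exists_iso_tensor_affineSpace (k := k) B ((m - p) * n + e)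
    exact Or.inr (exists_reducedLocallyClosed_of_isPullback hred himm hq
      (isReduced_specOver (k := k) (MvPolynomial (Fin ((m - p) * n + e)) B)) θ hθ hTW
      fun x hx => (mem_contactLocus_iff_proj n h hep x).1 hx.1)

end

end Jets
end

theorem mainTheorem8 {k : Type u} [Field k] [IsAlgClosed k] (X : Jets.SchOver k)
    [LocallyOfFiniteType X.hom] [QuasiCompact X.hom] :
    (∀ (m p : ℕ) (hpm : p ≤ m), m ≤ 2 * p + 1 →
      ∀ γ : Jets.KPoint (Jets.jetScheme X p),
        (∃ δ : Jets.KPoint (Jets.jetScheme X m), δ ≫ Jets.jetProj X hpm = γ) →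
        ∀ (U : X.left.Opens) (hU : ⊤ ≤ (Jets.jetMap γ).left ⁻¹ᵁ U), IsAffineOpen U →
          Nonempty (pullback (Jets.jetProj X hpm) γ ≅
            Jets.vectorSpaceScheme k (Jets.truncHom k hpm (Jets.JetOmega γ U hU)))) ∧
    (∀ n : ℕ, Jets.IsPureDimensional X.left n → (IsReduced X.left ∨ Jets.IsLCI X) →
      ∀ (m p e : ℕ) (hpm : p ≤ m), m ≤ 2 * p → p + e ≤ m →
        (∀ γ ∈ Jets.contactLocus (Jets.jacobianIdeal X n) e p,
          (∃ δ : Jets.KPoint (Jets.jetScheme X m), δ ≫ Jets.jetProj X hpm = γ) →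
          Nonempty (pullback (Jets.jetProj X hpm) γ ≅
            Jets.affineSpace k ((m - p) * n + e))) ∧
        Jets.IsPiecewiseTrivial (Jets.jetProj X hpm)
          (Jets.contactLocus (Jets.jacobianIdeal X n) e m)
          (Jets.contactLocus (Jets.jacobianIdeal X n) e p ∩
            Set.range fun δ : Jets.KPoint (Jets.jetScheme X m) => δ ≫ Jets.jetProj X hpm)
          (Jets.affineSpace k ((m - p) * n + e))) := by
  refine ⟨fun m p hpm hm γ hγ U hU hU' =>
    Jets.nonempty_pullback_iso_vectorSpaceScheme hpm hm γ hγ U hU hU', ?_⟩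
  intro n hX hX' m p e hpm hm he
  -- Pure dimensionality and the alternative between reduced and lci enter part (2) only through
  -- this vanishing.
  have h : ∀ U : X.left.Opens, IsAffineOpen U → ∀ (q : ℕ) (g : Fin q → Ω[Γ(X.left, U)⁄k]),
      Submodule.span Γ(X.left, U) (Set.range g) = ⊤ →
      Jets.fittingSpan (n - 1 : ℤ) g = (⊥ : Ideal Γ(X.left, U)) :=
    fun U hU q g hg => Jets.fittingSpan_eq_bot hX hX' hU hg
  exact ⟨fun γ hγ hδ => Jets.nonempty_pullback_iso_affineSpace h hpm hm he γ hγ hδ,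
    Jets.isPiecewiseTrivial_jetProj h hpm hm he⟩
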